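/- Model. There are $N\ge 2$ players; each has a safe arm paying the flow $s>0$ and a risky arm whose cumulative payoff in state $\theta\in\{0,1\}$ is $X^n_t=\alpha_\theta t+\sigma Z^n_t+hN^n_t$, with $\sigma,h>0$, $Z^n$ a standard Wiener process and $N^n$ a Poisson process of intensity $\lambda_\theta$, $\lambda_1\ge\lambda_0\ge 0$, all independent across players given $\theta$. Put $m_\theta=\alpha_\theta+\lambda_\theta h$ and assume $m_0<s<m_1$. The discount rate is $r>0$. The state is unknown and has common prior probability $p=\mathbb P[\theta=1]$. In the discrete game with period length $\Delta>0$, players choose between the arms only at times $0,\Delta,2\Delta,\dots$; at each such time there is first a public draw, uniform on $[0,1]$ and independent of everything else. All actions, and the payoff paths on $[\ell\Delta,(\ell+1)\Delta)$ of the risky arms in use, are publicly observed. A behavioral strategy is a measurable map from histories (with public draws) to probabilities of using the risky arm. With $\delta=e^{-r\Delta}$, player $n$'s payoff is $(1-\delta)\,\mathbb E\big[\sum_{\ell\ge0}\delta^\ell\{(1-\sigma_{n,\ell\Delta})s+\sigma_{n,\ell\Delta}m_\theta\}\big]$, where $\sigma_{n,\ell\Delta}$ is the probability with which $n$ uses the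 risky arm in period $\ell$. The belief after a history is the posterior probability of $\theta=1$ obtained from the prior and all past observations by Bayes' rule, on and off the path of play. A PBE is a strategy profile in which, after every history, each player's continuation strategy is optimal given this belief and the other players' strategies. An SSE is a PBE in which all players use the same strategy. Let $\rho=(\alpha_1-\alpha_0)^2/\sigma^2$, let $p^m=(s-m_0)/(m_1-m_0)$ be the myopic cutoff, and let $$p_1^*=\frac{\mu_1(s-m_0)}{(\mu_1+1)(m_1-s)+\mu_1(s-m_0)}$$ be the single-agent continuous-time cutoff, where $\mu_1$ is the positive solution of $\frac{\rho}{2}\mu(\mu+1)+(\lambda_1-\lambda_0)\mu+\lambda_0(\lambda_0/\lambda_1)^\mu-\lambda_0-r=0$. Proposition 8. Let $\rho=0$ and $\lambda_0=0$. For any beliefs $\underline p,\bar p$ with $p_1^*<\underline p<p^m<\bar p<1$ there exists $\bar\Delta>0$ such that for all $\Delta\in(0,\bar\Delta)$ the following hold. (1) For every prior $p\in(\underline p,1]$ there is an SSE in which, almost surely on the path of play, all players use the risky arm whenever the belief exceeds $\underline p$, and in which all players use the safe arm after every history with belief below $p_1^*$. (2) For every prior $p\in[\underline p,\bar p]$ there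 is an SSE in which each player's payoff is no larger than this player's best-reply payoff, in the same game with prior $p$, against opponents who use the risky arm if the belief lies in $[p_1^*,\underline p]\cup[\bar p,1]$ and the safe arm otherwise. -/

import Mathlib

open MeasureTheory ProbabilityTheory Filter Topology
open scoped NNReal ENNReal

/-- Primitives of the two-armed bandit problem faced by every player: discount rate `r`, flow payoff
`s` of the safe arm, volatility `σ` and lump-sum size `h` of the risky arm, and, for each state
`θ ∈ {0, 1}`, the drift `α θ` and the intensity `lam θ` of the lump-sums of the risky arm. -/
structure Bandit where
  r : ℝ
  s : ℝ
  σ : ℝ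
  h : ℝ
  α : Fin 2 → ℝ
  lam : Fin 2 → ℝ
  r_pos : 0 < r
  s_pos : 0 < s
  σ_pos : 0 < σ
  h_pos : 0 < h
  lam_zero_nonneg : 0 ≤ lam 0
  lam_le : lam 0 ≤ lam 1
  low_lt_safe : α 0 + lam 0 * h < s
  safe_lt_high : s < α 1 + lam 1 * h

/-- `N` is a Poisson process with intensity `l` under `P`. -/
structure IsPoissonProcess {Ω : Type} [MeasurableSpace Ω] (l : ℝ≥0) (N : ℝ≥0 → Ω → ℕ)
    (P : Measure Ω) : Prop where
  zero : ∀ᵐ ω ∂P, N 0 ω = 0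
  paths : ∀ᵐ ω ∂P, Monotone (fun t => N t ω) ∧
    ∀ t, ContinuousWithinAt (fun u => N u ω) (Set.Ici t) t
  incr : HasIndepIncrements N P
  law : ∀ t u, t ≤ u → HasLaw (fun ω => N u ω - N t ω) (poissonMeasure (l * (u - t))) P

namespace Bandit

variable (G : Bandit)

/-- Expected flow payoff of the risky arm in state `θ`. -/
def m (θ : Fin 2) : ℝ := G.α θ + G.lam θ * G.h

/-- Signal-to-noise ratio of the continuous payoff component. -/
noncomputable def rho : ℝ := (G.α 1 - G.α 0) ^ 2 / G.σ ^ 2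

/-- `μ` is the positive solution of the equation that determines the cutoff of the planner's
problem with `K` players. -/
def IsExponent (K : ℕ) (μ : ℝ) : Prop :=
  0 < μ ∧ G.rho / 2 * μ * (μ + 1) + (G.lam 1 - G.lam 0) * μ
    + G.lam 0 * (G.lam 0 / G.lam 1) ^ μ - G.lam 0 - G.r / K = 0

/-- The cutoff belief associated with the exponent `μ`. -/
noncomputable def cutoff (μ : ℝ) : ℝ :=
  μ * (G.s - G.m 0) / ((μ + 1) * (G.m 1 - G.s) + μ * (G.s - G.m 0))

/-- The belief at which a myopic player is indifferent between the two arms. -/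
noncomputable def myopicCutoff : ℝ := (G.s - G.m 0) / (G.m 1 - G.m 0)

/-! ### The payoff process of a risky arm over one period of length `Δ` -/

/-- Sample paths on `[0, Δ)` of the (cumulative) payoff process of a risky arm: a continuous
path plus `h` times a right-continuous counting path, both starting at `0`. The `σ`-algebra is the
one generated by the evaluations. -/
abbrev ArmPath (Δ : ℝ≥0) : Type :=
  {x : Set.Iio Δ → ℝ // ∃ (w : ℝ≥0 → ℝ) (n : ℝ≥0 → ℕ), Continuous w ∧ w 0 = 0 ∧
    Monotone n ∧ (∀ t, ContinuousWithinAt n (Set.Ici t) t) ∧ n 0 = 0 ∧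
    ∀ t : Set.Iio Δ, x t = w t + G.h * n t}

/-- `Q` is the law on path space, in state `θ`, of the payoff process
`X_t = α_θ t + σ Z_t + h N_t`, `0 ≤ t < Δ`, with `Z` a standard Wiener process and `N` an independent
Poisson process of intensity `λ_θ`. -/
def IsArmLaw (Δ : ℝ≥0) (θ : Fin 2) (Q : Measure (G.ArmPath Δ)) : Prop :=
  ∃ (Ω : Type) (_ : MeasurableSpace Ω) (P : Measure Ω) (Z : ℝ≥0 → Ω → ℝ) (N : ℝ≥0 → Ω → ℕ)
    (X : Ω → G.ArmPath Δ),
    IsProbabilityMeasure P ∧ IsBrownianReal Z P ∧ IsPoissonProcess (G.lam θ).toNNReal N P ∧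
    IndepFun (fun ω t => Z t ω) (fun ω t => N t ω) P ∧
    (∀ᵐ ω ∂P, ∀ t : Set.Iio Δ, (X ω).1 t = G.α θ * (t : ℝ≥0) + G.σ * Z t ω + G.h * N t ω) ∧
    HasLaw X Q P

/-- What is observed of one player in one period: `inl ()` if the player used the safe arm,
`inr y` if the player used the risky arm and its payoff path was `y`. -/
abbrev Obs (Δ : ℝ≥0) : Type := Unit ⊕ G.ArmPath Δ

/-! ### Histories and strategies in the game with `N` players and period length `Δ` -/

/-- Public record of one period: the public randomization draw made at the start of the period,
and the observations about all players. -/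
abbrev Period (N : ℕ) (Δ : ℝ≥0) : Type := unitInterval × (Fin N → G.Obs Δ)

/-- Information on which actions in period `ℓ` can be based: the history of the `ℓ` preceding
periods and the current public randomization draw. -/
abbrev Info (N : ℕ) (Δ : ℝ≥0) : Type := Σ ℓ : ℕ, (Fin ℓ → G.Period N Δ) × unitInterval

/-- The information at the start of the game, given the first public randomization draw. -/
def start (N : ℕ) (Δ : ℝ≥0) (u : unitInterval) : G.Info N Δ := ⟨0, (Fin.elim0, u)⟩

/-- The information in the next period, given the observations made in the current period and the
next public randomization draw. -/
def next {N : ℕ} {Δ : ℝ≥0} (x : G.Info N Δ) (y : (Fin N → G.Obs Δ) × unitInterval) : G.Info N Δ :=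
  ⟨x.1 + 1, (Fin.snoc x.2.1 (x.2.2, y.1), y.2)⟩

/-- A behavioral strategy: the probability of using the risky arm as a measurable function of the
available information. -/
structure Strategy (N : ℕ) (Δ : ℝ≥0) where
  act : G.Info N Δ → unitInterval
  measurable_act : Measurable act

/-! ### Beliefs -/

/-- Number of lump-sums along a path. -/
noncomputable def lumps {Δ : ℝ≥0} (y : G.ArmPath Δ) : ℕ := {t | ¬ ContinuousAt y.1 t}.ncard

/-- Total increment of the continuous component of a path over `[0, Δ)`. -/
noncomputable def contIncr {Δ : ℝ≥0} (y : G.ArmPath Δ) : ℝ :=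
  limUnder atTop y.1 - G.h * G.lumps y

/-- Likelihood in state `θ` of the observation of one player in one period (up to a factor that
does not depend on `θ`). -/
noncomputable def obsLikelihood {Δ : ℝ≥0} (θ : Fin 2) : G.Obs Δ → ℝ
  | Sum.inl _ => 1
  | Sum.inr y =>
      Real.exp (G.α θ * G.contIncr y / G.σ ^ 2 - G.α θ ^ 2 * Δ / (2 * G.σ ^ 2)) *
        (G.lam θ ^ G.lumps y * Real.exp (-G.lam θ * Δ))

/-- Likelihood in state `θ` of all past observations. -/
noncomputable def likelihood {N : ℕ} {Δ : ℝ≥0} (θ : Fin 2) (x : G.Info N Δ) : ℝ :=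
  ∏ i : Fin x.1, ∏ n : Fin N, G.obsLikelihood θ ((x.2.1 i).2 n)

/-- The common posterior probability of state `1`, by Bayes' rule from the prior `p`. -/
noncomputable def belief {N : ℕ} {Δ : ℝ≥0} (p : ℝ) (x : G.Info N Δ) : ℝ :=
  p * G.likelihood 1 x / (p * G.likelihood 1 x + (1 - p) * G.likelihood 0 x)

/-! ### Outcome distributions and payoffs

Below, `Q θ` is the law in state `θ` of the payoff path of a risky arm over one period. -/

section Play

variable {N : ℕ} {Δ : ℝ≥0}

lemma measurable_sigma_mk (ℓ : ℕ) :
    Measurable (fun z => (⟨ℓ, z⟩ : G.Info N Δ)) :=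
  measurable_iff_comap_le.2 (MeasurableSpace.comap_le_iff_le_map.2 (iInf_le _ ℓ))

lemma measurable_of_fibers {β : Type*} [MeasurableSpace β] {f : G.Info N Δ → β}
    (hf : ∀ ℓ, Measurable (fun z => f ⟨ℓ, z⟩)) : Measurable f := by
  intro t ht
  refine MeasurableSpace.measurableSet_iInf.2 fun ℓ => ?_
  exact hf ℓ ht

lemma measurable_next_fiber (ℓ : ℕ) :
    Measurable (fun z : ((Fin ℓ → G.Period N Δ) × unitInterval) ×
      ((Fin N → G.Obs Δ) × unitInterval) => G.next (⟨ℓ, z.1⟩ : G.Info N Δ) z.2) := by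
  unfold next
  refine (G.measurable_sigma_mk (ℓ + 1)).comp (Measurable.prodMk (measurable_pi_iff.2 fun i => ?_)
    (by fun_prop))
  refine Fin.lastCases ?_ (fun j => ?_) i
  · simp only [Fin.snoc_last]; fun_prop
  · simp only [Fin.snoc_castSucc]; fun_prop

/-- Law of the observation of one player who uses the risky arm (`a = true`) or the safe arm
(`a = false`). -/
noncomputable def obsLaw (Q : ProbabilityMeasure (G.ArmPath Δ)) (a : Bool) : Measure (G.Obs Δ) :=
  if a then (Q : Measure (G.ArmPath Δ)).map Sum.inr else Measure.dirac (Sum.inl ())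

instance (Q : ProbabilityMeasure (G.ArmPath Δ)) (a : Bool) :
    IsProbabilityMeasure (G.obsLaw Q a) := by
  unfold obsLaw
  split_ifs
  · exact Measure.isProbabilityMeasure_map measurable_inr.aemeasurable
  · infer_instance

/-- Probability of the action profile `a` if every player `n` independently uses the risky arm
with the probability given by the strategy `S n`. -/
noncomputable def profileProb (S : Fin N → G.Strategy N Δ) (x : G.Info N Δ) (a : Fin N → Bool) :
    ℝ≥0∞ :=
  ∏ n, ENNReal.ofReal (if a n then ((S n).act x : ℝ) else 1 - ((S n).act x : ℝ))

lemma measurable_profileProb (S : Fin N → G.Strategy N Δ) (a : Fin N → Bool) :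
    Measurable (fun x => G.profileProb S x a) := by
  unfold profileProb
  refine Finset.measurable_prod _ fun n _ => ENNReal.measurable_ofReal.comp ?_
  have h := measurable_subtype_coe.comp (S n).measurable_act
  split_ifs
  · exact h
  · exact measurable_const.sub h

/-- One-period transition kernel under the strategy profile `S`: independent action choices, then
independent payoff paths of the risky arms in use, then a new uniform public draw. -/
noncomputable def step (Q : ProbabilityMeasure (G.ArmPath Δ)) (S : Fin N → G.Strategy N Δ) :
    Kernel (G.Info N Δ) (G.Info N Δ) where
  toFun x := ∑ a : Fin N → Bool, G.profileProb S x a •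
    ((Measure.pi fun n => G.obsLaw Q (a n)).prod (volume : Measure unitInterval)).map (G.next x)
  measurable' := by
    refine Measure.measurable_of_measurable_coe _ fun s hs => ?_
    simp only [Measure.coe_finsetSum, Finset.sum_apply, Measure.smul_apply, smul_eq_mul]
    refine Finset.measurable_sum _ fun a _ => (G.measurable_profileProb S a).mul
      (G.measurable_of_fibers fun ℓ => ?_)
    have hm := G.measurable_next_fiber (N := N) (Δ := Δ) ℓ
    have heq : ∀ z, (((Measure.pi fun n => G.obsLaw Q (a n)).prod
        (volume : Measure unitInterval)).map (G.next ⟨ℓ, z⟩)) s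
        = ((Measure.pi fun n => G.obsLaw Q (a n)).prod (volume : Measure unitInterval))
          (Prod.mk z ⁻¹' ((fun z : ((Fin ℓ → G.Period N Δ) × unitInterval) ×
            ((Fin N → G.Obs Δ) × unitInterval) => G.next (⟨ℓ, z.1⟩ : G.Info N Δ) z.2) ⁻¹' s)) := by
      intro z
      exact Measure.map_apply (hm.comp measurable_prodMk_left) hs
    simp only [heq]
    exact measurable_measure_prodMk_left (hm hs)

/-- Distribution of the information available `j` periods later. -/
noncomputable def ahead (Q : ProbabilityMeasure (G.ArmPath Δ)) (S : Fin N → G.Strategy N Δ) :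
    ℕ → Kernel (G.Info N Δ) (G.Info N Δ)
  | 0 => Kernel.id
  | j + 1 => ahead Q S j ∘ₖ G.step Q S

/-- Distribution of the information available in period `ℓ`, from the perspective of the start of
the game with prior `p`. -/
noncomputable def pathLaw (Q : Fin 2 → ProbabilityMeasure (G.ArmPath Δ))
    (S : Fin N → G.Strategy N Δ) (p : ℝ) (ℓ : ℕ) : Measure (G.Info N Δ) :=
  ENNReal.ofReal p • ((volume : Measure unitInterval).map (G.start N Δ)).bind (G.ahead (Q 1) S ℓ) +
  ENNReal.ofReal (1 - p) •
    ((volume : Measure unitInterval).map (G.start N Δ)).bind (G.ahead (Q 0) S ℓ)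

/-- Discount factor per period. -/
noncomputable def discount (Δ : ℝ≥0) : ℝ := Real.exp (-G.r * Δ)

/-- Player `n`'s expected discounted payoff (in per-period units) conditional on state `θ`, in the
continuation of the game from the information `x` on. -/
noncomputable def statePayoff (Q : Fin 2 → ProbabilityMeasure (G.ArmPath Δ))
    (S : Fin N → G.Strategy N Δ) (n : Fin N) (θ : Fin 2) (x : G.Info N Δ) : ℝ :=
  (1 - G.discount Δ) * ∑' j : ℕ, G.discount Δ ^ j *
    ∫ y, ((1 - ((S n).act y : ℝ)) * G.s + ((S n).act y : ℝ) * G.m θ) ∂(G.ahead (Q θ) S j x)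

/-- Player `n`'s expected continuation payoff from the information `x` on, if state `1` has
probability `q`. -/
noncomputable def contPayoff (Q : Fin 2 → ProbabilityMeasure (G.ArmPath Δ))
    (S : Fin N → G.Strategy N Δ) (n : Fin N) (q : ℝ) (x : G.Info N Δ) : ℝ :=
  q * G.statePayoff Q S n 1 x + (1 - q) * G.statePayoff Q S n 0 x

/-- Player `n`'s expected payoff in the game with prior `p`. -/
noncomputable def payoff (Q : Fin 2 → ProbabilityMeasure (G.ArmPath Δ))
    (S : Fin N → G.Strategy N Δ) (n : Fin N) (p : ℝ) : ℝ :=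
  ∫ u : unitInterval, G.contPayoff Q S n p (G.start N Δ u)

/-- Player `n`'s best-reply payoff against the opponents' strategies in `S`, with prior `p`. -/
noncomputable def bestReplyPayoff (Q : Fin 2 → ProbabilityMeasure (G.ArmPath Δ))
    (S : Fin N → G.Strategy N Δ) (n : Fin N) (p : ℝ) : ℝ :=
  ⨆ T : G.Strategy N Δ, G.payoff Q (Function.update S n T) n p

/-- Perfect Bayesian equilibrium of the game with prior `p`: after every history, on and off the
path, every player's continuation strategy is optimal given the posterior belief. -/
def IsPBE (Q : Fin 2 → ProbabilityMeasure (G.ArmPath Δ)) (p : ℝ) (S : Fin N → G.Strategy N Δ) :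
    Prop :=
  ∀ (x : G.Info N Δ) (n : Fin N) (T : G.Strategy N Δ),
    G.contPayoff Q (Function.update S n T) n (G.belief p x) x ≤
      G.contPayoff Q S n (G.belief p x) x

/-- Strongly symmetric equilibrium: a perfect Bayesian equilibrium in which all players use the
same strategy. -/
def IsSSE (Q : Fin 2 → ProbabilityMeasure (G.ArmPath Δ)) (p : ℝ) (S : Fin N → G.Strategy N Δ) :
    Prop :=
  G.IsPBE Q p S ∧ ∀ (n n' : Fin N) (x : G.Info N Δ), (S n).act x = (S n').act x

end Play
end Bandit

/-!
As long as no lump-sum has arrived, the odds ratio of the belief is a function of the number `j` of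
failed experiments, `X * q ^ j`, and the first lump-sum reveals the good state. Weighting the
payoff losses relative to full information by the likelihood of failure turns the discrete game
into a deterministic recursion for costs along this grid, in which all expectations are binomial.

Three ranges of odds ratios matter. Below `lowCut` nobody experiments, even if rewarded by the
optimal continuation. Between `lowCut` and `highCut` there is a symmetric mixed equilibrium of the
stage game, found by backward induction on the grid: the saving due to one more failure varies so
little over a round that an intermediate value argument yields the mixing probability. Above
`highCut` there are two modes. In the normal mode everybody experiments, and a deviation leads to
the punishment mode, in which everybody uses the safe arm and a public lottery, after compliance,
restores the normal mode with just the probability that makes players indifferent to experimenting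
on their own. For short periods this deters deviations in the normal mode, because many rounds of
joint experimentation are ahead there. Lone experimentation is also what a player does against
opponents who only experiment at intermediate or very high beliefs, whence the payoff comparison in
the second part.

Both cutoffs tend to `r / (r + λ₁)`, the odds ratio of the belief `p₁*`, as the period length tends
to zero; the lower one does so from above.
-/

/-- Expectation of `g K` for a binomial random variable `K` with parameters `M` and `π`. -/
noncomputable def binomExp : ℕ → ℝ → (ℕ → ℝ) → ℝ
  | 0, _, g => g 0
  | M + 1, π, g => (1 - π) * binomExp M π g + π * binomExp M π (fun k => g (k + 1))

lemma binomExp_add (M : ℕ) (π : ℝ) (g f : ℕ → ℝ) :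
    binomExp M π (fun k => g k + f k) = binomExp M π g + binomExp M π f := by
  induction M generalizing g f with
  | zero => rfl
  | succ M ih =>
    simp only [binomExp, ih g f, ih (fun k => g (k + 1)) (fun k => f (k + 1))]
    ring

lemma binomExp_const_mul (M : ℕ) (π a : ℝ) (g : ℕ → ℝ) :
    binomExp M π (fun k => a * g k) = a * binomExp M π g := by
  induction M generalizing g with
  | zero => rfl
  | succ M ih =>
    simp only [binomExp, ih g, ih (fun k => g (k + 1))]
    ring

lemma binomExp_sub (M : ℕ) (π : ℝ) (g f : ℕ → ℝ) :
    binomExp M π (fun k => g k - f k) = binomExp M π g - binomExp M π f := by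
  have h := binomExp_add M π (fun k => g k - f k) f
  simp only [sub_add_cancel] at h
  exact eq_sub_of_add_eq h.symm

lemma binomExp_const (M : ℕ) (π a : ℝ) : binomExp M π (fun _ => a) = a := by
  induction M with
  | zero => rfl
  | succ M ih => simp only [binomExp, ih]; ring

lemma binomExp_mono {M : ℕ} {π : ℝ} (h0 : 0 ≤ π) (h1 : π ≤ 1) {g f : ℕ → ℝ}
    (h : ∀ k ≤ M, g k ≤ f k) : binomExp M π g ≤ binomExp M π f := by
  induction M generalizing g f with
  | zero => exact h 0 le_rfl
  | succ M ih =>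
    have hsafe := ih fun k hk => h k (by omega)
    have hrisky := ih fun k hk => h (k + 1) (by omega)
    have : 0 ≤ 1 - π := by linarith
    simp only [binomExp]
    gcongr

@[simp] lemma binomExp_zero (M : ℕ) (g : ℕ → ℝ) : binomExp M 0 g = g 0 := by
  induction M generalizing g with
  | zero => rfl
  | succ M ih => simp [binomExp, ih]

@[simp] lemma binomExp_one (M : ℕ) (g : ℕ → ℝ) : binomExp M 1 g = g M := by
  induction M generalizing g with
  | zero => rfl
  | succ M ih => simp [binomExp, ih]

lemma continuous_binomExp (M : ℕ) {g : ℝ → ℕ → ℝ} (hg : ∀ k, Continuous fun π => g π k) :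
    Continuous fun π => binomExp M π (g π) := by
  induction M generalizing g with
  | zero => exact hg 0
  | succ M ih =>
    have := ih hg
    have hrisky := ih (g := fun π k => g π (k + 1)) fun k => hg (k + 1)
    simp only [binomExp]
    fun_prop

lemma binomExp_natCast (M : ℕ) (π : ℝ) : binomExp M π (fun k => (k : ℝ)) = M * π := by
  induction M with
  | zero => simp [binomExp]
  | succ M ih =>
    simp only [binomExp, ih, Nat.cast_add, Nat.cast_one, binomExp_add, binomExp_const]
    ring

lemma binomExp_ite_eq_zero (M : ℕ) (π a : ℝ) :
    binomExp M π (fun k => if k = 0 then a else 0) = (1 - π) ^ M * a := by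
  induction M with
  | zero => simp [binomExp]
  | succ M ih =>
    simp only [binomExp, ih, Nat.add_eq_zero_iff, one_ne_zero, and_false, if_false,
      binomExp_const]
    ring

lemma binomExp_le_of_forall_pos_le {M : ℕ} {π B : ℝ} (h0 : 0 ≤ π) (h1 : π ≤ 1) {g : ℕ → ℝ}
    (h : ∀ k, 1 ≤ k → k ≤ M → g k ≤ B) :
    binomExp M π g ≤ (1 - π) ^ M * g 0 + (1 - (1 - π) ^ M) * B := by
  have hle : binomExp M π g ≤ binomExp M π (fun k => (if k = 0 then g 0 - B else 0) + B) := by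
    refine binomExp_mono h0 h1 fun k hk => ?_
    rcases Nat.eq_zero_or_pos k with rfl | hk0
    · simp
    · simpa [hk0.ne'] using h k hk0 hk
  rw [binomExp_add, binomExp_const, binomExp_ite_eq_zero] at hle
  linarith

lemma le_binomExp_of_forall_pos_le {M : ℕ} {π B : ℝ} (h0 : 0 ≤ π) (h1 : π ≤ 1) {g : ℕ → ℝ}
    (h : ∀ k, 1 ≤ k → k ≤ M → B ≤ g k) :
    (1 - π) ^ M * g 0 + (1 - (1 - π) ^ M) * B ≤ binomExp M π g := by
  have hneg := binomExp_le_of_forall_pos_le (B := -B) h0 h1 (g := fun k => -1 * g k)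
    fun k hk hk' => by linarith [h k hk hk']
  rw [binomExp_const_mul] at hneg
  linarith

lemma downward_induction {T : ℕ → Prop} (J : ℕ) (base : ∀ j ≥ J, T j)
    (step : ∀ j, (∀ k > j, T k) → T j) (j : ℕ) : T j := by
  have h : ∀ n j, J ≤ j + n → T j := by
    intro n
    induction n with
    | zero => exact fun j hj => base j hj
    | succ n ih => exact fun j hj => step j fun k hk => ih k (by omega)
  exact h J j (by omega)

lemma exists_seq_downward {α : Type*} (P : ℕ → (ℕ → α) → Prop)
    (hP : ∀ j f g, (∀ k ≥ j, f k = g k) → P j f → P j g) (J : ℕ) (f₀ : ℕ → α)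
    (base : ∀ j ≥ J, P j f₀)
    (step : ∀ j f, (∀ k > j, P k f) → ∃ v, P j (Function.update f j v)) :
    ∃ f, ∀ j, P j f := by
  have h : ∀ n, ∃ f, ∀ j, J ≤ j + n → P j f := by
    intro n
    induction n with
    | zero => exact ⟨f₀, fun j hj => base j hj⟩
    | succ n ih =>
      obtain ⟨f, hf⟩ := ih
      by_cases hn : J ≤ n
      · exact ⟨f, fun j hj => hf j (by omega)⟩
      obtain ⟨v, hv⟩ := step (J - (n + 1)) f fun k hk => hf k (by omega)
      refine ⟨Function.update f (J - (n + 1)) v, fun j hj => ?_⟩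
      rcases eq_or_lt_of_le (show J - (n + 1) ≤ j by omega) with rfl | hlt
      · exact hv
      · refine hP j f _ (fun k hk => ?_) (hf j (by omega))
        rw [Function.update_of_ne (by omega)]
  obtain ⟨f, hf⟩ := h J
  exact ⟨f, fun j => hf j (by omega)⟩

/-- Odds ratio below which a single player gives up experimenting in the discrete game with
discount factor `δ` and failure probability `q`. -/
noncomputable def lowCut (δ q : ℝ) : ℝ := (1 - δ) / (1 - δ * q)

/-- Odds ratio above which experimentation is worthwhile for one round even if `M` opponents
experiment as well and everybody gives up afterwards. -/
noncomputable def highCut (M : ℕ) (δ q : ℝ) : ℝ := (1 - δ) / (1 - δ + δ * q ^ M * (1 - q))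

/-- Admissible discount factors `δ` and probabilities `q` that a risky arm in the good state
generates no lump-sum within a period. -/
structure Rates (δ q : ℝ) : Prop where
  δ_pos : 0 < δ
  δ_lt : δ < 1
  q_pos : 0 < q
  q_lt : q < 1

namespace Rates

variable {δ q : ℝ} (H : Rates δ q)
include H

lemma one_sub_δ_pos : 0 < 1 - δ := sub_pos.2 H.δ_lt

lemma one_sub_q_pos : 0 < 1 - q := sub_pos.2 H.q_lt

lemma δq_lt : δ * q < 1 := mul_lt_one_of_nonneg_of_lt_one_left H.δ_pos.le H.δ_lt H.q_lt.le

lemma pow_le_one (k : ℕ) : q ^ k ≤ 1 := pow_le_one₀ H.q_pos.le H.q_lt.le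

lemma pow_le_self {k : ℕ} (hk : 1 ≤ k) : q ^ k ≤ q :=
  pow_le_of_le_one H.q_pos.le H.q_lt.le (by omega)

lemma one_sub_pow_le (k : ℕ) : 1 - q ^ k ≤ k * (1 - q) := by
  have := one_add_mul_le_pow (a := q - 1) (by linarith [H.q_pos]) k
  rw [add_sub_cancel] at this
  linarith

lemma lowCut_mul : lowCut δ q * (1 - δ * q) = 1 - δ :=
  div_mul_cancel₀ _ (by linarith [H.δq_lt])

lemma lowCut_pos : 0 < lowCut δ q := div_pos H.one_sub_δ_pos (by linarith [H.δq_lt])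

lemma lowCut_indiff : (1 - δ) * (1 - lowCut δ q) = δ * (lowCut δ q * (1 - q)) := by
  linear_combination (-1 : ℝ) * H.lowCut_mul

lemma lowCut_lt_one : lowCut δ q < 1 :=
  (div_lt_one (by linarith [H.δq_lt])).2 (by nlinarith [H.δ_pos, H.q_lt])

lemma highDen_pos (M : ℕ) : 0 < 1 - δ + δ * q ^ M * (1 - q) :=
  add_pos H.one_sub_δ_pos (mul_pos (mul_pos H.δ_pos (pow_pos H.q_pos M)) H.one_sub_q_pos)

lemma highCut_mul (M : ℕ) : highCut M δ q * (1 - δ + δ * q ^ M * (1 - q)) = 1 - δ :=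
  div_mul_cancel₀ _ (H.highDen_pos M).ne'

lemma highCut_pos (M : ℕ) : 0 < highCut M δ q := div_pos H.one_sub_δ_pos (H.highDen_pos M)

lemma highCut_indiff (M : ℕ) :
    (1 - δ) * (1 - highCut M δ q) = δ * (highCut M δ q * q ^ M * (1 - q)) := by
  linear_combination (-1 : ℝ) * H.highCut_mul M

lemma highCut_lt_one (M : ℕ) : highCut M δ q < 1 :=
  (div_lt_one (H.highDen_pos M)).2 <| lt_add_of_pos_right _ <|
    mul_pos (mul_pos H.δ_pos (pow_pos H.q_pos M)) H.one_sub_q_pos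

lemma lowCut_lt_highCut {M : ℕ} (hM : 1 ≤ M) : lowCut δ q < highCut M δ q := by
  refine div_lt_div_of_pos_left H.one_sub_δ_pos (H.highDen_pos M) ?_
  have hpow : δ * q ^ M * (1 - q) < δ * 1 * (1 - q) := by
    have := H.δ_pos
    have := H.one_sub_q_pos
    have := (H.pow_le_self hM).trans_lt H.q_lt
    gcongr
  linarith

lemma highCut_mul_pow_le (M : ℕ) : highCut M δ q * q ^ M ≤ lowCut δ q := by
  have hd : 0 < 1 - δ * q := by linarith [H.δq_lt]
  unfold lowCut highCut
  rw [div_mul_eq_mul_div, div_le_div_iff₀ (H.highDen_pos M) hd]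
  have hqM : q ^ M * (1 - δ) ≤ 1 - δ := mul_le_of_le_one_left H.one_sub_δ_pos.le (H.pow_le_one M)
  nlinarith [H.one_sub_δ_pos]

end Rates

/-- Smallness conditions on the period length in a game with `M` opponents; `π₀` is an upper bound
on the probability with which a player uses the risky arm in a mixed equilibrium. -/
structure FinePeriod (M : ℕ) (δ q π₀ : ℝ) : Prop extends Rates δ q where
  one_le : 1 ≤ M
  π_pos : 0 < π₀
  mul_π_le : M * π₀ ≤ 1 / 8
  pow_le : 1 - q ^ (M + 1) ≤ 1 / 8
  mixing : 10 * (M + 1) * (1 - q) * (M * π₀) ≤ 1 - δ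
  impatience : 8 * (M + 1) * (1 - δ) < δ ^ 2 * π₀
  cut_gap : 8 * (M + 1) * (1 - q) ≤ 1 - lowCut δ q

/-- Expected cost of using the safe arm once at the odds ratio `x` if `M` opponents use the risky
arm with probability `π` and `f k` is the cost of continuing after `k` failed experiments. The unit
of costs is the cost of using the risky arm forever in the bad state. -/
noncomputable def safeCost (M : ℕ) (δ x π : ℝ) (f : ℕ → ℝ) : ℝ :=
  (1 - δ) * x + δ * binomExp M π f

/-- Expected cost of using the risky arm once, in the situation of `safeCost`. -/
noncomputable def riskyCost (M : ℕ) (δ π : ℝ) (f : ℕ → ℝ) : ℝ :=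
  (1 - δ) + δ * binomExp M π (fun k => f (k + 1))

lemma riskyCost_update_zero (M : ℕ) (δ π v : ℝ) (f : ℕ → ℝ) :
    riskyCost M δ π (Function.update f 0 v) = riskyCost M δ π f := by
  simp [riskyCost]

/-- Decrease of the odds ratio caused by a failed experiment at the lower cutoff. -/
noncomputable def lowStep (δ q : ℝ) : ℝ := lowCut δ q * (1 - q)

/-- Range of the cost reductions due to a failed experiment near the lower cutoff: they agree with
`lowStep` up to a relative error of four times the success probability of `M + 1` experiments. -/
def savingRange (M : ℕ) (δ q : ℝ) : Set ℝ :=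
  Set.Icc (lowStep δ q * (1 - 4 * (1 - q ^ (M + 1)))) (lowStep δ q * (1 + 4 * (1 - q ^ (M + 1))))

/-- Properties of the costs `φ k` after `k ≥ 1` failed experiments that drive the backward
induction at the odds ratio `y`. -/
structure ContinuationCost (M : ℕ) (δ q y : ℝ) (φ : ℕ → ℝ) : Prop where
  ge : ∀ k, 1 ≤ k → k ≤ M + 1 → lowCut δ q * q ^ (M + 1) ≤ φ k
  sub_mem : ∀ k, 1 ≤ k → k ≤ M → φ k - φ (k + 1) ∈ savingRange M δ q
  le : φ 1 ≤ y * q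

/-- Mixing with probability `π` at the odds ratio `y`, where `φ 0` is the equilibrium cost and `φ k`
the cost after `k` failed experiments. -/
structure MixedCost (M : ℕ) (δ q y π : ℝ) (φ : ℕ → ℝ) : Prop where
  nonneg : 0 ≤ π
  le_one : π ≤ 1
  risky : riskyCost M δ π φ = φ 0
  safe : safeCost M δ y π φ = φ 0
  le : φ 0 ≤ y
  ge : lowCut δ q * q ^ (M + 1) ≤ φ 0
  sub_mem : φ 0 - φ 1 ∈ savingRange M δ q
  slack : ∀ z, z * q ^ M = y → (1 - δ) * (1 - z) ≤ δ * (φ 0 - φ 1)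

lemma ContinuationCost.one_sub_le {M : ℕ} {δ q y : ℝ} {φ : ℕ → ℝ}
    (hφ : ContinuationCost M δ q y φ) {k : ℕ} (hk : k ≤ M) :
    φ 1 - φ (k + 1) ≤ lowStep δ q * (1 + 4 * (1 - q ^ (M + 1))) * k := by
  induction k with
  | zero => simp
  | succ k ih =>
    have := (hφ.sub_mem (k + 1) (by omega) hk).2
    push_cast
    linarith [ih (by omega)]

lemma binomExp_saving {M : ℕ} {δ y π v : ℝ} {φ : ℕ → ℝ} (hv : riskyCost M δ π φ = v)
    (hS : safeCost M δ y π (Function.update φ 0 v) = v) :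
    δ * binomExp M π (fun k => Function.update φ 0 v k - φ (k + 1)) = (1 - δ) * (1 - y) := by
  rw [binomExp_sub]
  unfold riskyCost at hv
  unfold safeCost at hS
  linarith

namespace FinePeriod

variable {M : ℕ} {δ q π₀ : ℝ} (H : FinePeriod M δ q π₀)
include H

lemma pow_ge {k : ℕ} (hk : k ≤ M + 1) : 7 / 8 ≤ q ^ k := by
  have := pow_le_pow_of_le_one H.q_pos.le H.q_lt.le hk
  linarith [H.pow_le]

lemma one_sub_pow_succ_nonneg : 0 ≤ 1 - q ^ (M + 1) := sub_nonneg.2 (H.pow_le_one _)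

lemma one_sub_pow_succ_le : 1 - q ^ (M + 1) ≤ (M + 1) * (1 - q) :=
  mod_cast H.one_sub_pow_le (M + 1)

lemma lowCut_lt_highCut : lowCut δ q < highCut M δ q := H.toRates.lowCut_lt_highCut H.one_le

lemma lowStep_pos : 0 < lowStep δ q := mul_pos H.lowCut_pos H.one_sub_q_pos

lemma lowCut_mul_pow_le : lowCut δ q * q ^ (M + 1) ≤ lowCut δ q :=
  mul_le_of_le_one_right H.lowCut_pos.le (H.pow_le_one _)

lemma π_le : π₀ ≤ 1 / 8 := by
  have hM : (1 : ℝ) ≤ M := mod_cast H.one_le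
  nlinarith [H.mul_π_le, H.π_pos]

lemma π_le_one : π₀ ≤ 1 := H.π_le.trans (by norm_num)

lemma nonneg_of_mem_savingRange {d : ℝ} (hd : d ∈ savingRange M δ q) : 0 ≤ d :=
  (mul_nonneg H.lowStep_pos.le (by linarith [H.pow_le])).trans hd.1

lemma highCut_sub_le : highCut M δ q - lowCut δ q * q ^ (M + 1) ≤
    4 * (M + 1) * lowStep δ q := by
  set d := highCut M δ q - lowCut δ q * q ^ (M + 1) with hd
  have hd0 : 0 ≤ d := by linarith [H.lowCut_lt_highCut, H.lowCut_mul_pow_le]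
  have hpow := H.one_sub_pow_le (M + (M + 1))
  rw [pow_add] at hpow
  push_cast at hpow
  have hmul : d * q ^ M ≤ lowCut δ q * ((M + (M + 1)) * (1 - q)) := by
    calc d * q ^ M ≤ lowCut δ q * (1 - q ^ M * q ^ (M + 1)) := by
          rw [hd]; linarith [H.highCut_mul_pow_le M]
      _ ≤ _ := mul_le_mul_of_nonneg_left hpow H.lowCut_pos.le
  have hge : d * (7 / 8) ≤ d * q ^ M := mul_le_mul_of_nonneg_left (H.pow_ge (by omega)) hd0
  have hstep := H.lowStep_pos
  have hMstep : 0 ≤ M * lowStep δ q := by positivity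
  unfold lowStep at *
  linarith

lemma le_indiff {y : ℝ} (hy' : y < highCut M δ q) :
    δ * (lowStep δ q * (1 - (1 - q ^ (M + 1)))) ≤ (1 - δ) * (1 - y) := by
  have hcut : lowCut δ q * q ^ (M + 1) ≤ highCut M δ q * q ^ M := by
    have := H.lowCut_lt_highCut.le
    have := H.q_pos
    have := H.highCut_pos M
    have := pow_le_pow_of_le_one H.q_pos.le H.q_lt.le M.le_succ
    gcongr
  calc δ * (lowStep δ q * (1 - (1 - q ^ (M + 1))))
      = δ * (lowCut δ q * q ^ (M + 1) * (1 - q)) := by unfold lowStep; ring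
    _ ≤ δ * (highCut M δ q * q ^ M * (1 - q)) := by
        have := H.δ_pos.le
        have := H.one_sub_q_pos.le
        gcongr
    _ = (1 - δ) * (1 - highCut M δ q) := (H.highCut_indiff M).symm
    _ ≤ (1 - δ) * (1 - y) := mul_le_mul_of_nonneg_left (by linarith) H.one_sub_δ_pos.le

lemma indiff_le {y : ℝ} (hy : lowCut δ q < y) : (1 - δ) * (1 - y) ≤ δ * lowStep δ q := by
  rw [lowStep, ← H.lowCut_indiff]
  exact mul_le_mul_of_nonneg_left (by linarith) H.one_sub_δ_pos.le

lemma lowStep_le_sub {y : ℝ} (hy : lowCut δ q < y) {z : ℝ}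
    (hz : z * q ^ M = y) : lowStep δ q ≤ z - y := by
  have hz0 : 0 < z := pos_of_mul_pos_left (hz ▸ H.lowCut_pos.trans hy) (pow_pos H.q_pos M).le
  have hyz : y ≤ z * q := hz ▸ mul_le_mul_of_nonneg_left (H.pow_le_self H.one_le) hz0.le
  have hlt : lowCut δ q ≤ z := hy.le.trans (hyz.trans (mul_le_of_le_one_right hz0.le H.q_lt.le))
  have := mul_le_mul_of_nonneg_right hlt H.one_sub_q_pos.le
  unfold lowStep
  linarith

lemma pow_one_sub_ge {π : ℝ} (hπ : π ≤ π₀) : 1 - M * π₀ ≤ (1 - π) ^ M := by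
  have hbern := one_add_mul_le_pow (a := -π) (by linarith [H.π_le_one]) M
  rw [← sub_eq_add_neg] at hbern
  have : (M : ℝ) * π ≤ M * π₀ := by gcongr
  linarith

-- The error of the saving estimate is absorbed by the odds `z - y` lost in a round of failures.
lemma saving_error_le {y π : ℝ} (hπ : π ∈ Set.Icc 0 π₀) (hy : lowCut δ q < y)
    {z : ℝ} (hz : z * q ^ M = y) :
    δ * ((1 - (1 - π) ^ M) * (5 * (1 - q ^ (M + 1)) * lowStep δ q)) ≤
      (1 - π) ^ M * ((1 - δ) * (z - y)) := by
  set P := (1 - π) ^ M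
  set ε := 1 - q ^ (M + 1)
  set u := lowStep δ q
  have hu : 0 < u := H.lowStep_pos
  have hε0 : 0 ≤ ε := H.one_sub_pow_succ_nonneg
  have hP : 1 - M * π₀ ≤ P := H.pow_one_sub_ge hπ.2
  have hP1 : P ≤ 1 := pow_le_one₀ (by linarith [hπ.2, H.π_le_one]) (by linarith [hπ.1])
  have hδ : 0 < (1 - δ) * u := mul_pos H.one_sub_δ_pos hu
  calc δ * ((1 - P) * (5 * ε * u)) ≤ (1 - P) * (5 * ε * u) :=
        mul_le_of_le_one_left (mul_nonneg (by linarith) (by positivity)) H.δ_lt.le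
    _ ≤ M * π₀ * (5 * ((M + 1) * (1 - q)) * u) := by
        have : 0 ≤ M * π₀ := mul_nonneg M.cast_nonneg H.π_pos.le
        have : 1 - P ≤ M * π₀ := by linarith
        have := H.one_sub_pow_succ_le
        gcongr
    _ ≤ (1 - δ) / 2 * u := by
        have := mul_le_mul_of_nonneg_right H.mixing hu.le
        linarith
    _ ≤ P * ((1 - δ) * u) := by nlinarith [H.mul_π_le]
    _ ≤ P * ((1 - δ) * (z - y)) := by
        have := H.one_sub_δ_pos.le
        have := H.lowStep_le_sub hy hz
        have : 0 ≤ P := by linarith [H.mul_π_le]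
        gcongr

section Mixing

variable {y : ℝ} {φ : ℕ → ℝ} (hφ : ContinuationCost M δ q y φ)

include hφ

lemma cont_le_cont_one {k : ℕ} (hk : 1 ≤ k) (hk' : k ≤ M + 1) : φ k ≤ φ 1 := by
  induction k, hk using Nat.le_induction with
  | base => rfl
  | succ k hk ih =>
    have := H.nonneg_of_mem_savingRange (hφ.sub_mem k hk (by omega))
    linarith [ih (by omega)]

lemma riskyCost_le (hy : lowCut δ q < y) {π : ℝ} (h0 : 0 ≤ π) (h1 : π ≤ 1) :
    riskyCost M δ π φ ≤ y := by
  have hexp : binomExp M π (fun k => φ (k + 1)) ≤ y * q := by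
    rw [← binomExp_const M π (y * q)]
    exact binomExp_mono h0 h1 fun k hk => (H.cont_le_cont_one hφ (by omega) (by omega)).trans hφ.le
  have hcut : 1 - δ ≤ y * (1 - δ * q) := by
    rw [← H.lowCut_mul]
    exact mul_le_mul_of_nonneg_right hy.le (by linarith [H.δq_lt])
  have := mul_le_mul_of_nonneg_left hexp H.δ_pos.le
  unfold riskyCost
  linarith

lemma le_riskyCost {π : ℝ} (h0 : 0 ≤ π) (h1 : π ≤ 1) :
    lowCut δ q * q ^ (M + 1) ≤ riskyCost M δ π φ := by
  have hexp : lowCut δ q * q ^ (M + 1) ≤ binomExp M π (fun k => φ (k + 1)) := by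
    conv_lhs => rw [← binomExp_const M π (lowCut δ q * q ^ (M + 1))]
    exact binomExp_mono h0 h1 fun k hk => hφ.ge _ (by omega) (by omega)
  have hone := H.lowCut_mul_pow_le.trans H.lowCut_lt_one.le
  unfold riskyCost
  nlinarith [H.δ_pos, H.δ_lt]

lemma riskyCost_sub_ge (hy0 : 0 < y) (hy' : y < highCut M δ q) :
    δ * (lowStep δ q / 2) ≤ riskyCost M δ π₀ φ - φ 1 := by
  set u := lowStep δ q
  set ε := 1 - q ^ (M + 1)
  have hu := H.lowStep_pos
  have hε : ε ≤ 1 / 8 := H.pow_le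
  have : 0 ≤ ε := H.one_sub_pow_succ_nonneg
  have hdrop : φ 1 - binomExp M π₀ (fun k => φ (k + 1)) ≤ u * (1 + 4 * ε) * (M * π₀) := by
    rw [← binomExp_const M π₀ (φ 1), ← binomExp_sub, ← binomExp_natCast, ← binomExp_const_mul]
    exact binomExp_mono H.π_pos.le H.π_le_one fun k hk => by
      simpa only [binomExp_const] using hφ.one_sub_le hk
  have hsmall : u * (1 + 4 * ε) * (M * π₀) ≤ u * (3 / 16) := by
    calc u * (1 + 4 * ε) * (M * π₀) ≤ u * (1 + 4 * (1 / 8)) * (1 / 8) := by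
          have := mul_nonneg (Nat.cast_nonneg M) H.π_pos.le
          have := H.mul_π_le
          gcongr
      _ = u * (3 / 16) := by ring
  have hgain : δ * (u * (7 / 8)) ≤ (1 - δ) * (1 - φ 1) := by
    calc δ * (u * (7 / 8)) ≤ δ * (u * (1 - ε)) := by
          have := H.δ_pos.le
          gcongr
          linarith
      _ ≤ (1 - δ) * (1 - y) := H.le_indiff hy'
      _ ≤ (1 - δ) * (1 - φ 1) := by
          have := hφ.le.trans (mul_le_of_le_one_right hy0.le H.q_lt.le)
          exact mul_le_mul_of_nonneg_left (by linarith) H.one_sub_δ_pos.le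
  have hδ := mul_le_mul_of_nonneg_left (hdrop.trans hsmall) H.δ_pos.le
  have : 0 < δ * u := mul_pos H.δ_pos hu
  unfold riskyCost
  linarith

lemma sub_riskyCost_le (hy' : y < highCut M δ q) {π : ℝ} (h0 : 0 ≤ π) (h1 : π ≤ 1) :
    y - riskyCost M δ π φ ≤ 4 * (M + 1) * lowStep δ q := by
  linarith [H.le_riskyCost hφ h0 h1, H.highCut_sub_le]

lemma safeCost_le_riskyCost (hy0 : 0 < y) (hy' : y < highCut M δ q) :
    safeCost M δ y π₀ (Function.update φ 0 (riskyCost M δ π₀ φ)) ≤ riskyCost M δ π₀ φ := by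
  set v := riskyCost M δ π₀ φ
  set P := (1 - π₀) ^ M
  have hP : P ≤ 1 - π₀ :=
    pow_le_of_le_one (by linarith [H.π_le]) (by linarith [H.π_pos]) (by linarith [H.one_le])
  have hexp : binomExp M π₀ (Function.update φ 0 v) ≤ P * v + (1 - P) * φ 1 := by
    simpa using binomExp_le_of_forall_pos_le (B := φ 1) H.π_pos.le H.π_le_one
      (g := Function.update φ 0 v) fun k hk hk' => by
        rw [Function.update_of_ne (by omega)]
        exact H.cont_le_cont_one hφ hk (by omega)
  have hsub := H.riskyCost_sub_ge hφ hy0 hy'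
  have hu := H.lowStep_pos
  have hδ := H.δ_pos
  have hgain : δ * (π₀ * (δ * (lowStep δ q / 2))) ≤ δ * ((1 - P) * (v - φ 1)) := by
    have := H.π_pos
    have : π₀ ≤ 1 - P := by linarith
    have : 0 ≤ 1 - P := by linarith
    gcongr
  have hloss := mul_le_mul_of_nonneg_left
    (H.sub_riskyCost_le hφ hy' H.π_pos.le H.π_le_one) H.one_sub_δ_pos.le
  have himp := mul_le_mul_of_nonneg_right H.impatience.le (half_pos hu).le
  have := mul_le_mul_of_nonneg_left hexp hδ.le
  unfold safeCost
  linarith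

lemma exists_safeCost_eq_riskyCost (hy : lowCut δ q < y) (hy' : y < highCut M δ q) :
    ∃ π ∈ Set.Icc 0 π₀,
      safeCost M δ y π (Function.update φ 0 (riskyCost M δ π φ)) = riskyCost M δ π φ := by
  have hcont : Continuous fun π => riskyCost M δ π φ := by
    have := continuous_binomExp M (g := fun _ k => φ (k + 1)) fun k => continuous_const
    unfold riskyCost
    fun_prop
  have hcont' : Continuous fun π =>
      safeCost M δ y π (Function.update φ 0 (riskyCost M δ π φ)) - riskyCost M δ π φ := by
    have := continuous_binomExp M
      (g := fun π => Function.update φ 0 (riskyCost M δ π φ)) fun k => by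
        simp only [Function.update_apply]
        split_ifs <;> fun_prop
    unfold safeCost
    fun_prop
  have hzero : riskyCost M δ 0 φ ≤ safeCost M δ y 0 (Function.update φ 0 (riskyCost M δ 0 φ)) := by
    have := mul_le_mul_of_nonneg_left (H.riskyCost_le hφ hy le_rfl zero_le_one) H.one_sub_δ_pos.le
    simp only [safeCost, binomExp_zero, Function.update_self]
    linarith
  obtain ⟨π, hπ, hroot⟩ := intermediate_value_Icc' H.π_pos.le hcont'.continuousOn
    ⟨sub_nonpos.2 (H.safeCost_le_riskyCost hφ (H.lowCut_pos.trans hy) hy'), sub_nonneg.2 hzero⟩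
  exact ⟨π, hπ, sub_eq_zero.1 hroot⟩

end Mixing

section Indifference

variable {y π v : ℝ} {φ : ℕ → ℝ} (hφ : ContinuationCost M δ q y φ) (hπ : π ∈ Set.Icc 0 π₀)
  (hv : riskyCost M δ π φ = v) (hS : safeCost M δ y π (Function.update φ 0 v) = v)

include hφ hπ hv hS

lemma saving_le :
    δ * ((1 - π) ^ M * (v - φ 1) +
      (1 - (1 - π) ^ M) * (lowStep δ q * (1 - 4 * (1 - q ^ (M + 1))))) ≤ (1 - δ) * (1 - y) := by
  rw [← binomExp_saving hv hS]
  refine mul_le_mul_of_nonneg_left ?_ H.δ_pos.le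
  simpa using le_binomExp_of_forall_pos_le hπ.1 (hπ.2.trans H.π_le_one)
    (g := fun k => Function.update φ 0 v k - φ (k + 1)) fun k hk hk' => by
      rw [Function.update_of_ne (by omega)]
      exact (hφ.sub_mem k hk hk').1

lemma le_saving :
    (1 - δ) * (1 - y) ≤ δ * ((1 - π) ^ M * (v - φ 1) +
      (1 - (1 - π) ^ M) * (lowStep δ q * (1 + 4 * (1 - q ^ (M + 1))))) := by
  rw [← binomExp_saving hv hS]
  refine mul_le_mul_of_nonneg_left ?_ H.δ_pos.le
  simpa using binomExp_le_of_forall_pos_le hπ.1 (hπ.2.trans H.π_le_one)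
    (g := fun k => Function.update φ 0 v k - φ (k + 1)) fun k hk hk' => by
      rw [Function.update_of_ne (by omega)]
      exact (hφ.sub_mem k hk hk').2

lemma sub_mem_savingRange (hy : lowCut δ q < y) (hy' : y < highCut M δ q) :
    v - φ 1 ∈ savingRange M δ q := by
  have hlo := (H.le_indiff hy').trans (H.le_saving hφ hπ hv hS)
  have hhi := (H.saving_le hφ hπ hv hS).trans (H.indiff_le hy)
  replace hlo := le_of_mul_le_mul_left hlo H.δ_pos
  replace hhi := le_of_mul_le_mul_left hhi H.δ_pos
  set P := (1 - π) ^ M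
  set u := lowStep δ q with hu
  set ε := 1 - q ^ (M + 1) with hε
  have hP : 7 / 8 ≤ P := by linarith [H.pow_one_sub_ge hπ.2, H.mul_π_le]
  have huε : 0 ≤ u * ε := mul_nonneg H.lowStep_pos.le H.one_sub_pow_succ_nonneg
  have hP0 : 0 < P := by linarith
  constructor <;> refine le_of_mul_le_mul_left ?_ hP0 <;> rw [← hu, ← hε] <;> nlinarith

lemma slack_of_indiff (hy : lowCut δ q < y) (hy' : y < highCut M δ q) {z : ℝ}
    (hz : z * q ^ M = y) : (1 - δ) * (1 - z) ≤ δ * (v - φ 1) := by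
  have herr := H.saving_error_le hπ hy hz
  have hlo := H.le_saving hφ hπ hv hS
  have hP1 : (1 - π) ^ M ≤ 1 :=
    pow_le_one₀ (by linarith [hπ.2, H.π_le_one]) (by linarith [hπ.1])
  have hind := mul_le_mul_of_nonneg_left (H.le_indiff hy') (sub_nonneg.2 hP1)
  have hP : 0 < (1 - π) ^ M := by linarith [H.pow_one_sub_ge hπ.2, H.mul_π_le]
  refine le_of_mul_le_mul_left ?_ hP
  linarith

end Indifference

lemma exists_mixedCost {y : ℝ} {φ : ℕ → ℝ} (hφ : ContinuationCost M δ q y φ)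
    (hy : lowCut δ q < y) (hy' : y < highCut M δ q) :
    ∃ π v, MixedCost M δ q y π (Function.update φ 0 v) := by
  obtain ⟨π, hπ, hS⟩ := H.exists_safeCost_eq_riskyCost hφ hy hy'
  have hπ1 := hπ.2.trans H.π_le_one
  refine ⟨π, riskyCost M δ π φ, hπ.1, hπ1, ?_, ?_, ?_, ?_, ?_, fun z hz => ?_⟩ <;>
    simp only [Function.update_self, Function.update_of_ne one_ne_zero, riskyCost_update_zero]
  · exact hS
  · exact H.riskyCost_le hφ hy hπ.1 hπ1
  · exact H.le_riskyCost hφ hπ.1 hπ1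
  · exact H.sub_mem_savingRange hφ hπ rfl hS hy hy'
  · exact H.slack_of_indiff hφ hπ rfl hS hy hy' hz

end FinePeriod

/-- The cost `φ` at low odds ratios after `j` failed experiments, starting from the odds ratio `X`:
all players give up below the lower cutoff and mix with probability `p` below the upper one. -/
structure LowCostAt (M : ℕ) (δ q X : ℝ) (φ : ℕ → ℝ) (p : unitInterval) (j : ℕ) : Prop where
  below : X * q ^ j ≤ lowCut δ q → φ j = X * q ^ j
  mixing : lowCut δ q < X * q ^ j → X * q ^ j < highCut M δ q →
    MixedCost M δ q (X * q ^ j) p fun k => φ (j + k)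

/-- Costs in the normal mode (`VN`) and in the punishment mode (`VP`): all players use the risky
arm in the former, and in the latter they are indifferent to using it alone, up to the odds ratio
`top`, where the modes cease to differ. -/
structure ModeCost (M : ℕ) (δ q X top : ℝ) (φ VN VP : ℕ → ℝ) : Prop where
  normal_low : ∀ j, X * q ^ j < highCut M δ q → VN j = φ j
  punish_low : ∀ j, X * q ^ j < highCut M δ q → VP j = φ j
  normal : ∀ j, highCut M δ q ≤ X * q ^ j → VN j = (1 - δ) + δ * VN (j + (M + 1))
  punish : ∀ j, highCut M δ q ≤ X * q ^ j → X * q ^ j ≤ top → VP j = (1 - δ) + δ * VP (j + 1)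
  top : ∀ j, highCut M δ q ≤ X * q ^ j → top < X * q ^ j → VP j = VN j

lemma LowCostAt.congr {M : ℕ} {δ q X : ℝ} {φ φ' : ℕ → ℝ} {p : unitInterval} {j : ℕ}
    (h : LowCostAt M δ q X φ p j) (hφ : ∀ k ≥ j, φ k = φ' k) : LowCostAt M δ q X φ' p j := by
  have hshift : (fun k => φ (j + k)) = fun k => φ' (j + k) := funext fun k => hφ _ (by omega)
  exact ⟨fun hj => hφ j le_rfl ▸ h.below hj, fun hj hj' => hshift ▸ h.mixing hj hj'⟩

lemma LowCostAt.le {M : ℕ} {δ q X : ℝ} {φ : ℕ → ℝ} {p : unitInterval} {j : ℕ}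
    (h : LowCostAt M δ q X φ p j) (hj : X * q ^ j < highCut M δ q) : φ j ≤ X * q ^ j := by
  rcases le_or_gt (X * q ^ j) (lowCut δ q) with hlow | hlow
  · exact (h.below hlow).le
  · exact (h.mixing hlow hj).le

lemma LowCostAt.ge {M : ℕ} {δ q X : ℝ} {φ : ℕ → ℝ} {p : unitInterval} {j : ℕ}
    (h : LowCostAt M δ q X φ p j) (hj : X * q ^ j < highCut M δ q)
    (hj' : lowCut δ q * q ^ (M + 1) ≤ X * q ^ j) : lowCut δ q * q ^ (M + 1) ≤ φ j := by
  rcases le_or_gt (X * q ^ j) (lowCut δ q) with hlow | hlow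
  · rwa [h.below hlow]
  · exact (h.mixing hlow hj).ge

/-- Conditions under which the punishment mode deters deviations up to the odds ratio `top`. The
number `1 - κ` bounds the punishment cost, and `m` rounds of the normal mode start above the upper
cutoff as long as the odds ratio exceeds one. -/
structure EffectivePunishment (M : ℕ) (δ q top μ κ : ℝ) (m : ℕ) : Prop where
  top_large : 4 * (M + 1) * (1 - q) ≤ (1 - δ) * (top - 1)
  μ_nonneg : 0 ≤ μ
  pow_μ : q ^ μ = δ
  one_le : 1 ≤ m
  highCut_le : highCut M δ q ≤ q ^ ((M + 1) * m)
  gap : δ ^ m * (κ + (1 - δ) * top) ≤ δ * κ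
  κ_le : κ * top ^ μ ≤ δ * (1 - highCut M δ q) * highCut M δ q ^ μ

namespace Rates

variable {δ q : ℝ} (H : Rates δ q) {X : ℝ}
include H

lemma exists_grid_lt_lowCut (X : ℝ) : ∃ J, ∀ j ≥ J, X * q ^ j < lowCut δ q := by
  have h := (tendsto_pow_atTop_nhds_zero_of_lt_one H.q_pos.le H.q_lt).const_mul X
  rw [mul_zero] at h
  exact eventually_atTop.1 (h.eventually_lt_const H.lowCut_pos)

lemma grid_anti (hX : 0 < X) {j k : ℕ} (hjk : j ≤ k) : X * q ^ k ≤ X * q ^ j :=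
  mul_le_mul_of_nonneg_left (pow_le_pow_of_le_one H.q_pos.le H.q_lt.le hjk) hX.le

lemma grid_pos (hX : 0 < X) (j : ℕ) : 0 < X * q ^ j := mul_pos hX (pow_pos H.q_pos j)

lemma le_grid_add {c : ℝ} (hc : 0 ≤ c) {j k n : ℕ} (hj : c ≤ X * q ^ j) (hk : k ≤ n) :
    c * q ^ n ≤ X * q ^ (j + k) := by
  rw [pow_add q j k, ← mul_assoc]
  exact mul_le_mul hj (pow_le_pow_of_le_one H.q_pos.le H.q_lt.le hk) (pow_pos H.q_pos n).le
    (hc.trans hj)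

lemma one_sub_δ_le_of_lowCut_le {x : ℝ} (hx : lowCut δ q ≤ x) : 1 - δ ≤ x * (1 - δ * q) := by
  rw [← H.lowCut_mul]
  exact mul_le_mul_of_nonneg_right hx (by linarith [H.δq_lt])

end Rates

namespace FinePeriod

variable {M : ℕ} {δ q π₀ : ℝ} (H : FinePeriod M δ q π₀) {X top : ℝ} {φ : ℕ → ℝ}
  {p : ℕ → unitInterval} {VN VP : ℕ → ℝ}
include H

lemma grid_induction {T : ℕ → Prop} (low : ∀ j, X * q ^ j < highCut M δ q → T j)
    (high : ∀ j, highCut M δ q ≤ X * q ^ j → (∀ k > j, T k) → T j) (j : ℕ) : T j := by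
  obtain ⟨J, hJ⟩ := H.exists_grid_lt_lowCut X
  refine downward_induction J (fun j hj => low j ((hJ j hj).trans H.lowCut_lt_highCut))
    (fun j ih => ?_) j
  rcases lt_or_ge (X * q ^ j) (highCut M δ q) with h | h
  exacts [low j h, high j h ih]

section Low

variable {j : ℕ} {s s' : unitInterval} (h : LowCostAt M δ q X φ s j)
include h

lemma low_sub_mem (h' : LowCostAt M δ q X φ s' (j + 1)) (hX : 0 < X)
    (hj : X * q ^ j < highCut M δ q) (hj' : lowCut δ q * q ^ (M + 1) ≤ X * q ^ j) :
    φ j - φ (j + 1) ∈ savingRange M δ q := by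
  rcases le_or_gt (X * q ^ j) (lowCut δ q) with hlow | hlow
  · have hstep : φ j - φ (j + 1) = X * q ^ j * (1 - q) := by
      rw [h.below hlow, h'.below ((H.grid_anti hX (by omega)).trans hlow)]
      ring
    have hge := mul_le_mul_of_nonneg_right hj' H.one_sub_q_pos.le
    have hle := mul_le_mul_of_nonneg_right hlow H.one_sub_q_pos.le
    have := mul_nonneg H.lowStep_pos.le H.one_sub_pow_succ_nonneg
    rw [hstep]
    unfold lowStep at *
    constructor <;> unfold lowStep <;> linarith
  · exact (h.mixing hlow hj).sub_mem

lemma low_anti (h' : LowCostAt M δ q X φ s' (j + 1)) (hX : 0 < X)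
    (hj : X * q ^ j < highCut M δ q) : φ (j + 1) ≤ φ j := by
  rcases le_or_gt (X * q ^ j) (lowCut δ q) with hlow | hlow
  · have hgrid : X * q ^ (j + 1) ≤ X * q ^ j := H.grid_anti hX (by omega)
    rwa [h.below hlow, h'.below (hgrid.trans hlow)]
  · exact sub_nonneg.1 (H.nonneg_of_mem_savingRange (h.mixing hlow hj).sub_mem)

end Low

lemma continuationCost (hX : 0 < X) {j : ℕ} (h : ∀ k > j, LowCostAt M δ q X φ (p k) k)
    (hlow : lowCut δ q ≤ X * q ^ j) (hhigh : X * q ^ j < highCut M δ q) :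
    ContinuationCost M δ q (X * q ^ j) fun k => φ (j + k) := by
  have hlt : ∀ k, X * q ^ (j + k) < highCut M δ q := fun k =>
    (H.grid_anti hX (by omega)).trans_lt hhigh
  have hge : ∀ k ≤ M + 1, lowCut δ q * q ^ (M + 1) ≤ X * q ^ (j + k) := fun k hk =>
    H.le_grid_add H.lowCut_pos.le hlow hk
  refine ⟨fun k hk hk' => ?_, fun k hk hk' => ?_, ?_⟩
  · exact (h _ (by omega)).ge (hlt k) (hge k hk')
  · exact H.low_sub_mem (h _ (by omega)) (h _ (by omega)) hX (hlt k) (hge k (by omega))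
  · rw [mul_assoc, ← pow_succ]
    exact (h _ (by omega)).le (hlt 1)

lemma exists_lowCost (hX : 0 < X) :
    ∃ (φ : ℕ → ℝ) (p : ℕ → unitInterval), ∀ j, LowCostAt M δ q X φ (p j) j := by
  obtain ⟨J, hJ⟩ := H.exists_grid_lt_lowCut X
  suffices ∃ f : ℕ → ℝ × unitInterval,
      ∀ j, LowCostAt M δ q X (fun k => (f k).1) (f j).2 j from
    let ⟨f, hf⟩ := this; ⟨_, _, hf⟩
  refine exists_seq_downward _ (fun j f g hfg h => ?_) J (fun j => (X * q ^ j, 0))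
    (fun j hj => ⟨fun _ => rfl, fun h => absurd (hJ j hj) (not_lt.2 h.le)⟩) fun j f hf => ?_
  · rw [← hfg j le_rfl]
    exact h.congr fun k hk => by rw [hfg k hk]
  rcases le_or_gt (X * q ^ j) (lowCut δ q) with hlow | hlow
  · exact ⟨(X * q ^ j, 0), fun _ => by simp, fun h => absurd hlow (not_le.2 h)⟩
  rcases le_or_gt (highCut M δ q) (X * q ^ j) with hhigh | hhigh
  · exact ⟨(0, 0), fun h => absurd h (not_le.2 hlow), fun _ h => absurd hhigh (not_le.2 h)⟩
  obtain ⟨π, v, hmix⟩ := H.exists_mixedCost (H.continuationCost hX hf hlow.le hhigh) hlow hhigh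
  refine ⟨(v, ⟨π, hmix.nonneg, hmix.le_one⟩), fun h => absurd h (not_le.2 hlow), fun _ _ => ?_⟩
  convert hmix using 1
  · simp
  · funext k
    rcases Nat.eq_zero_or_pos k with rfl | hk
    · simp
    · simp [Function.update_of_ne hk.ne', Function.update_of_ne (show j + k ≠ j by omega)]

lemma exists_modeCost (X top : ℝ) (φ : ℕ → ℝ) : ∃ VN VP, ModeCost M δ q X top φ VN VP := by
  obtain ⟨J, hJ⟩ := H.exists_grid_lt_lowCut X
  obtain ⟨f, hf⟩ : ∃ f : ℕ → ℝ × ℝ, ∀ j, f j = if X * q ^ j < highCut M δ q then (φ j, φ j) else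
      ((1 - δ) + δ * (f (j + (M + 1))).1,
        if X * q ^ j ≤ top then (1 - δ) + δ * (f (j + 1)).2
          else (1 - δ) + δ * (f (j + (M + 1))).1) := by
    refine exists_seq_downward _ (fun j f g hfg h => ?_) J (fun j => (φ j, φ j))
      (fun j hj => ?_) fun j f _ => ?_
    · rw [← hfg j le_rfl, ← hfg (j + (M + 1)) (by omega), ← hfg (j + 1) (by omega)]
      exact h
    · rw [if_pos ((hJ j hj).trans H.lowCut_lt_highCut)]
    · simp only [Function.update_self, Function.update_of_ne (show j + (M + 1) ≠ j by omega),
        Function.update_of_ne (show j + 1 ≠ j by omega)]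
      exact ⟨_, rfl⟩
  refine ⟨fun j => (f j).1, fun j => (f j).2, fun j h => ?_, fun j h => ?_, fun j h => ?_,
    fun j h h' => ?_, fun j h h' => ?_⟩
  · simp only [hf j, if_pos h]
  · simp only [hf j, if_pos h]
  · simp only [hf j, if_neg (not_lt.2 h)]
  · simp only [hf j, if_neg (not_lt.2 h), if_pos h']
  · simp only [hf j, if_neg (not_lt.2 h), if_neg (not_le.2 h')]

lemma normal_slack (hX : 0 < X) (hL : ∀ j, LowCostAt M δ q X φ (p j) j) {j : ℕ}
    (hj : highCut M δ q ≤ X * q ^ j) (hjM : X * q ^ (j + M) < highCut M δ q) :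
    (1 - δ) * (1 - X * q ^ j) ≤ δ * (φ (j + M) - φ (j + M + 1)) := by
  rcases le_or_gt (X * q ^ (j + M)) (lowCut δ q) with hlow | hlow
  · rw [(hL _).below hlow, (hL _).below ((H.grid_anti hX (by omega)).trans hlow)]
    have hcut : 1 - δ ≤ X * q ^ j * (1 - δ + δ * q ^ M * (1 - q)) := by
      have := mul_le_mul_of_nonneg_right hj (H.highDen_pos M).le
      rwa [H.highCut_mul] at this
    linear_combination hcut
  · exact ((hL _).mixing hlow hjM).slack (X * q ^ j) (by ring)

lemma one_sub_VP_eq (hX : 0 < X) (hC : ModeCost M δ q X top φ VN VP) {j k : ℕ}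
    (hk : ∀ i < k, highCut M δ q ≤ X * q ^ (j + i)) (ht : X * q ^ j ≤ top) :
    1 - VP j = δ ^ k * (1 - VP (j + k)) := by
  induction k with
  | zero => simp
  | succ k ih =>
    rw [ih fun i hi => hk i (by omega), hC.punish (j + k) (hk k (by omega))
      ((H.grid_anti hX (by omega)).trans ht)]
    ring_nf

section Modes

variable (hX : 0 < X) (hL : ∀ j, LowCostAt M δ q X φ (p j) j)
  (hC : ModeCost M δ q X top φ VN VP)
include hL hC

lemma VN_lt_one (j : ℕ) : VN j < 1 := by
  refine H.grid_induction (X := X) (T := fun j => VN j < 1) (fun j hj => ?_) (fun j hj ih => ?_) j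
  · rw [hC.normal_low j hj]
    exact (((hL j).le hj).trans_lt hj).trans (H.highCut_lt_one M)
  · rw [hC.normal j hj]
    have := mul_lt_mul_of_pos_left (ih (j + (M + 1)) (by omega)) H.δ_pos
    linarith

lemma VP_lt_one (j : ℕ) : VP j < 1 := by
  refine H.grid_induction (X := X) (T := fun j => VP j < 1) (fun j hj => ?_) (fun j hj ih => ?_) j
  · rw [hC.punish_low j hj]
    exact (((hL j).le hj).trans_lt hj).trans (H.highCut_lt_one M)
  · rcases le_or_gt (X * q ^ j) top with ht | ht
    · rw [hC.punish j hj ht]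
      have := mul_lt_mul_of_pos_left (ih (j + 1) (by omega)) H.δ_pos
      linarith
    · rw [hC.top j hj ht]
      exact H.VN_lt_one hL hC j

include hX

lemma VN_nonneg (j : ℕ) : 0 ≤ VN j := by
  refine H.grid_induction (X := X) (T := fun j => 0 ≤ VN j) (fun j hj => ?_) (fun j hj ih => ?_) j
  · rw [hC.normal_low j hj]
    rcases le_or_gt (X * q ^ j) (lowCut δ q) with hlow | hlow
    · exact (hL j).below hlow ▸ (H.grid_pos hX j).le
    · exact (mul_pos H.lowCut_pos (pow_pos H.q_pos _)).le.trans ((hL j).mixing hlow hj).ge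
  · rw [hC.normal j hj]
    have := mul_nonneg H.δ_pos.le (ih (j + (M + 1)) (by omega))
    linarith [H.δ_lt]

lemma VP_succ_le {j : ℕ} (ht : X * q ^ j ≤ top) : VP (j + 1) ≤ VP j := by
  rcases lt_or_ge (X * q ^ j) (highCut M δ q) with hj | hj
  · rw [hC.punish_low j hj, hC.punish_low (j + 1) ((H.grid_anti hX (by omega)).trans_lt hj)]
    exact H.low_anti (hL j) (hL (j + 1)) hX hj
  · rw [hC.punish j hj ht]
    nlinarith [H.VP_lt_one hL hC (j + 1), H.δ_lt]

lemma VP_anti {j k : ℕ} (ht : X * q ^ j ≤ top) (hk : j ≤ k) : VP k ≤ VP j := by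
  induction k, hk using Nat.le_induction with
  | base => rfl
  | succ k hk ih => exact (H.VP_succ_le hX hL hC ((H.grid_anti hX hk).trans ht)).trans ih

lemma VP_succ_anti {j k : ℕ} (ht : X * q ^ j ≤ top) (hk : j + 1 ≤ k) : VP k ≤ VP (j + 1) :=
  H.VP_anti hX hL hC ((H.grid_anti hX (by omega)).trans ht) hk

lemma VP_le {j : ℕ} (ht : X * q ^ j ≤ top) : VP j ≤ X * q ^ j := by
  revert ht
  refine H.grid_induction (X := X) (T := fun j => X * q ^ j ≤ top → VP j ≤ X * q ^ j)
    (fun j hj _ => ?_) (fun j hj ih ht => ?_) j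
  · rw [hC.punish_low j hj]
    exact (hL j).le hj
  · have hnext := ih (j + 1) (by omega) ((H.grid_anti hX (by omega)).trans ht)
    have hcut := H.one_sub_δ_le_of_lowCut_le (H.lowCut_lt_highCut.le.trans hj)
    rw [hC.punish j hj ht]
    calc (1 - δ) + δ * VP (j + 1) ≤ X * q ^ j * (1 - δ * q) + δ * (X * q ^ (j + 1)) :=
          add_le_add hcut (mul_le_mul_of_nonneg_left hnext H.δ_pos.le)
      _ = X * q ^ j := by ring

lemma VN_le_VP (j : ℕ) : VN j ≤ VP j := by
  refine H.grid_induction (X := X) (T := fun j => VN j ≤ VP j) (fun j hj => ?_)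
    (fun j hj ih => ?_) j
  · rw [hC.normal_low j hj, hC.punish_low j hj]
  · rcases le_or_gt (X * q ^ j) top with ht | ht
    · rw [hC.punish j hj ht, hC.normal j hj]
      have := (ih (j + (M + 1)) (by omega)).trans
        (H.VP_succ_anti hX hL hC ht (k := j + (M + 1)) (by omega))
      have := H.δ_pos.le
      gcongr
    · rw [hC.top j hj ht]

lemma VN_succ_sub_le_of_lt {j : ℕ} (hj : highCut M δ q ≤ X * q ^ j)
    (hj' : X * q ^ (j + 1) < highCut M δ q) : VN (j + 1) - VN j ≤ 4 * (M + 1) * lowStep δ q := by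
  have hlast : X * q ^ (j + (M + 1)) < highCut M δ q :=
    (H.grid_anti hX (by omega)).trans_lt hj'
  have hle : VN (j + 1) ≤ highCut M δ q := by
    rw [hC.normal_low _ hj']
    exact ((hL _).le hj').trans hj'.le
  have hge : lowCut δ q * q ^ (M + 1) ≤ VN (j + (M + 1)) := by
    rw [hC.normal_low _ hlast]
    exact (hL _).ge hlast
      (H.le_grid_add H.lowCut_pos.le (H.lowCut_lt_highCut.le.trans hj) le_rfl)
  have hmono : VN (j + (M + 1)) ≤ VN j := by
    rw [hC.normal j hj]
    nlinarith [H.VN_lt_one hL hC (j + (M + 1)), H.δ_lt]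
  linarith [H.highCut_sub_le]

lemma VN_succ_sub_le (j : ℕ) : VN (j + 1) - VN j ≤ 4 * (M + 1) * (1 - q) := by
  have hq := H.one_sub_q_pos
  have hbound : 0 ≤ 4 * (M + 1) * (1 - q) := by positivity
  refine H.grid_induction (X := X) (T := fun j => VN (j + 1) - VN j ≤ 4 * (M + 1) * (1 - q))
    (fun j hj => ?_) (fun j hj ih => ?_) j
  · rw [hC.normal_low j hj, hC.normal_low (j + 1) ((H.grid_anti hX (by omega)).trans_lt hj)]
    linarith [H.low_anti (hL j) (hL (j + 1)) hX hj]
  · rcases lt_or_ge (X * q ^ (j + 1)) (highCut M δ q) with hj' | hj'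
    · refine (H.VN_succ_sub_le_of_lt hX hL hC hj hj').trans ?_
      have : lowStep δ q ≤ 1 - q := mul_le_of_le_one_left hq.le H.lowCut_lt_one.le
      gcongr
    · have hshift := ih (j + (M + 1)) (by omega)
      rw [add_right_comm] at hshift
      calc VN (j + 1) - VN j = δ * (VN (j + 1 + (M + 1)) - VN (j + (M + 1))) := by
            rw [hC.normal j hj, hC.normal (j + 1) hj']; ring
        _ ≤ δ * (4 * (M + 1) * (1 - q)) := mul_le_mul_of_nonneg_left hshift H.δ_pos.le
        _ ≤ 4 * (M + 1) * (1 - q) := mul_le_of_le_one_left hbound H.δ_lt.le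

lemma normal_le_safe (htop : 4 * (M + 1) * (1 - q) ≤ (1 - δ) * (top - 1)) {j : ℕ}
    (hj : highCut M δ q ≤ X * q ^ j) :
    (1 - δ) + δ * VN (j + (M + 1)) ≤ (1 - δ) * (X * q ^ j) + δ * VP (j + M) := by
  have hδ := H.δ_pos
  have hδ' := H.one_sub_δ_pos
  rcases lt_or_ge top (X * q ^ j) with ht | ht
  · have hq := H.one_sub_q_pos
    have hdrop : VN (j + (M + 1)) ≤ VP (j + M) + 4 * (M + 1) * (1 - q) := by
      rw [← add_assoc]
      linarith [H.VN_succ_sub_le hX hL hC (j + M), H.VN_le_VP hX hL hC (j + M)]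
    have hdrop' := mul_le_mul_of_nonneg_left hdrop hδ.le
    have hdisc : δ * (4 * (M + 1) * (1 - q)) ≤ 4 * (M + 1) * (1 - q) :=
      mul_le_of_le_one_left (by positivity) H.δ_lt.le
    have := mul_le_mul_of_nonneg_left ht.le hδ'.le
    linarith
  · have hmodes := mul_le_mul_of_nonneg_left (H.VN_le_VP hX hL hC (j + (M + 1))) hδ.le
    rw [← add_assoc] at hmodes ⊢
    rcases lt_or_ge (X * q ^ (j + M)) (highCut M δ q) with h | h
    · rw [hC.punish_low _ ((H.grid_anti hX (by omega)).trans_lt h)] at hmodes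
      rw [hC.punish_low _ h]
      linarith [H.normal_slack hX hL hj h]
    · have hgrid : X * q ^ (j + M) ≤ X * q ^ j := H.grid_anti hX (by omega)
      have hVP := (H.VP_le hX hL hC (hgrid.trans ht)).trans hgrid
      have := mul_le_mul_of_nonneg_left hVP hδ'.le
      linarith [hC.punish _ h (hgrid.trans ht)]

lemma normal_le_punish_add_two {j : ℕ} (hj : highCut M δ q ≤ X * q ^ j) (ht : X * q ^ j ≤ top) :
    VN j ≤ (1 - δ) + δ * VP (j + 2) := by
  rw [hC.normal j hj]
  have hone := H.one_le
  have := (H.VN_le_VP hX hL hC (j + (M + 1))).trans (H.VP_anti hX hL hC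
    ((H.grid_anti hX (j.le_add_right 2)).trans ht) (k := j + (M + 1)) (by omega))
  have := H.δ_pos.le
  gcongr

lemma punish_feasible_of_succ_lt {j : ℕ} (hj : highCut M δ q ≤ X * q ^ j) (ht : X * q ^ j ≤ top)
    (hx : X * q ^ j ≤ 1) (hj' : X * q ^ (j + 1) < highCut M δ q) :
    (1 - δ) * (X * q ^ j) + δ * VN j ≤ VP j := by
  set c := lowCut δ q
  set ε := 1 - q ^ (M + 1) with hε
  have hδ := H.δ_pos
  have hδ' := H.one_sub_δ_pos
  have hε0 : 0 ≤ ε := H.one_sub_pow_succ_nonneg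
  have hj'' : X * q ^ (j + 2) < highCut M δ q := (H.grid_anti hX (by omega)).trans_lt hj'
  have hM := H.one_le
  have hgrid : ∀ k ≤ M + 1, c * q ^ (M + 1) ≤ X * q ^ (j + k) := fun k hk =>
    H.le_grid_add H.lowCut_pos.le (H.lowCut_lt_highCut.le.trans hj) hk
  have hx' : X * q ^ j - c ≤ ε := by
    have hpow : X * q ^ j * (1 - ε) ≤ c := by
      calc X * q ^ j * (1 - ε) = X * q ^ (j + 1) * q ^ M := by rw [hε]; ring
        _ ≤ highCut M δ q * q ^ M := mul_le_mul_of_nonneg_right hj'.le (pow_pos H.q_pos M).le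
        _ ≤ c := H.highCut_mul_pow_le M
    linarith [mul_le_mul_of_nonneg_right hx hε0]
  have hcost : 1 - φ (j + 2) ≤ (1 - c) * (1 - 4 * ε) + (1 - X * q ^ j) := by
    have hge := (hL _).ge hj'' (hgrid 2 (by omega))
    have hgap : 8 * ε ≤ 1 - c := by linarith [H.cut_gap, H.one_sub_pow_succ_le]
    have : c * ε ≤ ε := mul_le_of_le_one_left hε0 H.lowCut_lt_one.le
    have : 0 ≤ c * ε := mul_nonneg H.lowCut_pos.le hε0
    linarith
  have hsave : (1 - δ) * ((1 - c) * (1 - 4 * ε)) ≤ δ * (φ (j + 1) - φ (j + 2)) := by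
    calc (1 - δ) * ((1 - c) * (1 - 4 * ε)) = δ * (lowStep δ q * (1 - 4 * ε)) := by
          rw [lowStep, ← mul_assoc, H.lowCut_indiff]; ring
      _ ≤ _ := mul_le_mul_of_nonneg_left
          (H.low_sub_mem (hL _) (hL _) hX hj' (hgrid 1 (by omega))).1 hδ.le
  have hN := mul_le_mul_of_nonneg_left (H.normal_le_punish_add_two hX hL hC hj ht) hδ.le
  have hφ : 0 ≤ 1 - φ (j + 2) := by
    rw [← hC.punish_low _ hj'']
    linarith [H.VP_lt_one hL hC (j + 2)]
  have hdisc := mul_le_of_le_one_left (mul_nonneg hδ'.le hφ) H.δ_lt.le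
  have hcost' := mul_le_mul_of_nonneg_left hcost hδ'.le
  rw [hC.punish_low _ hj''] at hN
  rw [hC.punish j hj ht, hC.punish_low _ hj']
  linarith

lemma punish_feasible_of_le_one {j : ℕ} (hj : highCut M δ q ≤ X * q ^ j) (ht : X * q ^ j ≤ top)
    (hx : X * q ^ j ≤ 1) : (1 - δ) * (X * q ^ j) + δ * VN j ≤ VP j := by
  rcases lt_or_ge (X * q ^ (j + 1)) (highCut M δ q) with hj' | hj'
  · exact H.punish_feasible_of_succ_lt hX hL hC hj ht hx hj'
  · have hN := H.normal_le_punish_add_two hX hL hC hj ht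
    rw [← hC.punish (j + 1) hj' ((H.grid_anti hX (by omega)).trans ht)] at hN
    rw [hC.punish j hj ht]
    exact add_le_add (mul_le_of_le_one_right H.one_sub_δ_pos.le hx)
      (mul_le_mul_of_nonneg_left hN H.δ_pos.le)

lemma one_sub_VP_le_pow_mul {m j : ℕ} (hj : highCut M δ q ≤ X * q ^ (j + (M + 1) * m))
    (ht : X * q ^ j ≤ top) : 1 - VP j ≤ δ ^ m * (1 - VN j) := by
  induction m generalizing j with
  | zero =>
    rw [pow_zero, one_mul]
    exact sub_le_sub_left (H.VN_le_VP hX hL hC j) 1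
  | succ m ih =>
    have hnext := ih (j := j + (M + 1)) (by convert hj using 3; ring)
      ((H.grid_anti hX (by omega)).trans ht)
    have hM := H.one_le
    have hpow : δ ^ (M + 1) ≤ δ ^ 2 := pow_le_pow_of_le_one H.δ_pos.le H.δ_lt.le (by omega)
    have hVP : 0 ≤ 1 - VP (j + (M + 1)) := by linarith [H.VP_lt_one hL hC (j + (M + 1))]
    calc 1 - VP j = δ ^ (M + 1) * (1 - VP (j + (M + 1))) :=
          H.one_sub_VP_eq hX hC
            (fun i hi => hj.trans (H.grid_anti hX (by nlinarith))) ht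
      _ ≤ δ ^ 2 * (1 - VP (j + (M + 1))) := mul_le_mul_of_nonneg_right hpow hVP
      _ ≤ δ ^ 2 * (δ ^ m * (1 - VN (j + (M + 1)))) :=
          mul_le_mul_of_nonneg_left hnext (sq_nonneg δ)
      _ = δ ^ (m + 1) * (1 - VN j) := by
          rw [hC.normal j (hj.trans (H.grid_anti hX (by omega)))]; ring

-- The weight `x ^ μ` cancels discounting, because a failure multiplies it by `q ^ μ = δ`.
lemma le_one_sub_VP_mul_rpow {μ : ℝ} (hμ : 0 ≤ μ) (hqμ : q ^ μ = δ) {j : ℕ}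
    (hj : highCut M δ q ≤ X * q ^ j) (ht : X * q ^ j ≤ top) :
    δ * (1 - highCut M δ q) * highCut M δ q ^ μ ≤ (1 - VP j) * (X * q ^ j) ^ μ := by
  revert hj ht
  refine H.grid_induction (X := X) (T := fun j => highCut M δ q ≤ X * q ^ j → X * q ^ j ≤ top →
    δ * (1 - highCut M δ q) * highCut M δ q ^ μ ≤ (1 - VP j) * (X * q ^ j) ^ μ)
    (fun j hj hj' => absurd hj (not_lt.2 hj')) (fun j hj ih _ ht => ?_) j
  have ht' : X * q ^ (j + 1) ≤ top := (H.grid_anti hX (by omega)).trans ht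
  have hstep : 1 - VP j = δ * (1 - VP (j + 1)) := by rw [hC.punish j hj ht]; ring
  rcases lt_or_ge (X * q ^ (j + 1)) (highCut M δ q) with h | h
  · have hVP := (H.VP_le hX hL hC ht').trans h.le
    have hδ := H.δ_pos.le
    have hpos := H.highCut_pos M
    have hVP' : 0 ≤ 1 - VP (j + 1) := by linarith [H.VP_lt_one hL hC (j + 1)]
    rw [hstep]
    gcongr
  · have hpow : (X * q ^ (j + 1)) ^ μ = (X * q ^ j) ^ μ * δ := by
      rw [pow_succ, ← mul_assoc, Real.mul_rpow (H.grid_pos hX j).le H.q_pos.le, hqμ]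
    calc δ * (1 - highCut M δ q) * highCut M δ q ^ μ
        ≤ (1 - VP (j + 1)) * (X * q ^ (j + 1)) ^ μ := ih (j + 1) (by omega) h ht'
      _ = (1 - VP j) * (X * q ^ j) ^ μ := by rw [hstep, hpow]; ring

-- Using the risky arm if and only if the odds ratio is at least `highCut` is good enough.
lemma free_riding_le {j K : ℕ} (ht : X * q ^ j ≤ top)
    (hK : lowCut δ q < X * q ^ j → X * q ^ j < highCut M δ q → M ≤ K) :
    (if highCut M δ q ≤ X * q ^ j then (1 - δ) + δ * VP (j + (K + 1))
      else (1 - δ) * (X * q ^ j) + δ * VP (j + K)) ≤ VP j := by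
  have hδ := H.δ_pos.le
  split_ifs with hj
  · have := mul_le_mul_of_nonneg_left
      (H.VP_succ_anti hX hL hC ht (k := j + (K + 1)) (by omega)) hδ
    linarith [hC.punish j hj ht]
  push Not at hj
  have hVP : ∀ k, VP (j + k) = φ (j + k) := fun k =>
    hC.punish_low _ ((H.grid_anti hX (by omega)).trans_lt hj)
  rcases le_or_gt (X * q ^ j) (lowCut δ q) with hlow | hlow
  · have hVPj : VP j = X * q ^ j := by rw [hC.punish_low j hj, (hL j).below hlow]
    have hanti := mul_le_mul_of_nonneg_left (H.VP_anti hX hL hC ht (k := j + K) (by omega)) hδ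
    rw [hVPj] at hanti ⊢
    linarith
  · have hmix := (hL j).mixing hlow hj
    have hexp : VP (j + K) ≤ binomExp M (p j) fun k => φ (j + k) := by
      rw [← binomExp_const M (p j) (VP (j + K))]
      refine binomExp_mono hmix.nonneg hmix.le_one fun k hk => ?_
      rw [← hVP k]
      have := hK hlow hj
      exact H.VP_anti hX hL hC ((H.grid_anti hX (by omega)).trans ht) (by omega)
    have := mul_le_mul_of_nonneg_left hexp hδ
    have hsafe := hmix.safe
    rw [safeCost, add_zero, ← hC.punish_low j hj] at hsafe
    linarith

variable {μ κ : ℝ} {m : ℕ} (hE : EffectivePunishment M δ q top μ κ m)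
include hE

lemma le_one_sub_VP {j : ℕ} (hj : highCut M δ q ≤ X * q ^ j) (ht : X * q ^ j ≤ top) :
    κ ≤ 1 - VP j := by
  have htop : 0 < top := (H.grid_pos hX j).trans_le ht
  refine le_of_mul_le_mul_right ?_ (Real.rpow_pos_of_pos htop μ)
  calc κ * top ^ μ ≤ δ * (1 - highCut M δ q) * highCut M δ q ^ μ := hE.κ_le
    _ ≤ (1 - VP j) * (X * q ^ j) ^ μ := H.le_one_sub_VP_mul_rpow hX hL hC hE.μ_nonneg hE.pow_μ hj ht
    _ ≤ (1 - VP j) * top ^ μ := by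
        have := hE.μ_nonneg
        have : 0 ≤ 1 - VP j := by linarith [H.VP_lt_one hL hC j]
        have := (H.grid_pos hX j).le
        gcongr

lemma punish_feasible_of_one_le {j : ℕ} (ht : X * q ^ j ≤ top) (hx : 1 ≤ X * q ^ j) :
    (1 - δ) * (X * q ^ j) + δ * VN j ≤ VP j := by
  have hδ := H.δ_pos
  have hδm : 0 < δ ^ m := pow_pos hδ m
  have hlast : highCut M δ q ≤ X * q ^ (j + (M + 1) * m) := by
    rw [pow_add, ← mul_assoc]
    exact hE.highCut_le.trans (le_mul_of_one_le_left (pow_pos H.q_pos _).le hx)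
  have hκ := H.le_one_sub_VP hX hL hC hE ((H.highCut_lt_one M).le.trans hx) ht
  have hkey : δ ^ m * ((1 - VP j) + (1 - δ) * (X * q ^ j)) ≤ δ ^ m * (δ * (1 - VN j)) := by
    have hsep := mul_le_mul_of_nonneg_left (H.one_sub_VP_le_pow_mul hX hL hC hlast ht) hδ.le
    have hflow : δ ^ m * ((1 - δ) * (X * q ^ j)) ≤ δ ^ m * ((1 - δ) * top) := by
      have := H.one_sub_δ_pos
      gcongr
    have hδ_le : δ ^ m ≤ δ := pow_le_of_le_one hδ.le H.δ_lt.le (by have := hE.one_le; omega)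
    have := mul_le_mul_of_nonneg_left hκ (sub_nonneg.2 hδ_le)
    linarith [hE.gap]
  have hcancel := le_of_mul_le_mul_left hkey hδm
  linarith [H.δ_lt]

lemma exists_lottery {j : ℕ} (hj : highCut M δ q ≤ X * q ^ j) (ht : X * q ^ j ≤ top) :
    ∃ η : unitInterval, (1 - δ) * (X * q ^ j) + δ * (η * VN j + (1 - η) * VP j) = VP j := by
  have hlo : (1 - δ) * (X * q ^ j) + δ * VN j ≤ VP j := by
    rcases le_total (X * q ^ j) 1 with h | h
    · exact H.punish_feasible_of_le_one hX hL hC hj ht h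
    · exact H.punish_feasible_of_one_le hX hL hC hE ht h
  have hhi : VP j ≤ (1 - δ) * (X * q ^ j) + δ * VP j := by
    have := mul_le_mul_of_nonneg_left (H.VP_le hX hL hC ht) H.one_sub_δ_pos.le
    linarith
  obtain ⟨a, b, ha, hb, hab, hmix⟩ := Icc_subset_segment ⟨hlo, hhi⟩
  refine ⟨⟨a, ha, by linarith⟩, ?_⟩
  obtain rfl : b = 1 - a := by linarith
  simp only [smul_eq_mul] at hmix
  linear_combination hmix

end Modes

end FinePeriod

/-- Equilibrium of the stage game in which `M + 1` players use the risky arm with probability `π`,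
at the odds ratio `x` and with the costs `f k` of continuing after `k` failed experiments; `v` is
the equilibrium cost. -/
structure IsStageEquilibrium (M : ℕ) (δ x π : ℝ) (f : ℕ → ℝ) (v : ℝ) : Prop where
  le_safe : v ≤ safeCost M δ x π f
  le_risky : v ≤ riskyCost M δ π f
  mixed : (1 - π) * safeCost M δ x π f + π * riskyCost M δ π f = v

/-- A symmetric two-mode automaton. After `j` failed experiments in mode `i`, every player uses the
risky arm with probability `mix i j`; if `k` players do so and none of them obtains a lump-sum, the
next mode is `true` with probability `rew i j k`. -/
structure Automaton where
  mix : Bool → ℕ → unitInterval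
  rew : Bool → ℕ → ℕ → unitInterval

namespace Automaton

/-- Expected continuation cost if the experiments of `k` players fail. -/
noncomputable def cont (A : Automaton) (val : Bool → ℕ → ℝ) (i : Bool) (j k : ℕ) : ℝ :=
  A.rew i j k * val true (j + k) + (1 - A.rew i j k) * val false (j + k)

/-- The automaton is a symmetric equilibrium with cost function `val`, by the one-shot deviation
principle. -/
structure IsEquilibrium (A : Automaton) (M : ℕ) (δ q X : ℝ) (val : Bool → ℕ → ℝ) : Prop where
  nonneg : ∀ i j, 0 ≤ val i j
  le_one : ∀ i j, val i j ≤ 1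
  stage : ∀ i j, IsStageEquilibrium M δ (X * q ^ j) (A.mix i j) (A.cont val i j) (val i j)

/-- An equilibrium that starts in mode `true`, where all players experiment above the upper cutoff,
and whose mode `false` is, up to the odds ratio `top`, at least as costly as a reply to opponents of
whom `K` experiment, all of them between the cutoffs. -/
structure IsTwoModeEquilibrium (A : Automaton) (M : ℕ) (δ q X top : ℝ) (val : Bool → ℕ → ℝ) : Prop
    extends A.IsEquilibrium M δ q X val where
  mix_low : ∀ i j, X * q ^ j ≤ lowCut δ q → A.mix i j = 0
  mix_high : ∀ j, highCut M δ q ≤ X * q ^ j → A.mix true j = 1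
  rew_all : ∀ j, A.rew true j (M + 1) = 1
  free_riding : X ≤ top → ∀ j K, (lowCut δ q < X * q ^ j → X * q ^ j < highCut M δ q → M ≤ K) →
    (if highCut M δ q ≤ X * q ^ j then (1 - δ) + δ * val false (j + (K + 1))
      else (1 - δ) * (X * q ^ j) + δ * val false (j + K)) ≤ val false j

lemma cont_of_eq (A : Automaton) {val : Bool → ℕ → ℝ} {j k : ℕ} {v : ℝ}
    (h : ∀ i, val i (j + k) = v) (i : Bool) : A.cont val i j k = v := by
  rw [cont, h, h]
  ring

lemma IsEquilibrium.abs_le_one {A : Automaton} {M : ℕ} {δ q X : ℝ} {val : Bool → ℕ → ℝ}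
    (hA : A.IsEquilibrium M δ q X val) (i : Bool) (j : ℕ) : |val i j| ≤ 1 :=
  abs_le.2 ⟨neg_one_lt_zero.le.trans (hA.nonneg i j), hA.le_one i j⟩

end Automaton

/-- Cost function of an automaton with the cost `VN` in mode `true` and `VP` in mode `false`. -/
def modeVal (VN VP : ℕ → ℝ) : Bool → ℕ → ℝ
  | true => VN
  | false => VP

/-- Mode `false` punishes by using the safe arm up to the odds ratio `top`; the lottery `η` returns
to mode `true` if nobody deviates. -/
noncomputable def twoModeAutomaton (M : ℕ) (δ q X top : ℝ) (p η : ℕ → unitInterval) :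
    Automaton where
  mix i j := if X * q ^ j ≤ lowCut δ q then 0 else if X * q ^ j < highCut M δ q then p j else
    if i = false ∧ X * q ^ j ≤ top then 0 else 1
  rew i j k := if i = false ∧ X * q ^ j ≤ top then (if k = 0 then η j else 0) else
    if k = M + 1 then 1 else 0

lemma LowCostAt.stage_mixing {M : ℕ} {δ q X : ℝ} {φ : ℕ → ℝ} {p : unitInterval} {j : ℕ}
    (h : LowCostAt M δ q X φ p j) (hj : lowCut δ q < X * q ^ j) (hj' : X * q ^ j < highCut M δ q) :
    IsStageEquilibrium M δ (X * q ^ j) p (fun k => φ (j + k)) (φ j) := by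
  have hmix := h.mixing hj hj'
  refine ⟨hmix.safe.ge, hmix.risky.ge, ?_⟩
  rw [hmix.safe, hmix.risky, add_zero]
  ring

namespace FinePeriod

variable {M : ℕ} {δ q π₀ : ℝ} (H : FinePeriod M δ q π₀) {X top : ℝ} {φ : ℕ → ℝ}
  {p η : ℕ → unitInterval} {VN VP : ℕ → ℝ}
include H

section Stage

variable (hX : 0 < X) (hL : ∀ j, LowCostAt M δ q X φ (p j) j)
  (hC : ModeCost M δ q X top φ VN VP)
include hX hL

lemma stage_below {j : ℕ} (hj : X * q ^ j ≤ lowCut δ q) :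
    IsStageEquilibrium M δ (X * q ^ j) 0 (fun k => φ (j + k)) (φ j) := by
  have hsafe : safeCost M δ (X * q ^ j) 0 (fun k => φ (j + k)) = φ j := by
    rw [safeCost, binomExp_zero, add_zero, (hL j).below hj]
    ring
  refine ⟨hsafe.ge, ?_, by rw [hsafe]; ring⟩
  rw [riskyCost, binomExp_zero, (hL j).below hj,
    (hL _).below ((H.grid_anti hX (by omega)).trans hj)]
  have hcut : X * q ^ j * (1 - δ * q) ≤ 1 - δ := by
    rw [← H.lowCut_mul]
    exact mul_le_mul_of_nonneg_right hj (by linarith [H.δq_lt])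
  linear_combination hcut

include hC

lemma stage_normal (htop : 4 * (M + 1) * (1 - q) ≤ (1 - δ) * (top - 1)) {j : ℕ}
    (hj : highCut M δ q ≤ X * q ^ j) {f : ℕ → ℝ} (hf : f M = VP (j + M))
    (hf' : f (M + 1) = VN (j + (M + 1))) : IsStageEquilibrium M δ (X * q ^ j) 1 f (VN j) := by
  have hrisky : riskyCost M δ 1 f = VN j := by rw [riskyCost, binomExp_one, hf', hC.normal j hj]
  refine ⟨?_, hrisky.ge, by rw [hrisky]; ring⟩
  rw [safeCost, binomExp_one, hf, hC.normal j hj]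
  exact H.normal_le_safe hX hL hC htop hj

end Stage

end FinePeriod

lemma ModeCost.stage_punish {M : ℕ} {δ q X top : ℝ} {φ VN VP : ℕ → ℝ}
    (hC : ModeCost M δ q X top φ VN VP) {j : ℕ} (hj : highCut M δ q ≤ X * q ^ j)
    (ht : X * q ^ j ≤ top) {f : ℕ → ℝ} (hf : (1 - δ) * (X * q ^ j) + δ * f 0 = VP j)
    (hf' : f 1 = VP (j + 1)) : IsStageEquilibrium M δ (X * q ^ j) 0 f (VP j) := by
  have hsafe : safeCost M δ (X * q ^ j) 0 f = VP j := by rw [safeCost, binomExp_zero, hf]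
  refine ⟨hsafe.ge, ?_, by rw [hsafe]; ring⟩
  rw [riskyCost, binomExp_zero, zero_add, hf', hC.punish j hj ht]

namespace FinePeriod

variable {M : ℕ} {δ q π₀ : ℝ} (H : FinePeriod M δ q π₀) {X top : ℝ} {φ : ℕ → ℝ}
  {p η : ℕ → unitInterval} {VN VP : ℕ → ℝ}
include H

lemma twoModeAutomaton_stage (hX : 0 < X) (hL : ∀ j, LowCostAt M δ q X φ (p j) j)
    (hC : ModeCost M δ q X top φ VN VP) (htop : 4 * (M + 1) * (1 - q) ≤ (1 - δ) * (top - 1))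
    (hη : ∀ j, highCut M δ q ≤ X * q ^ j → X * q ^ j ≤ top →
      (1 - δ) * (X * q ^ j) + δ * (η j * VN j + (1 - η j) * VP j) = VP j) (i : Bool) (j : ℕ) :
    IsStageEquilibrium M δ (X * q ^ j) ((twoModeAutomaton M δ q X top p η).mix i j)
      ((twoModeAutomaton M δ q X top p η).cont (modeVal VN VP) i j) (modeVal VN VP i j) := by
  rcases lt_or_ge (X * q ^ j) (highCut M δ q) with hj | hj
  · have hval : ∀ k i, modeVal VN VP i (j + k) = φ (j + k) := fun k i => by
      have hk := (H.grid_anti hX (j.le_add_right k)).trans_lt hj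
      cases i
      exacts [hC.punish_low _ hk, hC.normal_low _ hk]
    have hcont : (twoModeAutomaton M δ q X top p η).cont (modeVal VN VP) i j =
        fun k => φ (j + k) := funext fun k => Automaton.cont_of_eq _ (hval k) i
    rw [hcont, show modeVal VN VP i j = φ j from hval 0 i]
    rcases le_or_gt (X * q ^ j) (lowCut δ q) with hlow | hlow
    · simpa [twoModeAutomaton, hlow] using H.stage_below hX hL hlow
    · simpa [twoModeAutomaton, hlow.not_ge, hj] using (hL j).stage_mixing hlow hj
  have hlow : ¬ X * q ^ j ≤ lowCut δ q := not_le.2 (H.lowCut_lt_highCut.trans_le hj)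
  by_cases hi : i = false ∧ X * q ^ j ≤ top
  · obtain ⟨rfl, ht⟩ := hi
    have hstage := hC.stage_punish hj ht
      (f := (twoModeAutomaton M δ q X top p η).cont (modeVal VN VP) false j)
      (by simpa [Automaton.cont, twoModeAutomaton, ht, modeVal] using hη j hj ht)
      (by simp [Automaton.cont, twoModeAutomaton, ht, modeVal])
    simpa [twoModeAutomaton, hlow, hj.not_gt, ht, modeVal] using hstage
  · have hval : modeVal VN VP i j = VN j := by
      cases i
      exacts [hC.top j hj (not_le.1 fun h => hi ⟨rfl, h⟩), rfl]
    have hstage := H.stage_normal hX hL hC htop hj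
      (f := (twoModeAutomaton M δ q X top p η).cont (modeVal VN VP) i j)
      (by simp [Automaton.cont, twoModeAutomaton, hi, modeVal])
      (by simp [Automaton.cont, twoModeAutomaton, hi, modeVal])
    rw [hval]
    simpa [twoModeAutomaton, hlow, hj.not_gt, hi] using hstage

lemma exists_isTwoModeEquilibrium (hX : 0 < X) {μ κ : ℝ} {m : ℕ}
    (hE : EffectivePunishment M δ q top μ κ m) :
    ∃ (A : Automaton) (val : Bool → ℕ → ℝ), A.IsTwoModeEquilibrium M δ q X top val := by
  obtain ⟨φ, p, hL⟩ := H.exists_lowCost hX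
  obtain ⟨VN, VP, hC⟩ := H.exists_modeCost X top φ
  have hη : ∀ j, ∃ η : unitInterval, highCut M δ q ≤ X * q ^ j → X * q ^ j ≤ top →
      (1 - δ) * (X * q ^ j) + δ * (η * VN j + (1 - η) * VP j) = VP j := fun j => by
    by_cases hj : highCut M δ q ≤ X * q ^ j ∧ X * q ^ j ≤ top
    · obtain ⟨η, hη⟩ := H.exists_lottery hX hL hC hE hj.1 hj.2
      exact ⟨η, fun _ _ => hη⟩
    · exact ⟨0, fun h h' => absurd ⟨h, h'⟩ hj⟩
  choose η hη using hη
  refine ⟨twoModeAutomaton M δ q X top p η, modeVal VN VP,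
    ⟨fun i j => ?_, fun i j => ?_, H.twoModeAutomaton_stage hX hL hC hE.top_large hη⟩,
    fun i j hj => ?_, fun j hj => ?_, fun j => ?_, fun ht j K hK => ?_⟩
  · cases i
    exacts [(H.VN_nonneg hX hL hC j).trans (H.VN_le_VP hX hL hC j), H.VN_nonneg hX hL hC j]
  · cases i
    exacts [(H.VP_lt_one hL hC j).le, (H.VN_lt_one hL hC j).le]
  · simp [twoModeAutomaton, hj]
  · simp [twoModeAutomaton, not_le.2 (H.lowCut_lt_highCut.trans_le hj), hj.not_gt]
  · simp [twoModeAutomaton]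
  · refine H.free_riding_le hX hL hC (le_trans ?_ ht) hK
    exact mul_le_of_le_one_right hX.le (H.pow_le_one j)

end FinePeriod

lemma tendsto_one_sub_exp_div (a : ℝ) :
    Tendsto (fun Δ : ℝ => (1 - Real.exp (-a * Δ)) / Δ) (𝓝[>] 0) (𝓝 a) := by
  have hderiv : HasDerivAt (fun Δ : ℝ => 1 - Real.exp (-a * Δ)) a 0 := by
    simpa using (((hasDerivAt_id (0 : ℝ)).const_mul (-a)).exp).const_sub 1
  refine (hderiv.tendsto_slope.mono_left (nhdsWithin_mono _ fun Δ hΔ => ne_of_gt hΔ)).congr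
    fun Δ => ?_
  simp [slope_def_field]

lemma tendsto_exp_neg_mul (a : ℝ) :
    Tendsto (fun Δ : ℝ => Real.exp (-a * Δ)) (𝓝[>] 0) (𝓝 1) := by
  have hcont : ContinuousAt (fun Δ : ℝ => Real.exp (-a * Δ)) 0 := by fun_prop
  simpa using hcont.tendsto.mono_left nhdsWithin_le_nhds

lemma eventually_mul_one_sub_exp_lt {a b c d : ℝ} (h : c * a < d * b) :
    ∀ᶠ Δ : ℝ in 𝓝[>] 0, c * (1 - Real.exp (-a * Δ)) < d * (1 - Real.exp (-b * Δ)) := by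
  filter_upwards [self_mem_nhdsWithin, ((tendsto_one_sub_exp_div a).const_mul c).eventually_lt
    ((tendsto_one_sub_exp_div b).const_mul d) h] with Δ hΔ hlt
  rwa [← mul_div_assoc, ← mul_div_assoc, div_lt_div_iff_of_pos_right hΔ] at hlt

section Limits

variable {r l : ℝ} (hr : 0 < r) (hl : 0 < l)
include hr hl

lemma rates_exp {Δ : ℝ} (hΔ : 0 < Δ) : Rates (Real.exp (-r * Δ)) (Real.exp (-l * Δ)) where
  δ_pos := Real.exp_pos _
  δ_lt := Real.exp_lt_one_iff.2 (by nlinarith)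
  q_pos := Real.exp_pos _
  q_lt := Real.exp_lt_one_iff.2 (by nlinarith)

lemma div_add_lt_one : r / (r + l) < 1 := (div_lt_one (by positivity)).2 (by linarith)

lemma le_lowCut {Δ : ℝ} (hΔ : 0 < Δ) :
    r / (r + l) ≤ lowCut (Real.exp (-r * Δ)) (Real.exp (-l * Δ)) := by
  have H := rates_exp hr hl hΔ
  have hsuccess : 1 - Real.exp (-l * Δ) ≤ l * Δ := by
    linarith [Real.add_one_le_exp (-l * Δ)]
  have hdiscount : r * Δ * Real.exp (-r * Δ) ≤ 1 - Real.exp (-r * Δ) := by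
    have hinv : Real.exp (-r * Δ) * Real.exp (r * Δ) = 1 := by rw [← Real.exp_add]; simp
    have := mul_le_mul_of_nonneg_left (Real.add_one_le_exp (r * Δ)) H.δ_pos.le
    linarith
  have hkey : r * Real.exp (-r * Δ) * (1 - Real.exp (-l * Δ)) ≤ l * (1 - Real.exp (-r * Δ)) := by
    calc r * Real.exp (-r * Δ) * (1 - Real.exp (-l * Δ)) ≤ r * Real.exp (-r * Δ) * (l * Δ) := by
          gcongr
      _ = l * (r * Δ * Real.exp (-r * Δ)) := by ring
      _ ≤ _ := by gcongr
  rw [lowCut, div_le_div_iff₀ (by positivity) (by linarith [H.δq_lt])]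
  linarith

lemma tendsto_lowCut :
    Tendsto (fun Δ : ℝ => lowCut (Real.exp (-r * Δ)) (Real.exp (-l * Δ))) (𝓝[>] 0)
      (𝓝 (r / (r + l))) := by
  refine ((tendsto_one_sub_exp_div r).div (tendsto_one_sub_exp_div (r + l))
    (by linarith)).congr' ?_
  filter_upwards [self_mem_nhdsWithin] with Δ hΔ
  rw [Pi.div_apply, div_div_div_cancel_right₀ (ne_of_gt hΔ), lowCut, ← Real.exp_add]
  congr 3
  ring

lemma tendsto_highCut (M : ℕ) :
    Tendsto (fun Δ : ℝ => highCut M (Real.exp (-r * Δ)) (Real.exp (-l * Δ))) (𝓝[>] 0)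
      (𝓝 (r / (r + l))) := by
  have hsuccess := ((tendsto_exp_neg_mul r).mul ((tendsto_exp_neg_mul l).pow M)).mul
    (tendsto_one_sub_exp_div l)
  rw [one_pow, one_mul, one_mul] at hsuccess
  refine ((tendsto_one_sub_exp_div r).div ((tendsto_one_sub_exp_div r).add hsuccess)
    (by linarith)).congr' ?_
  filter_upwards [self_mem_nhdsWithin] with Δ hΔ
  rw [Pi.div_apply, ← mul_div_assoc, ← add_div, div_div_div_cancel_right₀ (ne_of_gt hΔ), highCut]

lemma exists_eventually_finePeriod {M : ℕ} (hM : 1 ≤ M) :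
    ∃ π₀, ∀ᶠ Δ : ℝ in 𝓝[>] 0, FinePeriod M (Real.exp (-r * Δ)) (Real.exp (-l * Δ)) π₀ := by
  have hM' : (1 : ℝ) ≤ M := by exact_mod_cast hM
  set π₀ := r / (20 * (M + 1) * M * (r + l)) with hπ₀
  have hπ₀_pos : 0 < π₀ := by positivity
  have hMπ : 20 * (M + 1) * (M * π₀) = r / (r + l) := by rw [hπ₀]; field_simp
  have hMπ_le : M * π₀ ≤ 1 / 8 := by
    have : 1 * (M * π₀) ≤ (M + 1) * (M * π₀) := by gcongr; linarith
    linarith [div_add_lt_one hr hl]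
  have hmixing : 10 * (M + 1) * (M * π₀) * l < 1 * r := by
    have : r / (r + l) * l < r := by
      rw [div_mul_eq_mul_div, div_lt_iff₀ (by positivity)]
      nlinarith
    nlinarith
  refine ⟨π₀, ?_⟩
  filter_upwards [self_mem_nhdsWithin,
    (((tendsto_exp_neg_mul l).pow (M + 1)).const_sub 1).eventually_lt_const
      (u := 1 / 8) (by norm_num),
    eventually_mul_one_sub_exp_lt hmixing,
    (((tendsto_exp_neg_mul r).const_sub 1).const_mul (8 * ((M : ℝ) + 1))).eventually_lt
      (((tendsto_exp_neg_mul r).pow 2).mul_const π₀) (by simpa using hπ₀_pos),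
    (((tendsto_exp_neg_mul l).const_sub 1).const_mul (8 * ((M : ℝ) + 1))).eventually_lt
      ((tendsto_lowCut hr hl).const_sub 1) (by simpa using div_add_lt_one hr hl)]
    with Δ hΔ hpow hmix himp hgap
  refine ⟨rates_exp hr hl hΔ, hM, hπ₀_pos, hMπ_le, hpow.le, ?_, himp, hgap.le⟩
  linarith

-- About `τ / Δ` rounds, where `τ` depends only on `y`.
lemma exists_eventually_exists_pow {N : ℕ} (hN : 0 < N) {y : ℝ} (hy : 0 < y) (hy' : y < 1) :
    ∃ c < 1, ∀ᶠ Δ : ℝ in 𝓝[>] 0, ∃ m : ℕ, 1 ≤ m ∧ y ≤ Real.exp (-l * Δ) ^ (N * m) ∧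
      Real.exp (-r * Δ) ^ m ≤ c := by
  set τ := -Real.log y / (l * N) with hτ
  have hτ_pos : 0 < τ := div_pos (neg_pos.2 (Real.log_neg hy hy')) (by positivity)
  have hexp : Real.exp (-(l * N * τ)) = y := by
    rw [hτ, mul_div_cancel₀ _ (by positivity), neg_neg, Real.exp_log hy]
  refine ⟨Real.exp (-(r * (τ / 2))),
    Real.exp_lt_one_iff.2 (neg_neg_of_pos (mul_pos hr (half_pos hτ_pos))), ?_⟩
  filter_upwards [Ioo_mem_nhdsGT (half_pos hτ_pos)] with Δ ⟨hΔ, hΔ'⟩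
  have hfloor : (⌊τ / Δ⌋₊ : ℝ) * Δ ≤ τ :=
    (le_div_iff₀ hΔ).1 (Nat.floor_le (div_nonneg hτ_pos.le hΔ.le))
  have hfloor' : τ / 2 ≤ ⌊τ / Δ⌋₊ * Δ := by
    linarith [(div_lt_iff₀ hΔ).1 (Nat.lt_floor_add_one (τ / Δ))]
  refine ⟨⌊τ / Δ⌋₊, ?_, ?_, ?_⟩
  · rw [Nat.one_le_floor_iff, one_le_div₀ hΔ]
    linarith
  · rw [← hexp, ← Real.exp_nat_mul, Real.exp_le_exp, Nat.cast_mul]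
    have : l * N * (⌊τ / Δ⌋₊ * Δ) ≤ l * N * τ := by gcongr
    linarith
  · rw [← Real.exp_nat_mul, Real.exp_le_exp]
    have : r * (τ / 2) ≤ r * (⌊τ / Δ⌋₊ * Δ) := by gcongr
    linarith

lemma eventually_le_one_sub_highCut_mul_rpow (M : ℕ) {a : ℝ}
    (ha : a < (1 - r / (r + l)) * (r / (r + l)) ^ (r / l)) :
    ∀ᶠ Δ : ℝ in 𝓝[>] 0, a ≤
      Real.exp (-r * Δ) * (1 - highCut M (Real.exp (-r * Δ)) (Real.exp (-l * Δ))) *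
        highCut M (Real.exp (-r * Δ)) (Real.exp (-l * Δ)) ^ (r / l) := by
  have hcut := tendsto_highCut hr hl M
  have hlim := ((tendsto_exp_neg_mul r).mul (hcut.const_sub 1)).mul
    (hcut.rpow_const (p := r / l) (Or.inl (by positivity)))
  rw [one_mul] at hlim
  exact (hlim.eventually_const_lt ha).mono fun Δ h => h.le

lemma exists_eventually_effectivePunishment (M : ℕ) (xhigh : ℝ) :
    ∃ top ≥ xhigh, ∃ κ, ∀ᶠ Δ : ℝ in 𝓝[>] 0, ∃ m,
      EffectivePunishment M (Real.exp (-r * Δ)) (Real.exp (-l * Δ)) top (r / l) κ m := by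
  set x := r / (r + l)
  have hx_pos : 0 < x := by positivity
  have hx_lt : x < 1 := div_add_lt_one hr hl
  set top := max xhigh (2 + 4 * (M + 1) * l / r)
  have htop_pos : 0 < top := lt_max_of_lt_right (by positivity)
  have hlarge : 4 * (M + 1) * l < (top - 1) * r := by
    have : 4 * (M + 1) * l / r < top - 1 := by
      linarith [le_max_right xhigh (2 + 4 * (M + 1) * l / r)]
    rwa [div_lt_iff₀ hr] at this
  have hlim_pos : 0 < (1 - x) * x ^ (r / l) :=
    mul_pos (sub_pos.2 hx_lt) (Real.rpow_pos_of_pos hx_pos _)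
  set κ := (1 - x) * x ^ (r / l) / (2 * top ^ (r / l)) with hκ
  have hκ_pos : 0 < κ := by positivity
  have hκ_lt : κ * top ^ (r / l) < (1 - x) * x ^ (r / l) := by
    have : κ * top ^ (r / l) = (1 - x) * x ^ (r / l) / 2 := by rw [hκ]; field_simp
    linarith
  obtain ⟨c, hc, hrounds⟩ := exists_eventually_exists_pow hr hl M.succ_pos
    (y := (1 + x) / 2) (by linarith) (by linarith)
  refine ⟨top, le_max_left _ _, κ, ?_⟩
  filter_upwards [self_mem_nhdsWithin, hrounds, eventually_mul_one_sub_exp_lt hlarge,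
    (tendsto_highCut hr hl M).eventually_lt_const (u := (1 + x) / 2) (by linarith),
    (((((tendsto_exp_neg_mul r).const_sub 1).mul_const top).const_add κ).const_mul c).eventually_lt
      ((tendsto_exp_neg_mul r).mul_const κ) (by simpa using mul_lt_of_lt_one_left hκ_pos hc),
    eventually_le_one_sub_highCut_mul_rpow hr hl M hκ_lt]
    with Δ hΔ ⟨m, hm, hqm, hδm⟩ htopΔ hcut hgap hκΔ
  have hpow : Real.exp (-l * Δ) ^ (r / l) = Real.exp (-r * Δ) := by
    rw [← Real.exp_mul]
    congr 1
    field_simp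
  refine ⟨m, by linarith, by positivity, hpow, hm, hcut.le.trans hqm, ?_, hκΔ⟩
  have : 0 ≤ 1 - Real.exp (-r * Δ) := (rates_exp hr hl hΔ).one_sub_δ_pos.le
  refine le_trans ?_ hgap.le
  gcongr

lemma eventually_exists_isTwoModeEquilibrium {M : ℕ} (hM : 1 ≤ M) (xhigh : ℝ) :
    ∀ᶠ Δ : ℝ in 𝓝[>] 0, ∀ X > 0, ∃ (A : Automaton) (val : Bool → ℕ → ℝ),
      A.IsTwoModeEquilibrium M (Real.exp (-r * Δ)) (Real.exp (-l * Δ)) X xhigh val := by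
  obtain ⟨π₀, hfine⟩ := exists_eventually_finePeriod hr hl hM
  obtain ⟨top, htop, κ, hpunish⟩ := exists_eventually_effectivePunishment hr hl M xhigh
  filter_upwards [hfine, hpunish] with Δ H ⟨m, hE⟩ X hX
  obtain ⟨A, val, hA⟩ := H.exists_isTwoModeEquilibrium hX hE
  exact ⟨A, val, { hA with free_riding := fun hXhigh => hA.free_riding (hXhigh.trans htop) }⟩

end Limits

lemma continuousAt_of_monotone_of_eq {n : ℝ≥0 → ℕ} (hn : Monotone n) {s t : ℝ≥0}
    (hr : ContinuousWithinAt n (Set.Ici t) t) (hst : s < t) (h : n s = n t) :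
    ContinuousAt n t := by
  refine continuousAt_iff_continuous_left_right.2 ⟨?_, hr⟩
  have hleft : ∀ᶠ u in 𝓝[Set.Iic t] t, n u = n t := by
    filter_upwards [self_mem_nhdsWithin, mem_nhdsWithin_of_mem_nhds (Ioi_mem_nhds hst)]
      with u hut hsu
    exact le_antisymm (hn hut) (h ▸ hn (le_of_lt hsu))
  exact (continuousWithinAt_const (b := n t)).congr_of_eventuallyEq hleft rfl

lemma exists_mem_dense_eq_of_continuousWithinAt_Ici {Δ : ℝ≥0} {n : ℝ≥0 → ℕ} {s : Set.Iio Δ}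
    (hr : ContinuousWithinAt n (Set.Ici s) s) {D : Set (Set.Iio Δ)} (hD : Dense D) {ε : ℝ}
    (hε : 0 < ε) : ∃ d ∈ D, dist d s < ε ∧ n d = n s := by
  have hcoe : Tendsto ((↑) : Set.Iio Δ → ℝ≥0) (𝓝[>] s) (𝓝[≥] (s : ℝ≥0)) :=
    tendsto_nhdsWithin_iff.2 ⟨(continuous_subtype_val.tendsto s).mono_left nhdsWithin_le_nhds,
      eventually_nhdsWithin_of_forall fun _ hu => Set.mem_Ici.2 (le_of_lt hu)⟩
  have hev : ∀ᶠ u : Set.Iio Δ in 𝓝[>] s, dist u s < ε ∧ n u = n s :=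
    .and (nhdsWithin_le_nhds (Metric.ball_mem_nhds s hε))
      ((hr.tendsto.comp hcoe).eventually_mem (isOpen_discrete {n s} |>.mem_nhds rfl))
  obtain ⟨c, hc, hsub⟩ := mem_nhdsGT_iff_exists_Ioo_subset.1 hev
  obtain ⟨d, hdD, hd⟩ := hD.exists_between hc
  exact ⟨d, hdD, hsub hd⟩

lemma continuousAt_add_mul_natCast {X : Type*} [TopologicalSpace X] {w : X → ℝ} {n : X → ℕ}
    {c : ℝ} {x : X} (hw : ContinuousAt w x) (hn : ContinuousAt n x) :
    ContinuousAt (fun x => w x + c * (n x : ℝ)) x := by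
  have : ContinuousAt (fun x => (n x : ℝ)) x := continuous_of_discreteTopology.continuousAt.comp hn
  fun_prop

namespace Bandit

variable (G : Bandit) {Δ : ℝ≥0}

lemma finite_discontinuities (y : G.ArmPath Δ) : {t | ¬ ContinuousAt y.1 t}.Finite := by
  obtain ⟨y, w, n, hw, -, hn, hr, -, hy⟩ := y
  have hjump : ∀ s t : Set.Iio Δ, ¬ ContinuousAt y t → s < t → n s < n t := by
    refine fun s t ht hst => (hn hst.le).lt_of_ne fun h => ht ?_
    have hnt : ContinuousAt (fun t : Set.Iio Δ => n t) t :=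
      ContinuousAt.comp (g := n) (continuousAt_of_monotone_of_eq hn (hr t) hst h)
        continuous_subtype_val.continuousAt
    rw [funext hy]
    exact continuousAt_add_mul_natCast (by fun_prop) hnt
  refine Set.Finite.of_injOn (f := fun t : Set.Iio Δ => n t) (t := Set.Iic (n Δ))
    (fun t _ => hn (le_of_lt t.2)) (fun s hs t ht hst => ?_) (Set.finite_Iic _)
  rcases lt_trichotomy s t with h | h | h
  · exact absurd hst (hjump s t ht h).ne
  · exact h
  · exact absurd hst (hjump t s hs h).ne'

lemma lumps_eq_zero_iff (y : G.ArmPath Δ) : G.lumps y = 0 ↔ Continuous y.1 := by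
  simp only [lumps, Set.ncard_eq_zero (G.finite_discontinuities y), continuous_iff_continuousAt,
    Set.eq_empty_iff_forall_notMem, Set.mem_ofPred_eq, not_not]

/-- The payoff paths of one period on which no lump-sum arrives; in each of them an
experiment has failed. -/
def lumpFree (Δ : ℝ≥0) : Set (G.ArmPath Δ) := {y | G.lumps y = 0}

lemma mem_lumpFree_iff {y : G.ArmPath Δ} {w : ℝ≥0 → ℝ} {n : ℝ≥0 → ℕ} (hw : Continuous w)
    (h0 : n 0 = 0) (hy : ∀ t : Set.Iio Δ, y.1 t = w t + G.h * n t) :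
    y ∈ G.lumpFree Δ ↔ ∀ t : Set.Iio Δ, n t = 0 := by
  refine (G.lumps_eq_zero_iff y).trans ⟨fun hc t => ?_, fun hn => ?_⟩
  · have hcast : Continuous fun t : Set.Iio Δ => (n t : ℝ) := by
      have : (fun t : Set.Iio Δ => (n t : ℝ)) = fun t => (y.1 t - w t) / G.h :=
        funext fun t => by rw [hy, add_sub_cancel_left, mul_div_cancel_left₀ _ G.h_pos.ne']
      rw [this]
      fun_prop
    have hcont : Continuous fun t : Set.Iio Δ => n t :=
      Nat.isClosedEmbedding_coe_real.isEmbedding.continuous_iff.2 hcast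
    have hconn : PreconnectedSpace (Set.Iio Δ) :=
      isPreconnected_iff_preconnectedSpace.1 Set.ordConnected_Iio.isPreconnected
    exact (PreconnectedSpace.constant hconn hcont
      (y := ⟨0, zero_le.trans_lt (Set.mem_Iio.1 t.2)⟩)).trans h0
  · have : y.1 = fun t : Set.Iio Δ => w t := funext fun t => by simp [hy, hn t]
    rw [this]
    fun_prop

lemma mem_lumpFree_iff_of_dense {D : Set (Set.Iio Δ)} (hD : Dense D) (y : G.ArmPath Δ) :
    y ∈ G.lumpFree Δ ↔ ∃ k : ℕ, ∀ s ∈ D, ∀ t ∈ D,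
      dist s t < 1 / ((k : ℝ) + 1) → |y.1 s - y.1 t| < G.h / 2 := by
  obtain ⟨w, n, hw, -, -, hr, h0, hy⟩ := y.2
  have hh := half_pos G.h_pos
  obtain ⟨ε, hε, hwε⟩ := Metric.uniformContinuousOn_iff.1
    (isCompact_Icc.uniformContinuousOn_of_continuous (hw.continuousOn (s := Set.Icc 0 Δ))) _ hh
  have hwst (s t : Set.Iio Δ) (hst : dist s t < ε) : |w s - w t| < G.h / 2 :=
    hwε s ⟨zero_le, le_of_lt s.2⟩ t ⟨zero_le, le_of_lt t.2⟩ hst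
  constructor
  · intro hfree
    have hn := (G.mem_lumpFree_iff hw h0 hy).1 hfree
    obtain ⟨k, hk⟩ := exists_nat_one_div_lt hε
    refine ⟨k, fun s _ t _ hst => ?_⟩
    simpa [hy, hn] using hwst s t (hst.trans hk)
  · rintro ⟨k, hk⟩
    have hclose (s t : Set.Iio Δ) (hs : s ∈ D) (ht : t ∈ D)
        (hst : dist s t < min ε (1 / ((k : ℝ) + 1))) : n s = n t := by
      have h1 := abs_lt.1 (hk s hs t ht (hst.trans_le (min_le_right _ _)))
      have h2 := abs_lt.1 (hwst s t (hst.trans_le (min_le_left _ _)))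
      rw [hy, hy] at h1
      have h3 : |(n s : ℝ) - n t| < 1 := by
        rw [abs_lt]
        constructor <;> nlinarith [G.h_pos]
      have h4 : |(n s : ℤ) - n t| < 1 := by exact_mod_cast h3
      exact_mod_cast sub_eq_zero.1 (Int.abs_lt_one_iff.1 h4)
    have hδ : 0 < min ε (1 / ((k : ℝ) + 1)) := by positivity
    have hlocal : IsLocallyConstant fun t : Set.Iio Δ => n t := by
      refine IsLocallyConstant.iff_eventually_eq _ |>.2 fun t => ?_
      filter_upwards [Metric.ball_mem_nhds t (div_pos hδ three_pos)] with s hst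
      obtain ⟨d, hdD, hsd, hd⟩ :=
        exists_mem_dense_eq_of_continuousWithinAt_Ici (hr s) hD (div_pos hδ three_pos)
      obtain ⟨e, heD, hte, he⟩ :=
        exists_mem_dense_eq_of_continuousWithinAt_Ici (hr t) hD (div_pos hδ three_pos)
      rw [← hd, ← he]
      refine hclose d e hdD heD ?_
      have := dist_triangle4 d s t e
      rw [dist_comm t e] at this
      linarith [Metric.mem_ball.1 hst]
    refine (G.lumps_eq_zero_iff y).2 (continuous_iff_continuousAt.2 fun t => ?_)
    rw [funext hy]
    exact continuousAt_add_mul_natCast (by fun_prop) hlocal.continuous.continuousAt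

lemma measurableSet_lumpFree : MeasurableSet (G.lumpFree Δ) := by
  obtain ⟨D, hDc, hD⟩ := TopologicalSpace.exists_countable_dense (Set.Iio Δ)
  have heval (s : Set.Iio Δ) : Measurable fun y : G.ArmPath Δ => y.1 s :=
    (measurable_pi_apply s).comp measurable_subtype_coe
  have hset : G.lumpFree Δ = ⋃ k : ℕ, ⋂ s ∈ D, ⋂ t ∈ D,
      {y | dist s t < 1 / ((k : ℝ) + 1) → |y.1 s - y.1 t| < G.h / 2} := by
    ext y
    simp only [G.mem_lumpFree_iff_of_dense hD, Set.mem_iUnion, Set.mem_iInter, Set.mem_ofPred_eq]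
  rw [hset]
  exact .iUnion fun k => .biInter hDc fun s _ => .biInter hDc fun t _ =>
    (MeasurableSet.const _).imp
      (measurableSet_lt ((heval s).sub (heval t)).abs measurable_const)

end Bandit

namespace IsPoissonProcess

variable {Ω : Type} [MeasurableSpace Ω] {l : ℝ≥0} {N : ℝ≥0 → Ω → ℕ} {P : Measure Ω}

lemma measure_increment_eq_zero (hN : IsPoissonProcess l N P) {t u : ℝ≥0} (htu : t ≤ u) :
    P {ω | N u ω - N t ω = 0} = ENNReal.ofReal (Real.exp (-(l * (u - t)))) := by
  rw [(hN.law t u htu).measure_eq (p := (· = 0)) (measurableSet_singleton 0),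
    show {k : ℕ | k = 0} = {0} from rfl, poissonMeasure_singleton]
  simp [NNReal.coe_sub htu]

lemma measure_eq_zero (hN : IsPoissonProcess l N P) (t : ℝ≥0) :
    P {ω | N t ω = 0} = ENNReal.ofReal (Real.exp (-(l * t))) := by
  have h := hN.measure_increment_eq_zero (zero_le (a := t))
  rw [NNReal.coe_zero, sub_zero] at h
  rw [← h]
  refine measure_congr ?_
  filter_upwards [hN.zero] with ω hω
  change (N t ω = 0) = (N t ω - N 0 ω = 0)
  rw [hω, tsub_zero]

lemma ae_eq_zero_of_forall_lt [IsProbabilityMeasure P] (hN : IsPoissonProcess l N P) {Δ : ℝ≥0}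
    (hΔ : 0 < Δ) : ∀ᵐ ω ∂P, (∀ t < Δ, N t ω = 0) → N Δ ω = 0 := by
  have hlim : Tendsto (fun t : ℝ≥0 => 1 - ENNReal.ofReal (Real.exp (-(l * (Δ - t)))))
      (𝓝[<] Δ) (𝓝 0) := by
    have hcont : Continuous fun t : ℝ≥0 => 1 - ENNReal.ofReal (Real.exp (-(l * (Δ - t : ℝ)))) :=
      (ENNReal.continuous_sub_left ENNReal.one_ne_top).comp
        (ENNReal.continuous_ofReal.comp (by fun_prop))
    simpa using (hcont.tendsto Δ).mono_left nhdsWithin_le_nhds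
  have : (𝓝[<] Δ).NeBot := nhdsLT_neBot_of_exists_lt ⟨0, hΔ⟩
  refine ae_iff.2 (le_antisymm (ge_of_tendsto hlim ?_) zero_le)
  filter_upwards [self_mem_nhdsWithin] with t ht
  have hmeas : NullMeasurableSet {ω | N Δ ω - N t ω = 0} P :=
    (hN.law t Δ (le_of_lt ht)).aemeasurable.nullMeasurable (measurableSet_singleton 0)
  rw [← hN.measure_increment_eq_zero (le_of_lt ht), ← prob_compl_eq_one_sub₀ hmeas]
  refine measure_mono fun ω hω => ?_
  obtain ⟨h0, hΔ⟩ := Classical.not_imp.1 hω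
  simpa [h0 t ht] using hΔ

end IsPoissonProcess

namespace Bandit

variable (G : Bandit) {Δ : ℝ≥0}

lemma lam_nonneg (θ : Fin 2) : 0 ≤ G.lam θ := by
  fin_cases θ
  exacts [G.lam_zero_nonneg, G.lam_zero_nonneg.trans G.lam_le]

/-- The map that turns the values of a Brownian motion at the times in `I` into those of
`α_θ t + σ Z_t`. -/
def driftedValues (θ : Fin 2) (I : Finset (Set.Iio Δ))
    (z : I.map ⟨Subtype.val, Subtype.val_injective⟩ → ℝ) (i : I) : ℝ :=
  G.α θ * (i.1 : ℝ≥0) + G.σ * z ⟨i.1, by simp⟩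

lemma measurable_driftedValues (θ : Fin 2) (I : Finset (Set.Iio Δ)) :
    Measurable (G.driftedValues θ I) := by
  unfold driftedValues
  fun_prop

namespace IsArmLaw

variable {G}

lemma map_restrict_lumpFree (hΔ : 0 < Δ) {θ : Fin 2} {Q : Measure (G.ArmPath Δ)}
    (hQ : G.IsArmLaw Δ θ Q) (I : Finset (Set.Iio Δ)) :
    (Q.restrict (G.lumpFree Δ)).map (fun y => I.restrict y.1) =
      ENNReal.ofReal (Real.exp (-(G.lam θ * Δ))) •
        (BrownianReal.projectiveFamily (I.map ⟨Subtype.val, Subtype.val_injective⟩)).map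
          (G.driftedValues θ I) := by
  obtain ⟨Ω, mΩ, P, Z, N, X, hP, hZ, hN, hind, hX, hlaw⟩ := hQ
  ext A hA
  have hR : Measurable fun y : G.ArmPath Δ => I.restrict y.1 :=
    (Finset.measurable_restrict I).comp measurable_subtype_coe
  have hA' := G.measurable_driftedValues θ I hA
  have hae : X ⁻¹' ((fun y => I.restrict y.1) ⁻¹' A ∩ G.lumpFree Δ) =ᵐ[P]
      ((fun ω t => Z t ω) ⁻¹' (Finset.restrict (I.map _) ⁻¹' (G.driftedValues θ I ⁻¹' A)) ∩
        (fun ω t => N t ω) ⁻¹' ((fun n : ℝ≥0 → ℕ => n Δ) ⁻¹' {0}) : Set Ω) := by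
    filter_upwards [hX, hZ.cont, hN.zero, hN.paths, hN.ae_eq_zero_of_forall_lt hΔ]
      with ω hXω hZω hN0 hNω hNΔ
    have hdrift : Continuous fun t : ℝ≥0 => G.α θ * (t : ℝ) + G.σ * Z t ω := by fun_prop
    have hmem := G.mem_lumpFree_iff (n := fun t => N t ω) hdrift hN0 hXω
    apply propext
    by_cases h0 : N Δ ω = 0
    · have hNt (t : Set.Iio Δ) : N t ω = 0 := Nat.le_zero.1 ((hNω.1 (le_of_lt t.2)).trans h0.le)
      have hval : I.restrict (X ω).1 =
          G.driftedValues θ I (Finset.restrict (I.map _) fun t => Z t ω) := by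
        ext i
        simp [driftedValues, hXω i.1, hNt i.1]
      change (I.restrict (X ω).1 ∈ A ∧ X ω ∈ G.lumpFree Δ) ↔ (_ ∈ A ∧ N Δ ω = 0)
      rw [hval, hmem]
      simp only [hNt, h0, implies_true]
    · have hjump : X ω ∉ G.lumpFree Δ :=
        fun h => h0 (hNΔ fun t ht => hmem.1 h ⟨t, ht⟩)
      exact iff_of_false (fun h => hjump h.2) fun h => h0 h.2
  rw [Measure.map_apply hR hA, Measure.restrict_apply (hR hA), ← hlaw.map_eq,
    Measure.map_apply_of_aemeasurable hlaw.aemeasurable ((hR hA).inter G.measurableSet_lumpFree),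
    measure_congr hae, (indepFun_iff_measure_inter_preimage_eq_mul.1 hind) _ _
      (Finset.measurable_restrict _ hA') (measurable_pi_apply Δ (measurableSet_singleton 0)),
    Measure.smul_apply, smul_eq_mul, Measure.map_apply (G.measurable_driftedValues θ I) hA,
    mul_comm]
  congr 1
  · rw [← Real.coe_toNNReal _ (G.lam_nonneg θ)]
    exact hN.measure_eq_zero Δ
  · exact (hZ.hasLaw _).measure_eq (p := (· ∈ G.driftedValues θ I ⁻¹' A)) hA'

lemma measure_lumpFree (hΔ : 0 < Δ) {θ : Fin 2} {Q : Measure (G.ArmPath Δ)}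
    (hQ : G.IsArmLaw Δ θ Q) :
    Q (G.lumpFree Δ) = ENNReal.ofReal (Real.exp (-(G.lam θ * Δ))) := by
  have hR : Measurable fun y : G.ArmPath Δ => (∅ : Finset (Set.Iio Δ)).restrict y.1 :=
    (Finset.measurable_restrict ∅).comp measurable_subtype_coe
  have : IsProbabilityMeasure
      ((BrownianReal.projectiveFamily _).map (G.driftedValues θ (∅ : Finset (Set.Iio Δ)))) :=
    Measure.isProbabilityMeasure_map (G.measurable_driftedValues θ ∅).aemeasurable
  calc Q (G.lumpFree Δ)
      = (Q.restrict (G.lumpFree Δ)).map (fun y => Finset.restrict ∅ y.1) Set.univ := by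
        rw [Measure.map_apply hR .univ, Set.preimage_univ, Measure.restrict_apply_univ]
    _ = ENNReal.ofReal (Real.exp (-(G.lam θ * Δ))) := by
        rw [hQ.map_restrict_lumpFree hΔ ∅, Measure.smul_apply, measure_univ, smul_eq_mul, mul_one]

lemma ae_mem_lumpFree (hΔ : 0 < Δ) {θ : Fin 2} (hθ : G.lam θ = 0) {Q : Measure (G.ArmPath Δ)}
    [IsProbabilityMeasure Q] (hQ : G.IsArmLaw Δ θ Q) : ∀ᵐ y ∂Q, y ∈ G.lumpFree Δ := by
  refine (mem_ae_iff_prob_eq_one G.measurableSet_lumpFree).2 ?_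
  rw [hQ.measure_lumpFree hΔ, hθ]
  simp

lemma restrict_lumpFree_eq_smul (hα : G.α 0 = G.α 1) (h0 : G.lam 0 = 0) (hΔ : 0 < Δ)
    {Q₀ Q₁ : Measure (G.ArmPath Δ)} [IsProbabilityMeasure Q₀] (hQ₀ : G.IsArmLaw Δ 0 Q₀)
    (hQ₁ : G.IsArmLaw Δ 1 Q₁) :
    Q₁.restrict (G.lumpFree Δ) = ENNReal.ofReal (Real.exp (-G.lam 1 * Δ)) • Q₀ := by
  set c := ENNReal.ofReal (Real.exp (-G.lam 1 * Δ)) with hc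
  have hfin : IsFiniteMeasure (c • Q₀) := ⟨by simp [hc]⟩
  have hQ₀' : Q₀.restrict (G.lumpFree Δ) = Q₀ :=
    Measure.restrict_eq_self_of_ae_mem (hQ₀.ae_mem_lumpFree hΔ h0)
  have hfdd (I : Finset (Set.Iio Δ)) :
      (Q₁.restrict (G.lumpFree Δ)).map (fun y => I.restrict y.1) =
        (c • Q₀).map (fun y => I.restrict y.1) := by
    have h := hQ₀.map_restrict_lumpFree hΔ I
    rw [hQ₀', h0, zero_mul, neg_zero, Real.exp_zero, ENNReal.ofReal_one, one_smul] at h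
    have hdrift : G.driftedValues 0 I = G.driftedValues 1 I := by
      ext z i
      simp only [driftedValues, hα]
    rw [hQ₁.map_restrict_lumpFree hΔ, Measure.map_smul, h, hdrift, hc, neg_mul]
  have hmap : (Q₁.restrict (G.lumpFree Δ)).map Subtype.val = (c • Q₀).map Subtype.val := by
    refine IsProjectiveLimit.unique (P := fun I => (c • Q₀).map fun y => I.restrict y.1)
      (fun I => ?_) fun I => ?_ <;>
      rw [Measure.map_map (Finset.measurable_restrict I) measurable_subtype_coe]
    exacts [hfdd I, rfl]
  ext s hs
  obtain ⟨t, ht, rfl⟩ := hs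
  rw [← Measure.map_apply measurable_subtype_coe ht, hmap,
    Measure.map_apply measurable_subtype_coe ht]

end IsArmLaw
end Bandit

namespace Bandit

variable (G : Bandit) {N : ℕ} {Δ : ℝ≥0}

lemma measurable_start : Measurable (G.start N Δ) :=
  (G.measurable_sigma_mk 0).comp (measurable_const.prodMk measurable_id)

lemma measurable_next (x : G.Info N Δ) : Measurable (G.next x) :=
  (G.measurable_next_fiber x.1).comp
    (measurable_const.prodMk measurable_id : Measurable fun z => (x.2, z))

section Kernel

variable (Q : ProbabilityMeasure (G.ArmPath Δ)) (S : Fin N → G.Strategy N Δ)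

/-- Real-valued counterpart of `profileProb`: the probability of the action profile `a`. -/
noncomputable def weight (x : G.Info N Δ) (a : Fin N → Bool) : ℝ :=
  ∏ n, if a n then ((S n).act x : ℝ) else 1 - (S n).act x

lemma weight_factor_nonneg (x : G.Info N Δ) (b : Bool) (n : Fin N) :
    0 ≤ if b then ((S n).act x : ℝ) else 1 - (S n).act x := by
  split_ifs
  exacts [unitInterval.nonneg _, unitInterval.one_minus_nonneg _]

lemma weight_nonneg (x : G.Info N Δ) (a : Fin N → Bool) : 0 ≤ G.weight S x a :=
  Finset.prod_nonneg fun n _ => G.weight_factor_nonneg S x (a n) n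

lemma profileProb_eq_ofReal_weight (x : G.Info N Δ) (a : Fin N → Bool) :
    G.profileProb S x a = ENNReal.ofReal (G.weight S x a) :=
  (ENNReal.ofReal_prod_of_nonneg fun n _ => G.weight_factor_nonneg S x (a n) n).symm

lemma sum_weight (x : G.Info N Δ) : ∑ a, G.weight S x a = 1 := by
  have h := Finset.prod_univ_sum (fun _ : Fin N => (Finset.univ : Finset Bool))
    fun n b => if b then ((S n).act x : ℝ) else 1 - (S n).act x
  rw [Fintype.piFinset_univ] at h
  exact h.symm.trans (Finset.prod_eq_one fun n _ => by simp)

/-- Distribution of the observations made in one period and of the next public draw, given the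
action profile `a`. -/
noncomputable def outcome (a : Fin N → Bool) : Measure ((Fin N → G.Obs Δ) × unitInterval) :=
  (Measure.pi fun n => G.obsLaw Q (a n)).prod volume

instance (a : Fin N → Bool) : IsProbabilityMeasure (G.outcome Q a) := by
  unfold outcome
  infer_instance

lemma step_apply (x : G.Info N Δ) : G.step Q S x =
    ∑ a, ENNReal.ofReal (G.weight S x a) • (G.outcome Q a).map (G.next x) := by
  simp only [← profileProb_eq_ofReal_weight]
  rfl

instance : IsMarkovKernel (G.step Q S) where
  isProbabilityMeasure x := ⟨by
    have hmap (a : Fin N → Bool) : (G.outcome Q a).map (G.next x) Set.univ = 1 := by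
      rw [Measure.map_apply (G.measurable_next x) MeasurableSet.univ, Set.preimage_univ,
        measure_univ]
    simp only [step_apply, Measure.coe_finsetSum, Finset.sum_apply, Measure.smul_apply,
      smul_eq_mul, hmap, mul_one]
    rw [← ENNReal.ofReal_sum_of_nonneg fun a _ => G.weight_nonneg S x a, G.sum_weight,
      ENNReal.ofReal_one]⟩

instance isMarkovKernel_ahead : ∀ j, IsMarkovKernel (G.ahead Q S j)
  | 0 => by unfold ahead; infer_instance
  | j + 1 => by
    have := isMarkovKernel_ahead j
    unfold ahead
    infer_instance

lemma integral_step (x : G.Info N Δ) {f : G.Info N Δ → ℝ} (hf : Measurable f) {B : ℝ}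
    (hB : ∀ y, |f y| ≤ B) :
    ∫ y, f y ∂G.step Q S x = ∑ a, G.weight S x a * ∫ z, f (G.next x z) ∂G.outcome Q a := by
  have hint (a : Fin N → Bool) : Integrable f ((G.outcome Q a).map (G.next x)) :=
    have := Measure.isProbabilityMeasure_map (μ := G.outcome Q a) (G.measurable_next x).aemeasurable
    Integrable.of_bound hf.aestronglyMeasurable B (Eventually.of_forall hB)
  rw [G.step_apply, integral_finsetSum_measure fun a _ =>
    (hint a).smul_measure ENNReal.ofReal_ne_top]
  refine Finset.sum_congr rfl fun a _ => ?_
  rw [integral_smul_measure, ENNReal.toReal_ofReal (G.weight_nonneg S x a), smul_eq_mul,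
    integral_map (G.measurable_next x).aemeasurable hf.aestronglyMeasurable]

lemma ae_step {x : G.Info N Δ} {P : G.Info N Δ → Prop} (hP : MeasurableSet {y | P y})
    (h : ∀ a, 0 < G.weight S x a → ∀ᵐ z ∂G.outcome Q a, P (G.next x z)) :
    ∀ᵐ y ∂G.step Q S x, P y := by
  rw [ae_iff, G.step_apply, Measure.coe_finsetSum, Finset.sum_apply]
  refine Finset.sum_eq_zero fun a _ => ?_
  rw [Measure.smul_apply, smul_eq_mul]
  rcases (G.weight_nonneg S x a).eq_or_lt with h0 | h0
  · rw [← h0, ENNReal.ofReal_zero, zero_mul]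
  · rw [ae_iff.1 ((ae_map_iff (G.measurable_next x).aemeasurable hP).2 (h a h0)), mul_zero]

end Kernel

section Regret

variable (Q : Fin 2 → ProbabilityMeasure (G.ArmPath Δ)) (S : Fin N → G.Strategy N Δ) (n : Fin N)
  (θ : Fin 2)

lemma discount_pos : 0 < G.discount Δ := Real.exp_pos _

lemma discount_lt_one (hΔ : 0 < Δ) : G.discount Δ < 1 :=
  Real.exp_lt_one_iff.2 <| by
    rw [neg_mul]
    exact neg_neg_of_pos (mul_pos G.r_pos (NNReal.coe_pos.2 hΔ))

/-- The probability with which player `n` uses the arm that is inferior in state `θ`. -/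
noncomputable def errorProb (x : G.Info N Δ) : ℝ :=
  if θ = 1 then 1 - (S n).act x else (S n).act x

lemma measurable_errorProb : Measurable (G.errorProb S n θ) := by
  have h := measurable_subtype_coe.comp (S n).measurable_act
  unfold errorProb
  split_ifs
  exacts [h.const_sub 1, h]

lemma errorProb_nonneg (x : G.Info N Δ) : 0 ≤ G.errorProb S n θ x := by
  unfold errorProb
  split_ifs
  exacts [unitInterval.one_minus_nonneg _, unitInterval.nonneg _]

lemma errorProb_le_one (x : G.Info N Δ) : G.errorProb S n θ x ≤ 1 := by
  unfold errorProb
  split_ifs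
  exacts [unitInterval.one_minus_le_one _, unitInterval.le_one _]

lemma integrable_errorProb (μ : Measure (G.Info N Δ)) [IsFiniteMeasure μ] :
    Integrable (G.errorProb S n θ) μ :=
  Integrable.of_bound (G.measurable_errorProb S n θ).aestronglyMeasurable 1 <|
    Eventually.of_forall fun x => by
      rw [Real.norm_of_nonneg (G.errorProb_nonneg S n θ x)]
      exact G.errorProb_le_one S n θ x

lemma flow_eq_max_sub (x : G.Info N Δ) :
    (1 - ((S n).act x : ℝ)) * G.s + (S n).act x * G.m θ =
      max G.s (G.m θ) - |G.m θ - G.s| * G.errorProb S n θ x := by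
  have h0 : G.m 0 < G.s := G.low_lt_safe
  have h1 : G.s < G.m 1 := G.safe_lt_high
  fin_cases θ
  · simp only [Fin.zero_eta, max_eq_left h0.le, abs_of_neg (sub_neg.2 h0), errorProb,
      zero_ne_one, if_false]
    ring
  · simp only [Fin.mk_one, max_eq_right h1.le, abs_of_pos (sub_pos.2 h1), errorProb, if_true]
    ring

/-- Expected error probability `j` periods ahead. -/
noncomputable def errorAhead (j : ℕ) (x : G.Info N Δ) : ℝ :=
  ∫ y, G.errorProb S n θ y ∂G.ahead (Q θ) S j x

lemma errorAhead_nonneg (j : ℕ) (x : G.Info N Δ) : 0 ≤ G.errorAhead Q S n θ j x :=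
  integral_nonneg (G.errorProb_nonneg S n θ)

lemma errorAhead_le_one (j : ℕ) (x : G.Info N Δ) : G.errorAhead Q S n θ j x ≤ 1 := by
  simpa [errorAhead] using integral_mono (G.integrable_errorProb S n θ (G.ahead (Q θ) S j x))
    (integrable_const 1) (G.errorProb_le_one S n θ)

lemma measurable_errorAhead (j : ℕ) : Measurable (G.errorAhead Q S n θ j) :=
  ((G.measurable_errorProb S n θ).stronglyMeasurable.integral_kernel
    (κ := G.ahead (Q θ) S j)).measurable

lemma errorAhead_zero (x : G.Info N Δ) : G.errorAhead Q S n θ 0 x = G.errorProb S n θ x := by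
  rw [errorAhead, ahead, Kernel.id_apply,
    integral_dirac' _ _ (G.measurable_errorProb S n θ).stronglyMeasurable]

lemma errorAhead_succ (j : ℕ) (x : G.Info N Δ) :
    G.errorAhead Q S n θ (j + 1) x = ∫ y, G.errorAhead Q S n θ j y ∂G.step (Q θ) S x := by
  rw [errorAhead, ahead, Kernel.integral_comp (G.integrable_errorProb S n θ _)]
  rfl

/-- Expected discounted frequency, in state `θ`, with which player `n` uses the inferior arm from
the information `x` on. -/
noncomputable def regret (x : G.Info N Δ) : ℝ :=
  (1 - G.discount Δ) * ∑' j, G.discount Δ ^ j * G.errorAhead Q S n θ j x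

lemma discounted_errorAhead_nonneg (j : ℕ) (x : G.Info N Δ) :
    0 ≤ G.discount Δ ^ j * G.errorAhead Q S n θ j x :=
  mul_nonneg (pow_nonneg G.discount_pos.le j) (G.errorAhead_nonneg Q S n θ j x)

lemma discounted_errorAhead_le (j : ℕ) (x : G.Info N Δ) :
    G.discount Δ ^ j * G.errorAhead Q S n θ j x ≤ G.discount Δ ^ j :=
  mul_le_of_le_one_right (pow_nonneg G.discount_pos.le j) (G.errorAhead_le_one Q S n θ j x)

lemma summable_discounted_errorAhead (hΔ : 0 < Δ) (x : G.Info N Δ) :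
    Summable fun j => G.discount Δ ^ j * G.errorAhead Q S n θ j x :=
  (summable_geometric_of_lt_one G.discount_pos.le (G.discount_lt_one hΔ)).of_nonneg_of_le
    (fun j => G.discounted_errorAhead_nonneg Q S n θ j x)
    fun j => G.discounted_errorAhead_le Q S n θ j x

lemma regret_nonneg (hΔ : 0 < Δ) (x : G.Info N Δ) : 0 ≤ G.regret Q S n θ x :=
  mul_nonneg (sub_nonneg.2 (G.discount_lt_one hΔ).le)
    (tsum_nonneg fun j => G.discounted_errorAhead_nonneg Q S n θ j x)

lemma regret_le_one (hΔ : 0 < Δ) (x : G.Info N Δ) : G.regret Q S n θ x ≤ 1 := by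
  have hδ := G.discount_lt_one hΔ
  have hgeom := hasSum_geometric_of_lt_one G.discount_pos.le hδ
  calc G.regret Q S n θ x ≤ (1 - G.discount Δ) * (1 - G.discount Δ)⁻¹ :=
        mul_le_mul_of_nonneg_left
          (hgeom.tsum_eq ▸ (G.summable_discounted_errorAhead Q S n θ hΔ x).tsum_le_tsum
            (fun j => G.discounted_errorAhead_le Q S n θ j x) hgeom.summable)
          (sub_nonneg.2 hδ.le)
    _ = 1 := mul_inv_cancel₀ (sub_pos.2 hδ).ne'

lemma abs_regret_le_one (hΔ : 0 < Δ) (x : G.Info N Δ) : |G.regret Q S n θ x| ≤ 1 := by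
  rw [abs_of_nonneg (G.regret_nonneg Q S n θ hΔ x)]
  exact G.regret_le_one Q S n θ hΔ x

lemma measurable_regret (hΔ : 0 < Δ) : Measurable (G.regret Q S n θ) := by
  refine Measurable.const_mul (measurable_of_tendsto_metrizable (f := fun k x =>
    ∑ j ∈ Finset.range k, G.discount Δ ^ j * G.errorAhead Q S n θ j x) (fun k => ?_) ?_) _
  · exact Finset.measurable_sum _ fun j _ => (G.measurable_errorAhead Q S n θ j).const_mul _
  · rw [tendsto_pi_nhds]
    exact fun x => (G.summable_discounted_errorAhead Q S n θ hΔ x).hasSum.tendsto_sum_nat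

lemma integrable_regret (hΔ : 0 < Δ) (μ : Measure (G.Info N Δ)) [IsFiniteMeasure μ] :
    Integrable (G.regret Q S n θ) μ :=
  Integrable.of_bound (G.measurable_regret Q S n θ hΔ).aestronglyMeasurable 1
    (Eventually.of_forall (G.abs_regret_le_one Q S n θ hΔ))

lemma tsum_discounted_errorAhead_succ (hΔ : 0 < Δ) (x : G.Info N Δ) :
    ∑' j, G.discount Δ ^ j * G.errorAhead Q S n θ (j + 1) x =
      ∫ y, ∑' j, G.discount Δ ^ j * G.errorAhead Q S n θ j y ∂G.step (Q θ) S x := by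
  have hint (j : ℕ) : Integrable (fun y => G.discount Δ ^ j * G.errorAhead Q S n θ j y)
      (G.step (Q θ) S x) :=
    Integrable.of_bound ((G.measurable_errorAhead Q S n θ j).const_mul _).aestronglyMeasurable
      (G.discount Δ ^ j) <| Eventually.of_forall fun y => by
        rw [Real.norm_of_nonneg (G.discounted_errorAhead_nonneg Q S n θ j y)]
        exact G.discounted_errorAhead_le Q S n θ j y
  have hnorm (j : ℕ) : ∫ y, ‖G.discount Δ ^ j * G.errorAhead Q S n θ j y‖ ∂G.step (Q θ) S x =
      G.discount Δ ^ j * G.errorAhead Q S n θ (j + 1) x := by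
    simp only [Real.norm_of_nonneg (G.discounted_errorAhead_nonneg Q S n θ j _),
      integral_const_mul, errorAhead_succ]
  have hsum : Summable fun j => G.discount Δ ^ j * G.errorAhead Q S n θ (j + 1) x :=
    (summable_geometric_of_lt_one G.discount_pos.le (G.discount_lt_one hΔ)).of_nonneg_of_le
      (fun j => mul_nonneg (pow_nonneg G.discount_pos.le j) (G.errorAhead_nonneg Q S n θ _ x))
      fun j => mul_le_of_le_one_right (pow_nonneg G.discount_pos.le j)
        (G.errorAhead_le_one Q S n θ _ x)
  rw [← (hasSum_integral_of_summable_integral_norm hint (by simpa only [hnorm])).tsum_eq]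
  simp only [integral_const_mul, errorAhead_succ]

lemma regret_rec (hΔ : 0 < Δ) (x : G.Info N Δ) :
    G.regret Q S n θ x = (1 - G.discount Δ) * G.errorProb S n θ x +
      G.discount Δ * ∫ y, G.regret Q S n θ y ∂G.step (Q θ) S x := by
  simp only [regret]
  rw [(G.summable_discounted_errorAhead Q S n θ hΔ x).tsum_eq_zero_add, integral_const_mul,
    ← G.tsum_discounted_errorAhead_succ Q S n θ hΔ x, pow_zero, one_mul, errorAhead_zero]
  simp only [pow_succ', mul_assoc, tsum_mul_left]
  ring

lemma statePayoff_eq_max_sub (hΔ : 0 < Δ) (x : G.Info N Δ) :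
    G.statePayoff Q S n θ x = max G.s (G.m θ) - |G.m θ - G.s| * G.regret Q S n θ x := by
  have hδ := G.discount_lt_one hΔ
  have hflow (j : ℕ) : ∫ y, ((1 - ((S n).act y : ℝ)) * G.s + (S n).act y * G.m θ)
      ∂G.ahead (Q θ) S j x = max G.s (G.m θ) - |G.m θ - G.s| * G.errorAhead Q S n θ j x := by
    simp only [G.flow_eq_max_sub S n θ]
    rw [integral_sub (integrable_const _) ((G.integrable_errorProb S n θ _).const_mul _),
      integral_const_mul, integral_const, probReal_univ, one_smul, errorAhead]
  have hsum := ((hasSum_geometric_of_lt_one G.discount_pos.le hδ).mul_left (max G.s (G.m θ))).sub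
    ((G.summable_discounted_errorAhead Q S n θ hΔ x).hasSum.mul_left |G.m θ - G.s|)
  rw [statePayoff, tsum_congr fun j => by rw [hflow j], regret,
    (hsum.congr_fun fun j => by ring).tsum_eq, mul_sub, mul_left_comm, mul_left_comm _ |_|,
    mul_inv_cancel₀ (sub_pos.2 hδ).ne', mul_one]

lemma statePayoff_one (hΔ : 0 < Δ) (x : G.Info N Δ) :
    G.statePayoff Q S n 1 x = G.m 1 - (G.m 1 - G.s) * G.regret Q S n 1 x := by
  have h : G.s < G.m 1 := G.safe_lt_high
  rw [G.statePayoff_eq_max_sub Q S n 1 hΔ, max_eq_right h.le, abs_of_pos (sub_pos.2 h)]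

lemma statePayoff_zero (hΔ : 0 < Δ) (x : G.Info N Δ) :
    G.statePayoff Q S n 0 x = G.s - (G.s - G.m 0) * G.regret Q S n 0 x := by
  have h : G.m 0 < G.s := G.low_lt_safe
  rw [G.statePayoff_eq_max_sub Q S n 0 hΔ, max_eq_left h.le, abs_of_neg (sub_neg.2 h), neg_sub]

end Regret

end Bandit

/-- Number of players who use the risky arm under the action profile `a`. -/
def riskyCount {N : ℕ} (a : Fin N → Bool) : ℕ := ∑ n, (a n).toNat

namespace Bandit

variable (G : Bandit) {N : ℕ} {Δ : ℝ≥0}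

section Observations

/-- Observations of a player that do not contain a lump-sum. -/
def clean (Δ : ℝ≥0) : Set (G.Obs Δ) := Sum.elim (fun _ => True) (fun y => y ∈ G.lumpFree Δ)

lemma measurableSet_clean : MeasurableSet (G.clean Δ) :=
  measurableSet_sum_iff.2 ⟨MeasurableSet.univ, G.measurableSet_lumpFree⟩

/-- Observations of all players without a lump-sum, together with any public draw. -/
def cleanProfile (N : ℕ) (Δ : ℝ≥0) : Set ((Fin N → G.Obs Δ) × unitInterval) :=
  (Set.univ.pi fun _ => G.clean Δ) ×ˢ Set.univ

lemma mem_cleanProfile {z : (Fin N → G.Obs Δ) × unitInterval} :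
    z ∈ G.cleanProfile N Δ ↔ ∀ n, z.1 n ∈ G.clean Δ := by
  simp only [cleanProfile, Set.mem_prod, Set.mem_univ_pi, Set.mem_univ, and_true]

lemma measurableSet_cleanProfile : MeasurableSet (G.cleanProfile N Δ) :=
  (MeasurableSet.univ_pi fun _ => G.measurableSet_clean).prod MeasurableSet.univ

/-- Number of players observed using the risky arm. -/
def usage (o : Fin N → G.Obs Δ) : ℕ := riskyCount fun n => (o n).isRight

lemma measurable_isRight : Measurable (Sum.isRight : G.Obs Δ → Bool) :=
  measurable_fun_sum measurable_const measurable_const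

lemma measurable_usage : Measurable (G.usage : (Fin N → G.Obs Δ) → ℕ) := by
  unfold usage riskyCount
  exact Finset.measurable_sum _ fun n _ =>
    (measurable_of_countable Bool.toNat).comp (G.measurable_isRight.comp (measurable_pi_apply n))

/-- Probability in state `1` that a risky arm yields no lump-sum in one period. -/
noncomputable def failure (Δ : ℝ≥0) : ℝ := Real.exp (-G.lam 1 * Δ)

lemma failure_pos : 0 < G.failure Δ := Real.exp_pos _

lemma alpha_eq_of_rho_eq_zero (hρ : G.rho = 0) : G.α 0 = G.α 1 := by
  have h := (div_eq_zero_iff.1 hρ).resolve_right (pow_pos G.σ_pos 2).ne'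
  exact (sub_eq_zero.1 (pow_eq_zero_iff two_ne_zero |>.1 h)).symm

lemma lam_one_pos (hα : G.α 0 = G.α 1) (h0 : G.lam 0 = 0) : 0 < G.lam 1 := by
  have h := G.low_lt_safe.trans G.safe_lt_high
  rw [hα, h0, zero_mul, add_zero, lt_add_iff_pos_right] at h
  exact pos_of_mul_pos_left h G.h_pos.le

lemma failure_lt_one (hα : G.α 0 = G.α 1) (h0 : G.lam 0 = 0) (hΔ : 0 < Δ) : G.failure Δ < 1 :=
  Real.exp_lt_one_iff.2 <| by
    rw [neg_mul]
    exact neg_neg_of_pos (mul_pos (G.lam_one_pos hα h0) (NNReal.coe_pos.2 hΔ))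

lemma rates (hα : G.α 0 = G.α 1) (h0 : G.lam 0 = 0) (hΔ : 0 < Δ) :
    Rates (G.discount Δ) (G.failure Δ) :=
  rates_exp G.r_pos (G.lam_one_pos hα h0) (NNReal.coe_pos.2 hΔ)

lemma obsLikelihood_zero_pos (h0 : G.lam 0 = 0) {o : G.Obs Δ} (ho : o ∈ G.clean Δ) :
    0 < G.obsLikelihood 0 o := by
  rcases o with _ | y
  · exact one_pos
  · have hy : G.lumps y = 0 := ho
    rw [obsLikelihood, h0, hy, pow_zero, one_mul]
    positivity

lemma obsLikelihood_zero_of_notMem (h0 : G.lam 0 = 0) {o : G.Obs Δ} (ho : o ∉ G.clean Δ) :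
    G.obsLikelihood 0 o = 0 := by
  rcases o with _ | y
  · exact absurd trivial ho
  · have hy : G.lumps y ≠ 0 := ho
    rw [obsLikelihood, h0, zero_pow hy, zero_mul, mul_zero]

lemma obsLikelihood_one_pos (hα : G.α 0 = G.α 1) (h0 : G.lam 0 = 0) (o : G.Obs Δ) :
    0 < G.obsLikelihood 1 o := by
  rcases o with _ | y
  · exact one_pos
  · exact mul_pos (Real.exp_pos _) (mul_pos (pow_pos (G.lam_one_pos hα h0) _) (Real.exp_pos _))

lemma obsLikelihood_one_eq (hα : G.α 0 = G.α 1) (h0 : G.lam 0 = 0) {o : G.Obs Δ}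
    (ho : o ∈ G.clean Δ) :
    G.obsLikelihood 1 o = G.obsLikelihood 0 o * G.failure Δ ^ o.isRight.toNat := by
  rcases o with _ | y
  · simp [obsLikelihood]
  · have hy : G.lumps y = 0 := ho
    simp [obsLikelihood, hy, h0, hα, failure]

end Observations

section Histories

/-- Number of past uses of the risky arm, over all players and periods. -/
def trials (x : G.Info N Δ) : ℕ := ∑ i : Fin x.1, G.usage (x.2.1 i).2

/-- Some player has received a lump-sum. -/
def Breakthrough (x : G.Info N Δ) : Prop := ∃ i : Fin x.1, ∃ n, (x.2.1 i).2 n ∉ G.clean Δ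

lemma trials_start (u : unitInterval) : G.trials (G.start N Δ u) = 0 :=
  Fin.sum_univ_zero _

lemma trials_next (x : G.Info N Δ) (z : (Fin N → G.Obs Δ) × unitInterval) :
    G.trials (G.next x z) = G.trials x + G.usage z.1 := by
  have h := Fin.sum_univ_castSucc fun i : Fin (x.1 + 1) => G.usage ((G.next x z).2.1 i).2
  simp only [next, Fin.snoc_castSucc, Fin.snoc_last] at h
  exact h

lemma measurable_observations {ℓ : ℕ} (i : Fin ℓ) :
    Measurable fun z : (Fin ℓ → G.Period N Δ) × unitInterval => (z.1 i).2 :=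
  ((measurable_pi_apply i).comp measurable_fst).snd

lemma measurable_trials : Measurable (G.trials : G.Info N Δ → ℕ) := by
  refine G.measurable_of_fibers fun ℓ => ?_
  change Measurable fun z : (Fin ℓ → G.Period N Δ) × unitInterval => ∑ i, G.usage (z.1 i).2
  exact Finset.measurable_fun_sum _ fun i _ =>
    G.measurable_usage.comp (G.measurable_observations i)

lemma measurable_failure_pow : Measurable fun x : G.Info N Δ => G.failure Δ ^ G.trials x :=
  (measurable_of_countable fun j : ℕ => G.failure Δ ^ j).comp G.measurable_trials

lemma not_breakthrough_start (u : unitInterval) : ¬ G.Breakthrough (G.start N Δ u) :=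
  fun ⟨i, _⟩ => i.elim0

lemma breakthrough_next {x : G.Info N Δ} {z : (Fin N → G.Obs Δ) × unitInterval} :
    G.Breakthrough (G.next x z) ↔ G.Breakthrough x ∨ z ∉ G.cleanProfile N Δ := by
  have h := Fin.exists_fin_succ' (P := fun i : Fin (x.1 + 1) =>
    ∃ n, ((G.next x z).2.1 i).2 n ∉ G.clean Δ)
  simp only [next, Fin.snoc_castSucc, Fin.snoc_last] at h
  rw [mem_cleanProfile, not_forall]
  exact h

lemma measurableSet_breakthrough : MeasurableSet {x : G.Info N Δ | G.Breakthrough x} := by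
  refine measurableSet_setOfPred.2 (G.measurable_of_fibers fun ℓ => ?_)
  have hobs (i : Fin ℓ) (n : Fin N) : Measurable
      fun z : (Fin ℓ → G.Period N Δ) × unitInterval => (z.1 i).2 n ∉ G.clean Δ :=
    measurableSet_setOfPred.1
      (((measurable_pi_apply n).comp (G.measurable_observations i)) G.measurableSet_clean).compl
  exact Measurable.exists fun i => Measurable.exists (hobs i)

lemma measurableSet_not_breakthrough : MeasurableSet {x : G.Info N Δ | ¬ G.Breakthrough x} :=
  G.measurableSet_breakthrough.compl

variable (rew : Bool → ℕ → ℕ → unitInterval) (i₀ : Bool)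

/-- Recursion over the periods that defines `mode`. -/
noncomputable def modeAux : ∀ ℓ : ℕ, (Fin ℓ → G.Period N Δ) → unitInterval → Bool
  | 0, _, _ => i₀
  | ℓ + 1, h, u =>
    let y : G.Info N Δ := ⟨ℓ, (Fin.init h, (h (Fin.last ℓ)).1)⟩
    decide (u ≤ rew (modeAux ℓ y.2.1 y.2.2) (G.trials y) (G.usage (h (Fin.last ℓ)).2))

/-- The current mode, if the initial mode is `i₀` and the public draw at the beginning of each
later period selects the mode `true` with probability `rew i j k`, where `i` is the mode of the
previous period, `j` the number of trials before that period and `k` the number of trials in it. -/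
noncomputable def mode (x : G.Info N Δ) : Bool := G.modeAux rew i₀ x.1 x.2.1 x.2.2

lemma mode_start (u : unitInterval) : G.mode rew i₀ (G.start N Δ u) = i₀ := rfl

lemma mode_next (x : G.Info N Δ) (z : (Fin N → G.Obs Δ) × unitInterval) :
    G.mode rew i₀ (G.next x z) =
      decide (z.2 ≤ rew (G.mode rew i₀ x) (G.trials x) (G.usage z.1)) := by
  simp only [mode, next, modeAux, Fin.init_snoc, Fin.snoc_last, Prod.mk.eta, Sigma.eta]
  rfl

lemma measurable_mode : Measurable (G.mode rew i₀ : G.Info N Δ → Bool) := by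
  refine G.measurable_of_fibers fun ℓ => ?_
  change Measurable fun z : (Fin ℓ → G.Period N Δ) × unitInterval => G.modeAux rew i₀ ℓ z.1 z.2
  induction ℓ with
  | zero => exact measurable_const
  | succ ℓ ih =>
    have hprev : Measurable fun z : (Fin (ℓ + 1) → G.Period N Δ) × unitInterval =>
        ((Fin.init z.1 : Fin ℓ → G.Period N Δ), (z.1 (Fin.last ℓ)).1) :=
      (measurable_pi_iff.2 fun i =>
        (measurable_pi_apply (Fin.castSucc i)).comp measurable_fst).prodMk (by fun_prop)
    have husage : Measurable fun z : (Fin (ℓ + 1) → G.Period N Δ) × unitInterval =>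
        G.usage (z.1 (Fin.last ℓ)).2 := G.measurable_usage.comp (by fun_prop)
    have hrew := (measurable_of_countable fun t : Bool × ℕ × ℕ => rew t.1 t.2.1 t.2.2).comp <|
      (ih.comp hprev).prodMk <|
        (G.measurable_trials.comp ((G.measurable_sigma_mk ℓ).comp hprev)).prodMk husage
    refine measurable_to_bool ?_
    convert measurableSet_le measurable_snd hrew using 1
    ext z
    exact decide_eq_true_iff

lemma measurable_of_mode_trials {β : Type*} [MeasurableSpace β] (F : Bool → ℕ → β) :
    Measurable fun x : G.Info N Δ => F (G.mode rew i₀ x) (G.trials x) :=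
  (measurable_of_countable fun t : Bool × ℕ => F t.1 t.2).comp
    ((G.measurable_mode rew i₀).prodMk G.measurable_trials)

end Histories

section Beliefs

lemma likelihood_one_pos (hα : G.α 0 = G.α 1) (h0 : G.lam 0 = 0) (x : G.Info N Δ) :
    0 < G.likelihood 1 x :=
  Finset.prod_pos fun _ _ => Finset.prod_pos fun _ _ => G.obsLikelihood_one_pos hα h0 _

lemma likelihood_zero_pos (h0 : G.lam 0 = 0) {x : G.Info N Δ} (hx : ¬ G.Breakthrough x) :
    0 < G.likelihood 0 x :=
  Finset.prod_pos fun i _ => Finset.prod_pos fun n _ =>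
    G.obsLikelihood_zero_pos h0 (not_not.1 fun hn => hx ⟨i, n, hn⟩)

lemma likelihood_zero_of_breakthrough (h0 : G.lam 0 = 0) {x : G.Info N Δ}
    (hx : G.Breakthrough x) : G.likelihood 0 x = 0 := by
  obtain ⟨i, n, hn⟩ := hx
  exact Finset.prod_eq_zero (Finset.mem_univ i)
    (Finset.prod_eq_zero (Finset.mem_univ n) (G.obsLikelihood_zero_of_notMem h0 hn))

lemma likelihood_one_eq (hα : G.α 0 = G.α 1) (h0 : G.lam 0 = 0) {x : G.Info N Δ}
    (hx : ¬ G.Breakthrough x) :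
    G.likelihood 1 x = G.likelihood 0 x * G.failure Δ ^ G.trials x := by
  have hobs (i : Fin x.1) (n : Fin N) :=
    G.obsLikelihood_one_eq hα h0 (not_not.1 fun hn : (x.2.1 i).2 n ∉ G.clean Δ => hx ⟨i, n, hn⟩)
  simp only [likelihood, hobs, Finset.prod_mul_distrib, Finset.prod_pow_eq_pow_sum]
  rfl

lemma belief_one (hα : G.α 0 = G.α 1) (h0 : G.lam 0 = 0) (x : G.Info N Δ) : G.belief 1 x = 1 := by
  rw [belief, sub_self, zero_mul, add_zero, one_mul,
    div_self (G.likelihood_one_pos hα h0 x).ne']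

lemma belief_of_breakthrough (hα : G.α 0 = G.α 1) (h0 : G.lam 0 = 0) {p : ℝ} (hp : 0 < p)
    {x : G.Info N Δ} (hx : G.Breakthrough x) : G.belief p x = 1 := by
  rw [belief, G.likelihood_zero_of_breakthrough h0 hx, mul_zero, add_zero,
    div_self (mul_pos hp (G.likelihood_one_pos hα h0 x)).ne']

lemma belief_of_not_breakthrough (hα : G.α 0 = G.α 1) (h0 : G.lam 0 = 0) (p : ℝ)
    {x : G.Info N Δ} (hx : ¬ G.Breakthrough x) :
    G.belief p x = p * G.failure Δ ^ G.trials x / (p * G.failure Δ ^ G.trials x + (1 - p)) := by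
  rw [belief, G.likelihood_one_eq hα h0 hx, mul_left_comm, mul_comm (1 - p), ← mul_add,
    mul_div_mul_left _ _ (G.likelihood_zero_pos h0 hx).ne']

/-- Odds ratio of the belief `c`, normalized to `1` at the myopic cutoff. -/
noncomputable def odds (c : ℝ) : ℝ := c * (G.m 1 - G.s) / ((1 - c) * (G.s - G.m 0))

lemma gain_pos : 0 < G.m 1 - G.s := sub_pos.2 G.safe_lt_high

lemma loss_pos : 0 < G.s - G.m 0 := sub_pos.2 G.low_lt_safe

lemma odds_pos {c : ℝ} (hc : 0 < c) (hc1 : c < 1) : 0 < G.odds c :=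
  div_pos (mul_pos hc G.gain_pos) (mul_pos (sub_pos.2 hc1) G.loss_pos)

lemma odds_lt_odds {c d : ℝ} (hc : 0 < c) (hd : d < 1) (h : c < d) : G.odds c < G.odds d := by
  have hgain := G.gain_pos
  have hloss := G.loss_pos
  have hd0 := hc.trans h
  unfold odds
  gcongr

lemma odds_le_odds_iff {c d : ℝ} (hc : 0 < c) (hc1 : c < 1) (hd : 0 < d) (hd1 : d < 1) :
    G.odds c ≤ G.odds d ↔ c ≤ d := by
  refine ⟨fun h => le_of_not_gt fun hlt => (G.odds_lt_odds hd hc1 hlt).not_ge h, fun h => ?_⟩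
  rcases h.eq_or_lt with rfl | hlt
  exacts [le_rfl, (G.odds_lt_odds hc hd1 hlt).le]

lemma belief_mem_Ioo (hα : G.α 0 = G.α 1) (h0 : G.lam 0 = 0) {p : ℝ} (hp : 0 < p) (hp1 : p < 1)
    {x : G.Info N Δ} (hx : ¬ G.Breakthrough x) : G.belief p x ∈ Set.Ioo 0 1 := by
  have hq := mul_pos hp (pow_pos (G.failure_pos (Δ := Δ)) (G.trials x))
  have hden := add_pos hq (sub_pos.2 hp1)
  rw [G.belief_of_not_breakthrough hα h0 p hx]
  exact ⟨div_pos hq hden, (div_lt_one hden).2 (lt_add_of_pos_right _ (sub_pos.2 hp1))⟩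

lemma odds_belief (hα : G.α 0 = G.α 1) (h0 : G.lam 0 = 0) {p : ℝ} (hp : 0 < p) (hp1 : p < 1)
    {x : G.Info N Δ} (hx : ¬ G.Breakthrough x) :
    G.odds (G.belief p x) = G.odds p * G.failure Δ ^ G.trials x := by
  have hq := mul_pos hp (pow_pos (G.failure_pos (Δ := Δ)) (G.trials x))
  have hp1' := sub_pos.2 hp1
  have hden := add_pos hq hp1'
  have hloss := G.loss_pos
  rw [odds, odds, G.belief_of_not_breakthrough hα h0 p hx, one_sub_div hden.ne',
    add_sub_cancel_left]
  field_simp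

lemma lam_one_mul_eq_of_isExponent (hρ : G.rho = 0) (h0 : G.lam 0 = 0) {μ : ℝ}
    (hμ : G.IsExponent 1 μ) : G.lam 1 * μ = G.r := by
  have h := hμ.2
  simp only [hρ, h0, zero_div, zero_mul, sub_zero, zero_add, add_zero, Nat.cast_one, div_one] at h
  exact sub_eq_zero.1 h

lemma cutoff_pos {μ : ℝ} (hμ : 0 < μ) : 0 < G.cutoff μ :=
  div_pos (mul_pos hμ G.loss_pos) (add_pos (mul_pos (add_pos hμ one_pos) G.gain_pos)
    (mul_pos hμ G.loss_pos))

lemma odds_cutoff {μ : ℝ} (hμ : 0 < μ) : G.odds (G.cutoff μ) = μ / (μ + 1) := by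
  have hgain := G.gain_pos
  have hloss := G.loss_pos
  have hden : 0 < (μ + 1) * (G.m 1 - G.s) + μ * (G.s - G.m 0) := by positivity
  rw [odds, cutoff, one_sub_div hden.ne', add_sub_cancel_right]
  field_simp

lemma odds_cutoff_of_isExponent (hρ : G.rho = 0) (h0 : G.lam 0 = 0) {μ : ℝ}
    (hμ : G.IsExponent 1 μ) : G.odds (G.cutoff μ) = G.r / (G.r + G.lam 1) := by
  have hl := G.lam_one_pos (G.alpha_eq_of_rho_eq_zero hρ) h0
  rw [G.odds_cutoff hμ.1, ← G.lam_one_mul_eq_of_isExponent hρ h0 hμ, ← mul_add_one,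
    mul_div_mul_left _ _ hl.ne']

end Beliefs

section Transitions

lemma obsLaw_restrict (hα : G.α 0 = G.α 1) (h0 : G.lam 0 = 0) (hΔ : 0 < Δ)
    {Q₀ Q₁ : ProbabilityMeasure (G.ArmPath Δ)} (hQ₀ : G.IsArmLaw Δ 0 Q₀) (hQ₁ : G.IsArmLaw Δ 1 Q₁)
    (b : Bool) : (G.obsLaw Q₁ b).restrict (G.clean Δ) =
      ENNReal.ofReal (G.failure Δ ^ b.toNat) • G.obsLaw Q₀ b := by
  cases b
  · classical
    simp only [obsLaw, Bool.false_eq_true, if_false, Bool.toNat_false, pow_zero,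
      ENNReal.ofReal_one, one_smul]
    exact (restrict_dirac' G.measurableSet_clean).trans (if_pos trivial)
  · simp only [obsLaw, if_true, Bool.toNat_true, pow_one, failure]
    rw [Measure.restrict_map measurable_inr G.measurableSet_clean, ← Measure.map_smul,
      ← IsArmLaw.restrict_lumpFree_eq_smul hα h0 hΔ hQ₀ hQ₁]
    rfl

lemma outcome_restrict (hα : G.α 0 = G.α 1) (h0 : G.lam 0 = 0) (hΔ : 0 < Δ)
    {Q₀ Q₁ : ProbabilityMeasure (G.ArmPath Δ)} (hQ₀ : G.IsArmLaw Δ 0 Q₀) (hQ₁ : G.IsArmLaw Δ 1 Q₁)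
    (a : Fin N → Bool) : (G.outcome Q₁ a).restrict (G.cleanProfile N Δ) =
      ENNReal.ofReal (G.failure Δ ^ riskyCount a) • G.outcome Q₀ a := by
  have hpi : (Measure.pi fun n => G.obsLaw Q₁ (a n)).restrict (Set.univ.pi fun _ => G.clean Δ) =
      ENNReal.ofReal (G.failure Δ ^ riskyCount a) • Measure.pi fun n => G.obsLaw Q₀ (a n) := by
    rw [Measure.restrict_pi_pi]
    refine Measure.pi_eq fun s _ => ?_
    simp only [G.obsLaw_restrict hα h0 hΔ hQ₀ hQ₁, Measure.smul_apply, Measure.pi_pi, smul_eq_mul,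
      Finset.prod_mul_distrib, riskyCount]
    rw [← ENNReal.ofReal_prod_of_nonneg fun n _ => (pow_pos G.failure_pos _).le,
      Finset.prod_pow_eq_pow_sum]
  rw [outcome, outcome, cleanProfile, ← Measure.prod_restrict, hpi, Measure.restrict_univ,
    Measure.prod_smul_left]

lemma ae_outcome_forall {Q : ProbabilityMeasure (G.ArmPath Δ)} {a : Fin N → Bool}
    {P : Fin N → G.Obs Δ → Prop} (h : ∀ n, ∀ᵐ o ∂G.obsLaw Q (a n), P n o) :
    ∀ᵐ z ∂G.outcome Q a, ∀ n, P n (z.1 n) :=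
  Measure.quasiMeasurePreserving_fst.ae <| ae_all_iff.2 fun n =>
    (Measure.quasiMeasurePreserving_eval (fun n => G.obsLaw Q (a n)) n).ae (h n)

lemma outcome_usage (Q : ProbabilityMeasure (G.ArmPath Δ)) (a : Fin N → Bool) :
    ∀ᵐ z ∂G.outcome Q a, G.usage z.1 = riskyCount a := by
  have hobs (b : Bool) : ∀ᵐ o ∂G.obsLaw Q b, o.isRight = b := by
    have hmeas := G.measurable_isRight (Δ := Δ) (measurableSet_singleton b)
    cases b
    · exact (ae_dirac_iff hmeas).2 rfl
    · exact (ae_map_iff measurable_inr.aemeasurable hmeas).2 (Eventually.of_forall fun _ => rfl)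
  filter_upwards [G.ae_outcome_forall fun n => hobs (a n)] with z hz
  simp only [usage, hz]

lemma outcome_clean (h0 : G.lam 0 = 0) (hΔ : 0 < Δ) {Q : ProbabilityMeasure (G.ArmPath Δ)}
    (hQ : G.IsArmLaw Δ 0 Q) (a : Fin N → Bool) : ∀ᵐ z ∂G.outcome Q a, z ∈ G.cleanProfile N Δ := by
  have hobs (b : Bool) : ∀ᵐ o ∂G.obsLaw Q b, o ∈ G.clean Δ := by
    cases b
    · exact (ae_dirac_iff G.measurableSet_clean).2 trivial
    · exact (ae_map_iff measurable_inr.aemeasurable G.measurableSet_clean).2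
        (hQ.ae_mem_lumpFree hΔ h0)
  filter_upwards [G.ae_outcome_forall fun n => hobs (a n)] with z hz
  exact G.mem_cleanProfile.2 hz

lemma ae_step_not_breakthrough (h0 : G.lam 0 = 0) (hΔ : 0 < Δ)
    {Q : ProbabilityMeasure (G.ArmPath Δ)} (hQ : G.IsArmLaw Δ 0 Q) (S : Fin N → G.Strategy N Δ)
    {x : G.Info N Δ} (hx : ¬ G.Breakthrough x) : ∀ᵐ y ∂G.step Q S x, ¬ G.Breakthrough y :=
  G.ae_step Q S G.measurableSet_not_breakthrough fun a _ => by
    filter_upwards [G.outcome_clean h0 hΔ hQ a] with z hz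
    exact fun h => (G.breakthrough_next.1 h).elim hx fun hz' => hz' hz

lemma ae_step_breakthrough (Q : ProbabilityMeasure (G.ArmPath Δ)) (S : Fin N → G.Strategy N Δ)
    {x : G.Info N Δ} (hx : G.Breakthrough x) : ∀ᵐ y ∂G.step Q S x, G.Breakthrough y :=
  G.ae_step Q S G.measurableSet_breakthrough fun _ _ =>
    Eventually.of_forall fun _ => G.breakthrough_next.2 (.inl hx)

lemma integral_decide_le (F : Bool → ℝ) (η : unitInterval) :
    ∫ u : unitInterval, F (decide (u ≤ η)) = η * F true + (1 - η) * F false := by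
  have hvol : volume.real (Set.Iic η) = (η : ℝ) := by
    rw [measureReal_def, unitInterval.volume_Iic, ENNReal.toReal_ofReal (unitInterval.nonneg η)]
  have hF : (fun u : unitInterval => F (decide (u ≤ η))) =
      fun u => F false + (Set.Iic η).indicator (fun _ => F true - F false) u := by
    ext u
    by_cases h : u ≤ η <;> simp [h]
  rw [hF, integral_add (integrable_const _) ((integrable_const _).indicator measurableSet_Iic),
    integral_indicator_const _ measurableSet_Iic, hvol, integral_const, probReal_univ, one_smul,
    smul_eq_mul]
  ring

lemma integral_step_mode (rew : Bool → ℕ → ℕ → unitInterval) (i₀ : Bool)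
    (Q : ProbabilityMeasure (G.ArmPath Δ)) (S : Fin N → G.Strategy N Δ) (x : G.Info N Δ)
    {F : Bool → ℕ → ℝ} {B : ℝ} (hB : ∀ i j, |F i j| ≤ B) :
    ∫ y, F (G.mode rew i₀ y) (G.trials y) ∂G.step Q S x = ∑ a, G.weight S x a *
      (rew (G.mode rew i₀ x) (G.trials x) (riskyCount a) * F true (G.trials x + riskyCount a) +
        (1 - rew (G.mode rew i₀ x) (G.trials x) (riskyCount a)) *
          F false (G.trials x + riskyCount a)) := by
  rw [G.integral_step Q S x (G.measurable_of_mode_trials rew i₀ F) fun y => hB _ _]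
  refine Finset.sum_congr rfl fun a _ => congrArg _ ?_
  set η := rew (G.mode rew i₀ x) (G.trials x) (riskyCount a)
  calc ∫ z, F (G.mode rew i₀ (G.next x z)) (G.trials (G.next x z)) ∂G.outcome Q a
      = ∫ z, F (decide (z.2 ≤ η)) (G.trials x + riskyCount a) ∂G.outcome Q a := by
        refine integral_congr_ae ?_
        filter_upwards [G.outcome_usage Q a] with z hz
        rw [mode_next, trials_next, hz]
    _ = ∫ u, F (decide (u ≤ η)) (G.trials x + riskyCount a) := by
        rw [outcome, integral_fun_snd (fun u => F (decide (u ≤ η)) (G.trials x + riskyCount a)),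
          probReal_univ, one_smul]
    _ = _ := integral_decide_le (fun b => F b (G.trials x + riskyCount a)) η

lemma failure_pow_mul_setIntegral_step (hα : G.α 0 = G.α 1) (h0 : G.lam 0 = 0) (hΔ : 0 < Δ)
    {Q₀ Q₁ : ProbabilityMeasure (G.ArmPath Δ)} (hQ₀ : G.IsArmLaw Δ 0 Q₀) (hQ₁ : G.IsArmLaw Δ 1 Q₁)
    (S : Fin N → G.Strategy N Δ) {x : G.Info N Δ} (hx : ¬ G.Breakthrough x)
    {f : G.Info N Δ → ℝ} (hf : Measurable f) {B : ℝ} (hB : ∀ y, |f y| ≤ B) :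
    G.failure Δ ^ G.trials x * ∫ y in {y | ¬ G.Breakthrough y}, f y ∂G.step Q₁ S x =
      ∫ y, G.failure Δ ^ G.trials y * f y ∂G.step Q₀ S x := by
  have hq := G.failure_pos (Δ := Δ)
  have hq1 := (G.failure_lt_one hα h0 hΔ).le
  have hbound₀ (y : G.Info N Δ) : |G.failure Δ ^ G.trials y * f y| ≤ B := by
    rw [abs_mul, abs_of_pos (pow_pos hq _)]
    exact (mul_le_of_le_one_left (abs_nonneg _) (pow_le_one₀ hq.le hq1)).trans (hB y)
  have hbound₁ (y : G.Info N Δ) : |{y | ¬ G.Breakthrough y}.indicator f y| ≤ B :=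
    (norm_indicator_le_norm_self f y).trans (hB y)
  have hpre : (fun z => {y | ¬ G.Breakthrough y}.indicator f (G.next x z)) =
      (G.cleanProfile N Δ).indicator fun z => f (G.next x z) := by
    ext z
    by_cases hz : z ∈ G.cleanProfile N Δ <;>
      simp [Set.indicator, G.breakthrough_next, hx, hz]
  rw [← integral_indicator G.measurableSet_not_breakthrough,
    G.integral_step Q₁ S x (hf.indicator G.measurableSet_not_breakthrough) hbound₁,
    G.integral_step Q₀ S x (f := fun y => G.failure Δ ^ G.trials y * f y)
      (G.measurable_failure_pow.mul hf) hbound₀,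
    Finset.mul_sum]
  refine Finset.sum_congr rfl fun a _ => ?_
  rw [hpre, integral_indicator G.measurableSet_cleanProfile,
    G.outcome_restrict hα h0 hΔ hQ₀ hQ₁, integral_smul_measure,
    ENNReal.toReal_ofReal (pow_pos hq _).le, smul_eq_mul, mul_left_comm, ← mul_assoc (_ ^ _),
    ← pow_add, ← integral_const_mul]
  refine congrArg _ (integral_congr_ae ?_)
  filter_upwards [G.outcome_usage Q₀ a] with z hz
  rw [trials_next, hz]

end Transitions

end Bandit

lemma nonpos_of_le_discounted {α : Type*} [MeasurableSpace α] {κ : Kernel α α} [IsMarkovKernel κ]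
    {T : Set α} (hT : ∀ x ∈ T, ∀ᵐ y ∂κ x, y ∈ T) {f : α → ℝ} (hf : Measurable f) {B δ : ℝ}
    (hB : ∀ x, |f x| ≤ B) (hδ0 : 0 ≤ δ) (hδ1 : δ < 1) (h : ∀ x ∈ T, f x ≤ δ * ∫ y, f y ∂κ x)
    {x : α} (hx : x ∈ T) : f x ≤ 0 := by
  have hpow (k : ℕ) : ∀ x ∈ T, f x ≤ δ ^ k * B := by
    induction k with
    | zero => exact fun x _ => by simpa using (le_abs_self _).trans (hB x)
    | succ k ih =>
      intro x hx
      have hint : ∫ y, f y ∂κ x ≤ ∫ _, δ ^ k * B ∂κ x :=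
        integral_mono_ae (Integrable.of_bound hf.aestronglyMeasurable B (Eventually.of_forall hB))
          (integrable_const _) ((hT x hx).mono ih)
      rw [integral_const, probReal_univ, one_smul] at hint
      rw [pow_succ', mul_assoc]
      exact (h x hx).trans (mul_le_mul_of_nonneg_left hint hδ0)
  have hlim := (tendsto_pow_atTop_nhds_zero_of_lt_one hδ0 hδ1).mul_const B
  rw [zero_mul] at hlim
  exact ge_of_tendsto' hlim fun k => hpow k x hx

namespace Bandit

variable (G : Bandit) {N : ℕ} {Δ : ℝ≥0} (Q : Fin 2 → ProbabilityMeasure (G.ArmPath Δ))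
  (S : Fin N → G.Strategy N Δ) (n : Fin N)

section Cost

lemma regret_one_eq_zero (hΔ : 0 < Δ) {T : Set (G.Info N Δ)}
    (hT : ∀ x ∈ T, ∀ᵐ y ∂G.step (Q 1) S x, y ∈ T) (hS : ∀ x ∈ T, (S n).act x = 1)
    {x : G.Info N Δ} (hx : x ∈ T) : G.regret Q S n 1 x = 0 := by
  refine le_antisymm (nonpos_of_le_discounted hT (G.measurable_regret Q S n 1 hΔ)
    (G.abs_regret_le_one Q S n 1 hΔ) G.discount_pos.le (G.discount_lt_one hΔ) (fun y hy => ?_) hx)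
    (G.regret_nonneg Q S n 1 hΔ x)
  have herror : G.errorProb S n 1 y = 0 := by simp [errorProb, hS y hy]
  rw [G.regret_rec Q S n 1 hΔ y, herror, mul_zero, zero_add]

lemma regret_one_of_breakthrough (hΔ : 0 < Δ) (hS : ∀ x, G.Breakthrough x → (S n).act x = 1)
    {x : G.Info N Δ} (hx : G.Breakthrough x) : G.regret Q S n 1 x = 0 :=
  G.regret_one_eq_zero Q S n hΔ (T := {x | G.Breakthrough x})
    (fun _ hy => G.ae_step_breakthrough (Q 1) S hy) hS hx

/-- Expected shortfall of player `n`'s continuation payoff from the payoff under full information,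
before a breakthrough and if the odds ratio of the prior is `X`. The unit is the expected payoff
loss from using the risky arm in the bad state. -/
noncomputable def cost (X : ℝ) (x : G.Info N Δ) : ℝ :=
  X * (G.failure Δ ^ G.trials x * G.regret Q S n 1 x) + G.regret Q S n 0 x

/-- Bellman operator of `cost`. Expectations are taken in the bad state, where there is no
breakthrough; the good state only enters through the factor `G.failure Δ ^ G.trials x`. -/
noncomputable def bellman (X : ℝ) (F : G.Info N Δ → ℝ) (x : G.Info N Δ) : ℝ :=
  (1 - G.discount Δ) *
      ((1 - (S n).act x) * (X * G.failure Δ ^ G.trials x) + (S n).act x) +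
    G.discount Δ * ∫ y, F y ∂G.step (Q 0) S x

lemma bellman_sub {F F' : G.Info N Δ → ℝ} {X : ℝ} {x : G.Info N Δ}
    (hF : Integrable F (G.step (Q 0) S x)) (hF' : Integrable F' (G.step (Q 0) S x)) :
    G.bellman Q S n X F x - G.bellman Q S n X F' x =
      G.discount Δ * ∫ y, (F y - F' y) ∂G.step (Q 0) S x := by
  rw [bellman, bellman, add_sub_add_left_eq_sub, integral_sub hF hF', mul_sub]

lemma cost_nonneg {X : ℝ} (hX : 0 ≤ X) (hΔ : 0 < Δ) (x : G.Info N Δ) : 0 ≤ G.cost Q S n X x :=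
  add_nonneg (mul_nonneg hX (mul_nonneg (pow_pos G.failure_pos _).le
    (G.regret_nonneg Q S n 1 hΔ x))) (G.regret_nonneg Q S n 0 hΔ x)

lemma measurable_cost (X : ℝ) (hΔ : 0 < Δ) : Measurable (G.cost Q S n X) :=
  ((G.measurable_failure_pow.mul (G.measurable_regret Q S n 1 hΔ)).const_mul X).add
    (G.measurable_regret Q S n 0 hΔ)

variable (hα : G.α 0 = G.α 1) (h0 : G.lam 0 = 0) (hΔ : 0 < Δ)

include hα h0 hΔ

lemma abs_failure_pow_mul_regret_le (x : G.Info N Δ) :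
    |G.failure Δ ^ G.trials x * G.regret Q S n 1 x| ≤ 1 := by
  rw [abs_mul, abs_of_pos (pow_pos G.failure_pos _)]
  exact mul_le_one₀ (pow_le_one₀ G.failure_pos.le (G.failure_lt_one hα h0 hΔ).le) (abs_nonneg _)
    (G.abs_regret_le_one Q S n 1 hΔ x)

lemma abs_cost_le (X : ℝ) (x : G.Info N Δ) : |G.cost Q S n X x| ≤ |X| + 1 := by
  refine (abs_add_le _ _).trans (add_le_add ?_ (G.abs_regret_le_one Q S n 0 hΔ x))
  rw [abs_mul]
  exact mul_le_of_le_one_right (abs_nonneg X)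
    (G.abs_failure_pow_mul_regret_le Q S n hα h0 hΔ x)

lemma integrable_cost (X : ℝ) (μ : Measure (G.Info N Δ)) [IsFiniteMeasure μ] :
    Integrable (G.cost Q S n X) μ :=
  Integrable.of_bound (G.measurable_cost Q S n X hΔ).aestronglyMeasurable _
    (Eventually.of_forall (G.abs_cost_le Q S n hα h0 hΔ X))

variable {Q} (hQ : ∀ θ, G.IsArmLaw Δ θ (Q θ))

include hQ

lemma cost_eq_bellman_add (X : ℝ) {x : G.Info N Δ} (hx : ¬ G.Breakthrough x) :
    G.cost Q S n X x = G.bellman Q S n X (G.cost Q S n X) x +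
      G.discount Δ * (X * (G.failure Δ ^ G.trials x *
        ∫ y in {y | G.Breakthrough y}, G.regret Q S n 1 y ∂G.step (Q 1) S x)) := by
  have hsplit := integral_add_compl G.measurableSet_not_breakthrough
    (G.integrable_regret Q S n 1 hΔ (G.step (Q 1) S x))
  simp only [Set.compl_ofPred, not_not] at hsplit
  have hint : Integrable (fun y => G.failure Δ ^ G.trials y * G.regret Q S n 1 y)
      (G.step (Q 0) S x) :=
    Integrable.of_bound
      (G.measurable_failure_pow.mul (G.measurable_regret Q S n 1 hΔ)).aestronglyMeasurable 1
      (Eventually.of_forall (G.abs_failure_pow_mul_regret_le Q S n hα h0 hΔ))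
  have hcost : ∫ y, G.cost Q S n X y ∂G.step (Q 0) S x =
      X * (G.failure Δ ^ G.trials x *
        ∫ y in {y | ¬ G.Breakthrough y}, G.regret Q S n 1 y ∂G.step (Q 1) S x) +
      ∫ y, G.regret Q S n 0 y ∂G.step (Q 0) S x := by
    rw [G.failure_pow_mul_setIntegral_step hα h0 hΔ (hQ 0) (hQ 1) S hx
      (G.measurable_regret Q S n 1 hΔ) (G.abs_regret_le_one Q S n 1 hΔ), ← integral_const_mul,
      ← integral_add (hint.const_mul X) (G.integrable_regret Q S n 0 hΔ _)]
    rfl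
  rw [bellman, hcost, cost, G.regret_rec Q S n 1 hΔ x, G.regret_rec Q S n 0 hΔ x, ← hsplit]
  simp only [errorProb, if_true, Fin.zero_eq_one_iff, OfNat.ofNat_ne_one, if_false]
  ring

lemma bellman_cost_le {X : ℝ} (hX : 0 ≤ X) {x : G.Info N Δ} (hx : ¬ G.Breakthrough x) :
    G.bellman Q S n X (G.cost Q S n X) x ≤ G.cost Q S n X x := by
  rw [G.cost_eq_bellman_add S n hα h0 hΔ hQ X hx]
  exact le_add_of_nonneg_right (mul_nonneg G.discount_pos.le (mul_nonneg hX
    (mul_nonneg (pow_pos G.failure_pos _).le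
      (integral_nonneg (G.regret_nonneg Q S n 1 hΔ)))))

lemma bellman_cost_eq (hS : ∀ x, G.Breakthrough x → (S n).act x = 1) (X : ℝ) {x : G.Info N Δ}
    (hx : ¬ G.Breakthrough x) : G.bellman Q S n X (G.cost Q S n X) x = G.cost Q S n X x := by
  have hzero : ∫ y in {y | G.Breakthrough y}, G.regret Q S n 1 y ∂G.step (Q 1) S x = 0 :=
    setIntegral_eq_zero_of_forall_eq_zero fun y hy =>
      G.regret_one_of_breakthrough Q S n hΔ hS hy
  rw [G.cost_eq_bellman_add S n hα h0 hΔ hQ X hx, hzero, mul_zero, mul_zero, mul_zero, add_zero]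

lemma le_cost {X : ℝ} (hX : 0 ≤ X) {F : G.Info N Δ → ℝ} (hF : Measurable F) {B : ℝ}
    (hB : ∀ x, |F x| ≤ B) (h : ∀ x, ¬ G.Breakthrough x → F x ≤ G.bellman Q S n X F x)
    {x : G.Info N Δ} (hx : ¬ G.Breakthrough x) : F x ≤ G.cost Q S n X x := by
  refine sub_nonpos.1 (nonpos_of_le_discounted (T := {x | ¬ G.Breakthrough x})
    (fun y hy => G.ae_step_not_breakthrough h0 hΔ (hQ 0) S hy)
    (hF.sub (G.measurable_cost Q S n X hΔ))
    (fun y => (abs_sub _ _).trans (add_le_add (hB y) (G.abs_cost_le Q S n hα h0 hΔ X y)))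
    G.discount_pos.le (G.discount_lt_one hΔ) (fun y hy => ?_) hx)
  simp only [Pi.sub_apply]
  rw [← G.bellman_sub Q S n (X := X)
    (Integrable.of_bound hF.aestronglyMeasurable B (Eventually.of_forall hB))
    (G.integrable_cost Q S n hα h0 hΔ X _)]
  exact sub_le_sub (h y hy) (G.bellman_cost_le S n hα h0 hΔ hQ hX hy)

lemma cost_le (hS : ∀ x, G.Breakthrough x → (S n).act x = 1) {X : ℝ} {F : G.Info N Δ → ℝ}
    (hF : Measurable F) {B : ℝ} (hB : ∀ x, |F x| ≤ B)
    (h : ∀ x, ¬ G.Breakthrough x → G.bellman Q S n X F x ≤ F x)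
    {x : G.Info N Δ} (hx : ¬ G.Breakthrough x) : G.cost Q S n X x ≤ F x := by
  refine sub_nonpos.1 (nonpos_of_le_discounted (T := {x | ¬ G.Breakthrough x})
    (fun y hy => G.ae_step_not_breakthrough h0 hΔ (hQ 0) S hy)
    ((G.measurable_cost Q S n X hΔ).sub hF)
    (fun y => (abs_sub _ _).trans (add_le_add (G.abs_cost_le Q S n hα h0 hΔ X y) (hB y)))
    G.discount_pos.le (G.discount_lt_one hΔ) (fun y hy => ?_) hx)
  simp only [Pi.sub_apply]
  rw [← G.bellman_sub Q S n (X := X) (G.integrable_cost Q S n hα h0 hΔ X _)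
    (Integrable.of_bound hF.aestronglyMeasurable B (Eventually.of_forall hB))]
  exact sub_le_sub (G.bellman_cost_eq S n hα h0 hΔ hQ hS X hy).ge (h y hy)

end Cost

section Payoffs

lemma contPayoff_eq_sub (hΔ : 0 < Δ) {b : ℝ} (hb : b ≠ 1) (x : G.Info N Δ) :
    G.contPayoff Q S n b x = b * G.m 1 + (1 - b) * G.s - (1 - b) * (G.s - G.m 0) *
      (G.odds b * G.regret Q S n 1 x + G.regret Q S n 0 x) := by
  have hodds : (1 - b) * (G.s - G.m 0) * G.odds b = b * (G.m 1 - G.s) := by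
    rw [odds, mul_div_cancel₀ _ (mul_ne_zero (sub_ne_zero.2 hb.symm) G.loss_pos.ne')]
  rw [contPayoff, G.statePayoff_one Q S n hΔ, G.statePayoff_zero Q S n hΔ]
  linear_combination G.regret Q S n 1 x * hodds

lemma contPayoff_one (hΔ : 0 < Δ) (x : G.Info N Δ) :
    G.contPayoff Q S n 1 x = G.m 1 - (G.m 1 - G.s) * G.regret Q S n 1 x := by
  rw [contPayoff, sub_self, zero_mul, add_zero, one_mul, G.statePayoff_one Q S n hΔ]

lemma contPayoff_one_le_of_regret_eq_zero (hΔ : 0 < Δ) {S' : Fin N → G.Strategy N Δ}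
    {x : G.Info N Δ} (hx : G.regret Q S' n 1 x = 0) :
    G.contPayoff Q S n 1 x ≤ G.contPayoff Q S' n 1 x := by
  rw [G.contPayoff_one Q S n hΔ, G.contPayoff_one Q S' n hΔ, hx, mul_zero, sub_zero]
  exact sub_le_self _ (mul_nonneg G.gain_pos.le (G.regret_nonneg Q S n 1 hΔ x))

lemma contPayoff_belief (hα : G.α 0 = G.α 1) (h0 : G.lam 0 = 0) (hΔ : 0 < Δ) {p : ℝ} (hp : 0 < p)
    (hp1 : p < 1) {x : G.Info N Δ} (hx : ¬ G.Breakthrough x) :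
    G.contPayoff Q S n (G.belief p x) x = G.belief p x * G.m 1 + (1 - G.belief p x) * G.s -
      (1 - G.belief p x) * (G.s - G.m 0) * G.cost Q S n (G.odds p) x := by
  rw [G.contPayoff_eq_sub Q S n hΔ (G.belief_mem_Ioo hα h0 hp hp1 hx).2.ne,
    G.odds_belief hα h0 hp hp1 hx, cost, mul_assoc (G.odds p)]

lemma isPBE_of_cost_le (hα : G.α 0 = G.α 1) (h0 : G.lam 0 = 0) (hΔ : 0 < Δ) {p : ℝ} (hp : 0 < p)
    (hp1 : p < 1) (hS : ∀ n x, G.Breakthrough x → (S n).act x = 1)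
    (hcost : ∀ n T x, ¬ G.Breakthrough x →
      G.cost Q S n (G.odds p) x ≤ G.cost Q (Function.update S n T) n (G.odds p) x) :
    G.IsPBE Q p S := by
  intro x n T
  by_cases hx : G.Breakthrough x
  · rw [G.belief_of_breakthrough hα h0 hp hx]
    exact G.contPayoff_one_le_of_regret_eq_zero Q _ n hΔ
      (G.regret_one_of_breakthrough Q S n hΔ (hS n) hx)
  · rw [G.contPayoff_belief Q S n hα h0 hΔ hp hp1 hx,
      G.contPayoff_belief Q (Function.update S n T) n hα h0 hΔ hp hp1 hx]
    exact sub_le_sub_left (mul_le_mul_of_nonneg_left (hcost n T x hx) (mul_pos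
      (sub_pos.2 (G.belief_mem_Ioo hα h0 hp hp1 hx).2) G.loss_pos).le) _

lemma payoff_eq_sub_cost (hα : G.α 0 = G.α 1) (h0 : G.lam 0 = 0) (hΔ : 0 < Δ) {p : ℝ}
    (hp1 : p < 1) : G.payoff Q S n p = p * G.m 1 + (1 - p) * G.s -
      (1 - p) * (G.s - G.m 0) * ∫ u, G.cost Q S n (G.odds p) (G.start N Δ u) := by
  have hstart (u : unitInterval) : G.contPayoff Q S n p (G.start N Δ u) =
      p * G.m 1 + (1 - p) * G.s -
        (1 - p) * (G.s - G.m 0) * G.cost Q S n (G.odds p) (G.start N Δ u) := by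
    rw [G.contPayoff_eq_sub Q S n hΔ hp1.ne, cost, trials_start, pow_zero, one_mul]
  have hint : Integrable fun u => G.cost Q S n (G.odds p) (G.start N Δ u) :=
    (integrable_map_measure (G.measurable_cost Q S n (G.odds p) hΔ).aestronglyMeasurable
      G.measurable_start.aemeasurable).1
        (G.integrable_cost Q S n hα h0 hΔ (G.odds p) (volume.map (G.start N Δ)))
  rw [payoff, integral_congr_ae (Eventually.of_forall hstart),
    integral_sub (integrable_const _) (hint.const_mul _), integral_const, probReal_univ, one_smul,
    integral_const_mul]

lemma le_payoff_of_cost_le (hα : G.α 0 = G.α 1) (h0 : G.lam 0 = 0) (hΔ : 0 < Δ) {p : ℝ}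
    (hp : 0 < p) (hp1 : p < 1) {c : ℝ}
    (h : ∀ u, G.cost Q S n (G.odds p) (G.start N Δ u) ≤ c) :
    p * G.m 1 + (1 - p) * G.s - (1 - p) * (G.s - G.m 0) * c ≤ G.payoff Q S n p := by
  have hint : ∫ u, G.cost Q S n (G.odds p) (G.start N Δ u) ≤ c :=
    (integral_mono_of_nonneg
      (Eventually.of_forall fun _ => G.cost_nonneg Q S n (G.odds_pos hp hp1).le hΔ _)
      (integrable_const c) (Eventually.of_forall h)).trans_eq (by simp)
  rw [G.payoff_eq_sub_cost Q S n hα h0 hΔ hp1]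
  exact sub_le_sub_left (mul_le_mul_of_nonneg_left hint
    (mul_pos (sub_pos.2 hp1) G.loss_pos).le) _

end Payoffs

end Bandit

section Binomial

lemma sum_bool_insertNth {M : ℕ} (n : Fin (M + 1)) (w : Fin (M + 1) → ℝ) (g : ℕ → ℝ) :
    ∑ a : Fin (M + 1) → Bool, (∏ i, if a i then w i else 1 - w i) * g (riskyCount a) =
      (1 - w n) * ∑ a : Fin M → Bool, (∏ i, if a i then w (n.succAbove i) else
        1 - w (n.succAbove i)) * g (riskyCount a) +
      w n * ∑ a : Fin M → Bool, (∏ i, if a i then w (n.succAbove i) else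
        1 - w (n.succAbove i)) * g (riskyCount a + 1) := by
  rw [← (Fin.insertNthEquiv (fun _ => Bool) n).sum_comp, Fintype.sum_prod_type, Fintype.sum_bool,
    add_comm, Finset.mul_sum, Finset.mul_sum]
  simp only [riskyCount, Fin.insertNthEquiv_apply, Fin.prod_univ_succAbove _ n,
    Fin.sum_univ_succAbove _ n, Fin.insertNth_apply_same, Fin.insertNth_apply_succAbove, if_true,
    Bool.false_eq_true, if_false, Bool.toNat_true, Bool.toNat_false, zero_add, mul_assoc,
    add_comm 1]

lemma sum_bool_eq_binomExp (M : ℕ) (π : ℝ) (g : ℕ → ℝ) :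
    ∑ a : Fin M → Bool, (∏ i, if a i then π else 1 - π) * g (riskyCount a) = binomExp M π g := by
  induction M generalizing g with
  | zero => simp [binomExp, riskyCount]
  | succ M ih =>
    rw [sum_bool_insertNth 0 (fun _ => π) g, ih g, ih fun k => g (k + 1)]
    rfl

end Binomial

namespace Bandit

variable (G : Bandit) {M N : ℕ} {Δ : ℝ≥0} {Q : Fin 2 → ProbabilityMeasure (G.ArmPath Δ)}

section SymmetricOpponents

variable (S : Fin (M + 1) → G.Strategy (M + 1) Δ) (n : Fin (M + 1)) (x : G.Info (M + 1) Δ) {π : ℝ}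
  (hπ : ∀ i, i ≠ n → ((S i).act x : ℝ) = π)

include hπ

lemma sum_weight_riskyCount (g : ℕ → ℝ) :
    ∑ a, G.weight S x a * g (riskyCount a) = (1 - ((S n).act x : ℝ)) * binomExp M π g +
      ((S n).act x : ℝ) * binomExp M π (fun k => g (k + 1)) := by
  have h := sum_bool_insertNth n (fun i => ((S i).act x : ℝ)) g
  simp only [hπ _ (Fin.succAbove_ne n _)] at h
  rw [sum_bool_eq_binomExp M π g, sum_bool_eq_binomExp M π fun k => g (k + 1)] at h
  exact h

lemma bellman_mode (A : Automaton) (i₀ : Bool) (X : ℝ) {val : Bool → ℕ → ℝ} {B : ℝ}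
    (hB : ∀ i j, |val i j| ≤ B) :
    G.bellman Q S n X (fun y => val (G.mode A.rew i₀ y) (G.trials y)) x =
      (1 - ((S n).act x : ℝ)) * safeCost M (G.discount Δ) (X * G.failure Δ ^ G.trials x) π
        (A.cont val (G.mode A.rew i₀ x) (G.trials x)) +
      ((S n).act x : ℝ) * riskyCost M (G.discount Δ) π
        (A.cont val (G.mode A.rew i₀ x) (G.trials x)) := by
  have hsum := G.sum_weight_riskyCount S n x hπ (A.cont val (G.mode A.rew i₀ x) (G.trials x))
  simp only [Automaton.cont] at hsum
  rw [bellman, G.integral_step_mode A.rew i₀ (Q 0) S x hB, hsum, safeCost, riskyCost]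
  simp only [Automaton.cont]
  ring

end SymmetricOpponents

section UntilBreakthrough

/-- The strategy that prescribes the mixed action `g x` before a breakthrough and the risky arm
from then on. -/
noncomputable def untilBreakthrough (g : G.Info N Δ → unitInterval) (hg : Measurable g) :
    G.Strategy N Δ where
  act x := open Classical in if G.Breakthrough x then 1 else g x
  measurable_act := Measurable.ite G.measurableSet_breakthrough measurable_const hg

variable {g : G.Info N Δ → unitInterval} {hg : Measurable g} {x : G.Info N Δ}

lemma untilBreakthrough_act_of_breakthrough (hx : G.Breakthrough x) :
    (G.untilBreakthrough g hg).act x = 1 := if_pos hx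

lemma untilBreakthrough_act_of_not_breakthrough (hx : ¬ G.Breakthrough x) :
    (G.untilBreakthrough g hg).act x = g x := if_neg hx

end UntilBreakthrough

section Play

variable (A : Automaton) (i₀ : Bool)

/-- The profile in which all players follow the automaton `A` with initial mode `i₀` until the first
breakthrough, and use the risky arm from then on. -/
noncomputable def play (N : ℕ) (Δ : ℝ≥0) : Fin N → G.Strategy N Δ := fun _ =>
  G.untilBreakthrough (fun x => A.mix (G.mode A.rew i₀ x) (G.trials x))
    (G.measurable_of_mode_trials A.rew i₀ A.mix)

variable {A}

lemma play_act_of_breakthrough (n : Fin N) {x : G.Info N Δ} (hx : G.Breakthrough x) :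
    (G.play A i₀ N Δ n).act x = 1 := G.untilBreakthrough_act_of_breakthrough hx

lemma play_act_of_not_breakthrough (n : Fin N) {x : G.Info N Δ} (hx : ¬ G.Breakthrough x) :
    (G.play A i₀ N Δ n).act x = A.mix (G.mode A.rew i₀ x) (G.trials x) :=
  G.untilBreakthrough_act_of_not_breakthrough hx

variable {X : ℝ} {val : Bool → ℕ → ℝ}
  (hA : A.IsEquilibrium M (G.discount Δ) (G.failure Δ) X val) (n : Fin (M + 1))

include hA

lemma le_bellman_update_play (T : G.Strategy (M + 1) Δ) {x : G.Info (M + 1) Δ}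
    (hx : ¬ G.Breakthrough x) :
    val (G.mode A.rew i₀ x) (G.trials x) ≤
      G.bellman Q (Function.update (G.play A i₀ (M + 1) Δ) n T) n X
        (fun y => val (G.mode A.rew i₀ y) (G.trials y)) x := by
  have hstage := hA.stage (G.mode A.rew i₀ x) (G.trials x)
  rw [G.bellman_mode _ n x (fun i hi => congrArg _ <| by
    rw [Function.update_of_ne hi, G.play_act_of_not_breakthrough i₀ i hx]) A i₀ X hA.abs_le_one]
  exact Convex.min_le_combo _ _ (unitInterval.one_minus_nonneg _) (unitInterval.nonneg _)
    (sub_add_cancel _ _) |>.trans' (le_min hstage.le_safe hstage.le_risky)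

lemma bellman_play {x : G.Info (M + 1) Δ} (hx : ¬ G.Breakthrough x) :
    G.bellman Q (G.play A i₀ (M + 1) Δ) n X (fun y => val (G.mode A.rew i₀ y) (G.trials y)) x =
      val (G.mode A.rew i₀ x) (G.trials x) := by
  rw [G.bellman_mode _ n x (fun i _ => congrArg _ (G.play_act_of_not_breakthrough i₀ i hx)) A i₀ X
    hA.abs_le_one, G.play_act_of_not_breakthrough i₀ n hx]
  exact (hA.stage _ _).mixed

variable (hα : G.α 0 = G.α 1) (h0 : G.lam 0 = 0) (hΔ : 0 < Δ) (hQ : ∀ θ, G.IsArmLaw Δ θ (Q θ))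

include hα h0 hΔ hQ

lemma le_cost_update_play (hX : 0 ≤ X) (T : G.Strategy (M + 1) Δ) {x : G.Info (M + 1) Δ}
    (hx : ¬ G.Breakthrough x) :
    val (G.mode A.rew i₀ x) (G.trials x) ≤
      G.cost Q (Function.update (G.play A i₀ (M + 1) Δ) n T) n X x :=
  G.le_cost _ n hα h0 hΔ hQ hX (G.measurable_of_mode_trials A.rew i₀ val)
    (fun _ => hA.abs_le_one _ _) (fun _ => G.le_bellman_update_play i₀ hA n T) hx

lemma cost_play (hX : 0 ≤ X) {x : G.Info (M + 1) Δ} (hx : ¬ G.Breakthrough x) :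
    G.cost Q (G.play A i₀ (M + 1) Δ) n X x = val (G.mode A.rew i₀ x) (G.trials x) := by
  refine le_antisymm (G.cost_le _ n hα h0 hΔ hQ
    (fun _ => G.play_act_of_breakthrough i₀ n) (G.measurable_of_mode_trials A.rew i₀ val)
    (fun _ => hA.abs_le_one _ _) (fun _ hy => (G.bellman_play i₀ hA n hy).le) hx) ?_
  simpa only [Function.update_eq_self] using
    G.le_cost_update_play i₀ hA n hα h0 hΔ hQ hX (G.play A i₀ (M + 1) Δ n) hx

end Play

section Equilibrium

variable {A : Automaton} (i₀ : Bool) {p : ℝ} {val : Bool → ℕ → ℝ}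
  (hA : A.IsEquilibrium M (G.discount Δ) (G.failure Δ) (G.odds p) val)
  (hα : G.α 0 = G.α 1) (h0 : G.lam 0 = 0) (hΔ : 0 < Δ) (hQ : ∀ θ, G.IsArmLaw Δ θ (Q θ))
  (hp : 0 < p) (hp1 : p < 1)

include hA hα h0 hΔ hQ hp hp1

lemma isSSE_play : G.IsSSE Q p (G.play A i₀ (M + 1) Δ) := by
  have hX := (G.odds_pos hp hp1).le
  refine ⟨G.isPBE_of_cost_le Q _ hα h0 hΔ hp hp1 (fun n _ => G.play_act_of_breakthrough i₀ n)
    fun n T x hx => ?_, fun _ _ _ => rfl⟩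
  rw [G.cost_play i₀ hA n hα h0 hΔ hQ hX hx]
  exact G.le_cost_update_play i₀ hA n hα h0 hΔ hQ hX T hx

lemma payoff_play (n : Fin (M + 1)) :
    G.payoff Q (G.play A i₀ (M + 1) Δ) n p =
      p * G.m 1 + (1 - p) * G.s - (1 - p) * (G.s - G.m 0) * val i₀ 0 := by
  have hcost (u : unitInterval) :
      G.cost Q (G.play A i₀ (M + 1) Δ) n (G.odds p) (G.start (M + 1) Δ u) = val i₀ 0 := by
    rw [G.cost_play i₀ hA n hα h0 hΔ hQ (G.odds_pos hp hp1).le (G.not_breakthrough_start u),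
      mode_start, trials_start]
  simp only [G.payoff_eq_sub_cost Q _ n hα h0 hΔ hp1, hcost, integral_const, probReal_univ,
    one_smul]

end Equilibrium

section BestReply

variable {p : ℝ} (hα : G.α 0 = G.α 1) (h0 : G.lam 0 = 0) (hΔ : 0 < Δ) (hp : 0 < p) (hp1 : p < 1)

include hα h0 hΔ hp hp1

lemma payoff_le_bestReplyPayoff (S : Fin N → G.Strategy N Δ) (n : Fin N) (T : G.Strategy N Δ) :
    G.payoff Q (Function.update S n T) n p ≤ G.bestReplyPayoff Q S n p := by
  refine le_ciSup (f := fun T => G.payoff Q (Function.update S n T) n p)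
    ⟨p * G.m 1 + (1 - p) * G.s, Set.forall_mem_range.2 fun T => ?_⟩ T
  rw [G.payoff_eq_sub_cost Q _ n hα h0 hΔ hp1]
  exact sub_le_self _ (mul_nonneg (mul_pos (sub_pos.2 hp1) G.loss_pos).le
    (integral_nonneg fun u => G.cost_nonneg Q _ n (G.odds_pos hp hp1).le hΔ _))

end BestReply

section FreeRiding

/-- The strategy that uses the risky arm after a breakthrough and at odds ratios above the upper
cutoff, and the safe arm otherwise, where `X` is the odds ratio of the prior. Against opponents who
experiment between the cutoffs, it bounds the best-reply payoff from below. -/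
noncomputable def highCutReply (M : ℕ) (X : ℝ) : G.Strategy N Δ :=
  G.untilBreakthrough
    (fun x =>
      if highCut M (G.discount Δ) (G.failure Δ) ≤ X * G.failure Δ ^ G.trials x then 1 else 0)
    (Measurable.ite (measurableSet_le measurable_const (G.measurable_failure_pow.const_mul X))
      measurable_const measurable_const)

variable {A : Automaton} {X top : ℝ} {val : Bool → ℕ → ℝ}
  (hA : A.IsTwoModeEquilibrium M (G.discount Δ) (G.failure Δ) X top val) (htop : X ≤ top)
  {R : Fin (M + 1) → G.Strategy (M + 1) Δ}
  (hpure : ∀ x, (∀ i, (R i).act x = 0) ∨ ∀ i, (R i).act x = 1)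
  (hrisky : ∀ x, ¬ G.Breakthrough x →
    lowCut (G.discount Δ) (G.failure Δ) < X * G.failure Δ ^ G.trials x →
    X * G.failure Δ ^ G.trials x < highCut M (G.discount Δ) (G.failure Δ) →
    ∀ i, (R i).act x = 1) (n : Fin (M + 1))

include hA htop hpure hrisky

lemma bellman_highCutReply_le {x : G.Info (M + 1) Δ} (hx : ¬ G.Breakthrough x) :
    G.bellman Q (Function.update R n (G.highCutReply M X)) n X (fun y => val false (G.trials y)) x ≤
      val false (G.trials x) := by
  obtain ⟨π, K, hπ, hK, hbinom⟩ : ∃ (π : unitInterval) (K : ℕ), (∀ i, (R i).act x = π) ∧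
      (lowCut (G.discount Δ) (G.failure Δ) < X * G.failure Δ ^ G.trials x →
        X * G.failure Δ ^ G.trials x < highCut M (G.discount Δ) (G.failure Δ) → M ≤ K) ∧
      ∀ g, binomExp M π g = g K := by
    rcases hpure x with hsafe | hall
    · refine ⟨0, 0, hsafe, fun hlow hhigh => ?_, binomExp_zero M⟩
      exact absurd ((hsafe n).symm.trans (hrisky x hx hlow hhigh n)) zero_ne_one
    · exact ⟨1, M, hall, fun _ _ => le_rfl, binomExp_one M⟩
  have hbellman := G.bellman_mode (Q := Q) (Function.update R n (G.highCutReply M X)) n x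
    (fun i hi => congrArg _ <| by rw [Function.update_of_ne hi, hπ i]) A false X
    (val := fun _ => val false) fun _ => hA.abs_le_one false
  have hcont : A.cont (fun _ => val false) (G.mode A.rew false x) (G.trials x) =
      fun k => val false (G.trials x + k) := funext fun k => A.cont_of_eq (fun _ => rfl) _
  have hact : (Function.update R n (G.highCutReply M X) n).act x =
      if highCut M (G.discount Δ) (G.failure Δ) ≤ X * G.failure Δ ^ G.trials x then 1 else 0 := by
    rw [Function.update_self]
    exact G.untilBreakthrough_act_of_not_breakthrough hx
  rw [hcont, hact, safeCost, riskyCost, hbinom, hbinom] at hbellman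
  refine hbellman.trans_le (le_trans (le_of_eq ?_) (hA.free_riding htop (G.trials x) K hK))
  split_ifs <;> simp

variable (hα : G.α 0 = G.α 1) (h0 : G.lam 0 = 0) (hΔ : 0 < Δ) (hQ : ∀ θ, G.IsArmLaw Δ θ (Q θ))

include hα h0 hΔ hQ

lemma cost_highCutReply_le {x : G.Info (M + 1) Δ} (hx : ¬ G.Breakthrough x) :
    G.cost Q (Function.update R n (G.highCutReply M X)) n X x ≤ val false (G.trials x) := by
  refine G.cost_le _ n hα h0 hΔ hQ (fun y hy => ?_)
    (G.measurable_of_mode_trials A.rew false fun _ => val false) (fun _ => hA.abs_le_one _ _)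
    (fun _ => G.bellman_highCutReply_le hA htop hpure hrisky n) hx
  rw [Function.update_self]
  exact G.untilBreakthrough_act_of_breakthrough hy

lemma le_bestReplyPayoff {p : ℝ} (hp : 0 < p) (hp1 : p < 1) (hX : G.odds p = X) :
    p * G.m 1 + (1 - p) * G.s - (1 - p) * (G.s - G.m 0) * val false 0 ≤
      G.bestReplyPayoff Q R n p := by
  subst hX
  refine (G.le_payoff_of_cost_le Q _ n hα h0 hΔ hp hp1 fun u => ?_).trans
    (G.payoff_le_bestReplyPayoff hα h0 hΔ hp hp1 R n (G.highCutReply M (G.odds p)))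
  exact G.cost_highCutReply_le hA htop hpure hrisky n hα h0 hΔ hQ (G.not_breakthrough_start u)

end FreeRiding

end Bandit

namespace Bandit

variable (G : Bandit) {M N : ℕ} {Δ : ℝ≥0}

section PathLaw

variable {S : Fin N → G.Strategy N Δ} {T : Set (G.Info N Δ)} (hT : MeasurableSet T)

include hT

lemma ae_ahead_mem (Q : ProbabilityMeasure (G.ArmPath Δ))
    (hstep : ∀ x ∈ T, ∀ᵐ y ∂G.step Q S x, y ∈ T) (ℓ : ℕ) {x : G.Info N Δ} (hx : x ∈ T) :
    ∀ᵐ y ∂G.ahead Q S ℓ x, y ∈ T := by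
  induction ℓ generalizing x with
  | zero =>
    rw [ahead, Kernel.id_apply]
    exact (ae_dirac_iff hT).2 hx
  | succ ℓ ih =>
    rw [ahead]
    exact Kernel.ae_comp_of_ae_ae hT ((hstep x hx).mono fun y hy => ih hy)

lemma ae_pathLaw_mem {Q : Fin 2 → ProbabilityMeasure (G.ArmPath Δ)}
    (hstart : ∀ u, G.start N Δ u ∈ T) (hstep : ∀ θ, ∀ x ∈ T, ∀ᵐ y ∂G.step (Q θ) S x, y ∈ T) (p : ℝ)
    (ℓ : ℕ) : ∀ᵐ x ∂G.pathLaw Q S p ℓ, x ∈ T := by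
  have hinit : ∀ᵐ x ∂(volume : Measure unitInterval).map (G.start N Δ), x ∈ T :=
    (ae_map_iff G.measurable_start.aemeasurable hT).2 (Eventually.of_forall hstart)
  have hstate (θ : Fin 2) : ∀ᵐ x ∂((volume : Measure unitInterval).map (G.start N Δ)).bind
      (G.ahead (Q θ) S ℓ), x ∈ T :=
    Measure.ae_comp_of_ae_ae hT (hinit.mono fun _ => G.ae_ahead_mem hT (Q θ) (hstep θ) ℓ)
  rw [pathLaw, ae_add_measure_iff]
  exact ⟨Measure.ae_smul_measure (hstate 1) _, Measure.ae_smul_measure (hstate 0) _⟩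

end PathLaw

section AlwaysRisky

/-- The strategy that always prescribes the risky arm. -/
def alwaysRisky (N : ℕ) (Δ : ℝ≥0) : G.Strategy N Δ := ⟨fun _ => 1, measurable_const⟩

lemma isSSE_alwaysRisky (hα : G.α 0 = G.α 1) (h0 : G.lam 0 = 0) (hΔ : 0 < Δ)
    (Q : Fin 2 → ProbabilityMeasure (G.ArmPath Δ)) :
    G.IsSSE Q 1 fun _ : Fin N => G.alwaysRisky N Δ := by
  refine ⟨fun x n T => ?_, fun _ _ _ => rfl⟩
  rw [G.belief_one hα h0 x]
  exact G.contPayoff_one_le_of_regret_eq_zero Q _ n hΔ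
    (G.regret_one_eq_zero Q _ n hΔ (T := Set.univ)
      (fun _ _ => Eventually.of_forall Set.mem_univ) (fun _ _ => rfl) (Set.mem_univ x))

end AlwaysRisky

section OnPath

lemma riskyCount_of_weight_pos {S : Fin N → G.Strategy N Δ} {x : G.Info N Δ}
    (hS : ∀ n, (S n).act x = 1) {a : Fin N → Bool} (ha : 0 < G.weight S x a) :
    riskyCount a = N := by
  have hrisky (n : Fin N) : a n = true := by
    by_contra hn
    exact ha.ne' (Finset.prod_eq_zero (Finset.mem_univ n) (by simp [hn, hS n]))
  simp [riskyCount, hrisky]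

variable {A : Automaton} {X top : ℝ} {val : Bool → ℕ → ℝ}
  (hA : A.IsTwoModeEquilibrium M (G.discount Δ) (G.failure Δ) X top val)
  (hα : G.α 0 = G.α 1) (h0 : G.lam 0 = 0) (hΔ : 0 < Δ) (hX : 0 < X)

include hA hα h0 hΔ hX

lemma ae_step_play_mode (Q : ProbabilityMeasure (G.ArmPath Δ)) {x : G.Info (M + 1) Δ}
    (hx : ¬ G.Breakthrough x)
    (hmode : highCut M (G.discount Δ) (G.failure Δ) ≤ X * G.failure Δ ^ G.trials x →
      G.mode A.rew true x = true) :
    ∀ᵐ y ∂G.step Q (G.play A true (M + 1) Δ) x,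
      highCut M (G.discount Δ) (G.failure Δ) ≤ X * G.failure Δ ^ G.trials y →
        G.mode A.rew true y = true := by
  refine G.ae_step Q _ (measurableSet_setOfPred.2 (G.measurable_of_mode_trials A.rew true
    fun i j => highCut M (G.discount Δ) (G.failure Δ) ≤ X * G.failure Δ ^ j → i = true))
    fun a ha => ?_
  by_cases hj : highCut M (G.discount Δ) (G.failure Δ) ≤ X * G.failure Δ ^ G.trials x
  · have hact (n : Fin (M + 1)) : (G.play A true (M + 1) Δ n).act x = 1 := by
      rw [G.play_act_of_not_breakthrough true n hx, hmode hj, hA.mix_high _ hj]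
    filter_upwards [G.outcome_usage Q a] with z hz _
    rw [mode_next, hz, G.riskyCount_of_weight_pos hact ha, hmode hj, hA.rew_all]
    exact decide_eq_true (unitInterval.le_one z.2)
  · refine Eventually.of_forall fun z hz => absurd (hz.trans ?_) hj
    exact (G.rates hα h0 hΔ).grid_anti hX ((Nat.le_add_right _ _).trans_eq (G.trials_next x z).symm)

lemma ae_pathLaw_play_mode (Q : Fin 2 → ProbabilityMeasure (G.ArmPath Δ)) (p : ℝ) (ℓ : ℕ) :
    ∀ᵐ x ∂G.pathLaw Q (G.play A true (M + 1) Δ) p ℓ, G.Breakthrough x ∨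
      (highCut M (G.discount Δ) (G.failure Δ) ≤ X * G.failure Δ ^ G.trials x →
        G.mode A.rew true x = true) := by
  refine G.ae_pathLaw_mem (T := {x | G.Breakthrough x ∨ _})
    (G.measurableSet_breakthrough.union (measurableSet_setOfPred.2
      (G.measurable_of_mode_trials A.rew true fun i j =>
        highCut M (G.discount Δ) (G.failure Δ) ≤ X * G.failure Δ ^ j → i = true)))
    (fun u => .inr fun _ => G.mode_start A.rew true u) (fun θ x hx => ?_) p ℓ
  by_cases hB : G.Breakthrough x
  · exact (G.ae_step_breakthrough (Q θ) _ hB).mono fun _ => .inl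
  · exact (G.ae_step_play_mode hA hα h0 hΔ hX (Q θ) hB (hx.resolve_left hB)).mono fun _ => .inr

end OnPath

section Thresholds

variable {A : Automaton} {p top : ℝ} {val : Bool → ℕ → ℝ}
  (hA : A.IsTwoModeEquilibrium M (G.discount Δ) (G.failure Δ) (G.odds p) top val)
  (hα : G.α 0 = G.α 1) (h0 : G.lam 0 = 0) (hp : 0 < p) (hp1 : p < 1) {c : ℝ}

include hA hα h0 hp hp1

lemma play_act_of_belief_lt (i₀ : Bool) (hc1 : c < 1)
    (hlow : G.odds c ≤ lowCut (G.discount Δ) (G.failure Δ)) {x : G.Info (M + 1) Δ}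
    (hx : G.belief p x < c) (n : Fin (M + 1)) : (G.play A i₀ (M + 1) Δ n).act x = 0 := by
  have hB : ¬ G.Breakthrough x := fun h =>
    (hx.trans hc1).ne (G.belief_of_breakthrough hα h0 hp h)
  rw [G.play_act_of_not_breakthrough i₀ n hB]
  refine hA.mix_low _ _ (le_trans ?_ hlow)
  rw [← G.odds_belief hα h0 hp hp1 hB]
  exact (G.odds_lt_odds (G.belief_mem_Ioo hα h0 hp hp1 hB).1 hc1 hx).le

lemma ae_pathLaw_play_act (hΔ : 0 < Δ) (hc : 0 < c)
    (hhigh : highCut M (G.discount Δ) (G.failure Δ) < G.odds c)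
    (Q : Fin 2 → ProbabilityMeasure (G.ArmPath Δ)) (ℓ : ℕ) :
    ∀ᵐ x ∂G.pathLaw Q (G.play A true (M + 1) Δ) p ℓ,
      c < G.belief p x → ∀ n, (G.play A true (M + 1) Δ n).act x = 1 := by
  filter_upwards [G.ae_pathLaw_play_mode hA hα h0 hΔ (G.odds_pos hp hp1) Q p ℓ] with x hmode hx n
  by_cases hB : G.Breakthrough x
  · exact G.play_act_of_breakthrough true n hB
  · have hgrid : highCut M (G.discount Δ) (G.failure Δ) ≤ G.odds p * G.failure Δ ^ G.trials x := by
      rw [← G.odds_belief hα h0 hp hp1 hB]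
      exact (hhigh.trans (G.odds_lt_odds hc (G.belief_mem_Ioo hα h0 hp hp1 hB).2 hx)).le
    rw [G.play_act_of_not_breakthrough true n hB, hmode.resolve_left hB hgrid]
    exact hA.mix_high _ hgrid

end Thresholds

section BeliefRule

lemma measurable_belief (hα : G.α 0 = G.α 1) (h0 : G.lam 0 = 0) {p : ℝ} (hp : 0 < p) :
    Measurable (G.belief p : G.Info N Δ → ℝ) := by
  classical
  have hbelief : (G.belief p : G.Info N Δ → ℝ) = fun x => if G.Breakthrough x then 1 else
      p * G.failure Δ ^ G.trials x / (p * G.failure Δ ^ G.trials x + (1 - p)) := by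
    ext x
    split_ifs with hx
    exacts [G.belief_of_breakthrough hα h0 hp hx, G.belief_of_not_breakthrough hα h0 p hx]
  have hodds := G.measurable_failure_pow (N := N) (Δ := Δ) |>.const_mul p
  rw [hbelief]
  exact Measurable.ite G.measurableSet_breakthrough measurable_const
    (hodds.div (hodds.add_const _))

/-- The strategy that uses the risky arm if and only if the belief lies in `E`. -/
noncomputable def beliefRule {p : ℝ} (hb : Measurable (G.belief p : G.Info N Δ → ℝ)) {E : Set ℝ}
    (hE : MeasurableSet E) : G.Strategy N Δ where
  act x := open Classical in if G.belief p x ∈ E then 1 else 0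
  measurable_act := Measurable.ite (hb hE) measurable_const measurable_const

variable {Q : Fin 2 → ProbabilityMeasure (G.ArmPath Δ)} {A : Automaton} {p top : ℝ}
  {val : Bool → ℕ → ℝ}

lemma payoff_play_le_bestReplyPayoff
    (hA : A.IsTwoModeEquilibrium M (G.discount Δ) (G.failure Δ) (G.odds p) top val)
    (hα : G.α 0 = G.α 1) (h0 : G.lam 0 = 0) (hΔ : 0 < Δ) (hQ : ∀ θ, G.IsArmLaw Δ θ (Q θ))
    (hp : 0 < p) (hp1 : p < 1) (htop : G.odds p ≤ top)
    (hb : Measurable (G.belief p : G.Info (M + 1) Δ → ℝ)) {E : Set ℝ} (hE : MeasurableSet E)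
    (hcuts : ∀ b, 0 < b → b < 1 → lowCut (G.discount Δ) (G.failure Δ) < G.odds b →
      G.odds b < highCut M (G.discount Δ) (G.failure Δ) → b ∈ E) (n : Fin (M + 1)) :
    G.payoff Q (G.play A false (M + 1) Δ) n p ≤
      G.bestReplyPayoff Q (fun _ => G.beliefRule hb hE) n p := by
  rw [G.payoff_play false hA.toIsEquilibrium hα h0 hΔ hQ hp hp1 n]
  refine G.le_bestReplyPayoff hA htop (fun x => ?_) (fun x hx hlow hhigh _ => if_pos ?_) n hα h0 hΔ
    hQ hp hp1 rfl
  · by_cases hx : G.belief p x ∈ E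
    exacts [.inr fun _ => if_pos hx, .inl fun _ => if_neg hx]
  · have hmem := G.belief_mem_Ioo hα h0 hp hp1 hx
    rw [← G.odds_belief hα h0 hp hp1 hx] at hlow hhigh
    exact hcuts _ hmem.1 hmem.2 hlow hhigh

end BeliefRule

end Bandit

lemma exists_nnreal_bound_of_eventually {P : ℝ → Prop} (h : ∀ᶠ t in 𝓝[>] (0 : ℝ), P t) :
    ∃ b : ℝ≥0, 0 < b ∧ ∀ t : ℝ≥0, 0 < t → t < b → P t := by
  obtain ⟨u, hu, hP⟩ := mem_nhdsGT_iff_exists_Ioo_subset.1 h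
  exact ⟨u.toNNReal, Real.toNNReal_pos.2 hu, fun t ht htu =>
    hP ⟨NNReal.coe_pos.2 ht, Real.lt_toNNReal_iff_coe_lt.1 htu⟩⟩

namespace Bandit

variable (G : Bandit) {M : ℕ} {Δ : ℝ≥0} {A : Automaton} {p top clow plow phigh : ℝ}
  {val : Bool → ℕ → ℝ} {Q : Fin 2 → ProbabilityMeasure (G.ArmPath Δ)}
  (hA : A.IsTwoModeEquilibrium M (G.discount Δ) (G.failure Δ) (G.odds p) top val)
  (hα : G.α 0 = G.α 1) (h0 : G.lam 0 = 0) (hΔ : 0 < Δ) (hQ : ∀ θ, G.IsArmLaw Δ θ (Q θ))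
  (hp : 0 < p) (hp1 : p < 1)
  (hlow : G.odds clow ≤ lowCut (G.discount Δ) (G.failure Δ))
  (hhigh : highCut M (G.discount Δ) (G.failure Δ) < G.odds plow)

include hA hα h0 hΔ hQ hp hp1 hlow hhigh

lemma exists_isSSE_risky_above (hclow : clow < 1) (hplow : 0 < plow) :
    ∃ S : Fin (M + 1) → G.Strategy (M + 1) Δ, G.IsSSE Q p S ∧
      (∀ ℓ : ℕ, ∀ᵐ x ∂(G.pathLaw Q S p ℓ), plow < G.belief p x → ∀ n, (S n).act x = 1) ∧
      (∀ x, G.belief p x < clow → ∀ n, (S n).act x = 0) :=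
  ⟨G.play A true (M + 1) Δ,
    G.isSSE_play true hA.toIsEquilibrium hα h0 hΔ hQ hp hp1,
    G.ae_pathLaw_play_act hA hα h0 hp hp1 hΔ hplow hhigh Q,
    fun _ hx n => G.play_act_of_belief_lt hA hα h0 hp hp1 true hclow hlow hx n⟩

lemma exists_isSSE_payoff_le_bestReplyPayoff (hclow : 0 < clow ∧ clow < 1)
    (hplow : 0 < plow ∧ plow < 1) (htop : G.odds p ≤ top) :
    ∃ S : Fin (M + 1) → G.Strategy (M + 1) Δ, G.IsSSE Q p S ∧
      ∃ R : Fin (M + 1) → G.Strategy (M + 1) Δ,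
        (∀ n x,
          (G.belief p x ∈ Set.Icc clow plow ∪ Set.Icc phigh 1 → (R n).act x = 1) ∧
          (G.belief p x ∉ Set.Icc clow plow ∪ Set.Icc phigh 1 → (R n).act x = 0)) ∧
        ∀ n, G.payoff Q S n p ≤ G.bestReplyPayoff Q R n p := by
  have hE : MeasurableSet (Set.Icc clow plow ∪ Set.Icc phigh 1) :=
    measurableSet_Icc.union measurableSet_Icc
  have hcuts (b : ℝ) (hb : 0 < b) (hb1 : b < 1)
      (hlb : lowCut (G.discount Δ) (G.failure Δ) < G.odds b)
      (hbh : G.odds b < highCut M (G.discount Δ) (G.failure Δ)) :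
      b ∈ Set.Icc clow plow ∪ Set.Icc phigh 1 :=
    .inl ⟨(G.odds_le_odds_iff hclow.1 hclow.2 hb hb1).1 (hlow.trans hlb.le),
      (G.odds_le_odds_iff hb hb1 hplow.1 hplow.2).1 (hbh.trans hhigh).le⟩
  exact ⟨G.play A false (M + 1) Δ, G.isSSE_play false hA.toIsEquilibrium hα h0 hΔ hQ hp hp1,
    fun _ => G.beliefRule (G.measurable_belief hα h0 hp) hE,
    fun _ _ => ⟨fun h => if_pos h, fun h => if_neg h⟩,
    G.payoff_play_le_bestReplyPayoff hA hα h0 hΔ hQ hp hp1 htop (G.measurable_belief hα h0 hp) hE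
      hcuts⟩

end Bandit

theorem proposition8_general (G : Bandit) (hρ : G.rho = 0) (h0 : G.lam 0 = 0) (N : ℕ) (hN : 2 ≤ N)
    (μ₁ : ℝ) (hμ₁ : G.IsExponent 1 μ₁) (plow phigh : ℝ) (h1 : G.cutoff μ₁ < plow)
    (h2 : plow < 1) (h3 : phigh < 1) :
    ∃ Δbar : ℝ≥0, 0 < Δbar ∧ ∀ Δ : ℝ≥0, 0 < Δ → Δ < Δbar →
      ∀ Q : Fin 2 → ProbabilityMeasure (G.ArmPath Δ), (∀ θ, G.IsArmLaw Δ θ (Q θ)) →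
        (∀ p : ℝ, plow < p → p ≤ 1 →
          ∃ S : Fin N → G.Strategy N Δ, G.IsSSE Q p S ∧
            (∀ ℓ : ℕ, ∀ᵐ x ∂(G.pathLaw Q S p ℓ),
              plow < G.belief p x → ∀ n, (S n).act x = 1) ∧
            (∀ x, G.belief p x < G.cutoff μ₁ → ∀ n, (S n).act x = 0)) ∧
        (∀ p : ℝ, plow ≤ p → p ≤ phigh →
          ∃ S : Fin N → G.Strategy N Δ, G.IsSSE Q p S ∧
            ∃ R : Fin N → G.Strategy N Δ,
              (∀ n x,
                (G.belief p x ∈ Set.Icc (G.cutoff μ₁) plow ∪ Set.Icc phigh 1 → (R n).act x = 1) ∧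
                (G.belief p x ∉ Set.Icc (G.cutoff μ₁) plow ∪ Set.Icc phigh 1 → (R n).act x = 0)) ∧
              ∀ n, G.payoff Q S n p ≤ G.bestReplyPayoff Q R n p) := by
  obtain ⟨M, rfl⟩ : ∃ M, N = M + 1 := ⟨N - 1, by omega⟩
  have hα := G.alpha_eq_of_rho_eq_zero hρ
  have hl := G.lam_one_pos hα h0
  have hcut := G.odds_cutoff_of_isExponent hρ h0 hμ₁
  have hc0 := G.cutoff_pos hμ₁.1
  have hc1 := h1.trans h2
  have hlow0 := hc0.trans h1
  obtain ⟨Δbar, hpos, hΔbar⟩ := exists_nnreal_bound_of_eventually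
    ((eventually_exists_isTwoModeEquilibrium G.r_pos hl (Nat.le_of_lt_succ hN)
      (G.odds phigh)).and ((tendsto_highCut G.r_pos hl M).eventually_lt_const
        (hcut.symm.trans_lt (G.odds_lt_odds hc0 h2 h1))))
  refine ⟨Δbar, hpos, fun Δ hΔ hlt Q hQ => ?_⟩
  obtain ⟨hequilibrium, hhigh⟩ := hΔbar Δ hΔ hlt
  have hlow := hcut.trans_le (le_lowCut G.r_pos hl hΔ)
  refine ⟨fun p hp hp1 => ?_, fun p hp hp1 => ?_⟩
  · rcases hp1.eq_or_lt with rfl | hp1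
    · exact ⟨fun _ => G.alwaysRisky (M + 1) Δ, G.isSSE_alwaysRisky hα h0 hΔ Q,
        fun _ => .of_forall fun _ _ _ => rfl,
        fun x hx => absurd (G.belief_one hα h0 x ▸ hx) hc1.not_gt⟩
    · have hp0 := hlow0.trans hp
      obtain ⟨A, val, hA⟩ := hequilibrium _ (G.odds_pos hp0 hp1)
      exact G.exists_isSSE_risky_above hA hα h0 hΔ hQ hp0 hp1 hlow hhigh hc1 hlow0
  · have hp0 := hlow0.trans_le hp
    have hp1' := hp1.trans_lt h3
    obtain ⟨A, val, hA⟩ := hequilibrium _ (G.odds_pos hp0 hp1')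
    exact G.exists_isSSE_payoff_le_bestReplyPayoff hA hα h0 hΔ hQ hp0 hp1' hlow hhigh ⟨hc0, hc1⟩
      ⟨hlow0, h2⟩ ((G.odds_le_odds_iff hp0 hp1' (hp0.trans_le hp1) h3).2 hp1)

theorem proposition8 (G : Bandit) (hρ : G.rho = 0) (h0 : G.lam 0 = 0) (N : ℕ) (hN : 2 ≤ N)
    (μ₁ : ℝ) (hμ₁ : G.IsExponent 1 μ₁) (plow phigh : ℝ) (h1 : G.cutoff μ₁ < plow)
    (h2 : plow < G.myopicCutoff) (h3 : G.myopicCutoff < phigh) (h4 : phigh < 1) :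
    ∃ Δbar : ℝ≥0, 0 < Δbar ∧ ∀ Δ : ℝ≥0, 0 < Δ → Δ < Δbar →
      ∀ Q : Fin 2 → ProbabilityMeasure (G.ArmPath Δ), (∀ θ, G.IsArmLaw Δ θ (Q θ)) →
        (∀ p : ℝ, plow < p → p ≤ 1 →
          ∃ S : Fin N → G.Strategy N Δ, G.IsSSE Q p S ∧
            (∀ ℓ : ℕ, ∀ᵐ x ∂(G.pathLaw Q S p ℓ),
              plow < G.belief p x → ∀ n, (S n).act x = 1) ∧
            (∀ x, G.belief p x < G.cutoff μ₁ → ∀ n, (S n).act x = 0)) ∧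
        (∀ p : ℝ, plow ≤ p → p ≤ phigh →
          ∃ S : Fin N → G.Strategy N Δ, G.IsSSE Q p S ∧
            ∃ R : Fin N → G.Strategy N Δ,
              (∀ n x,
                (G.belief p x ∈ Set.Icc (G.cutoff μ₁) plow ∪ Set.Icc phigh 1 → (R n).act x = 1) ∧
                (G.belief p x ∉ Set.Icc (G.cutoff μ₁) plow ∪ Set.Icc phigh 1 → (R n).act x = 0)) ∧
              ∀ n, G.payoff Q S n p ≤ G.bestReplyPayoff Q R n p) :=
  proposition8_general G hρ h0 N hN μ₁ hμ₁ plow phigh h1 (h2.trans (h3.trans h4)) h4
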